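/- Let $\kappa>0$, $\gamma>1$, $\widetilde\gamma\in(1,3)$, and for $\varepsilon>0$, $v>1$ put $$p_\varepsilon(v)=\frac{\varepsilon}{(v-1)^\gamma}+\frac{\kappa}{v^{\widetilde\gamma}},\qquad c_\varepsilon(v)=\sqrt{-p_\varepsilon'(v)},\qquad \theta_\varepsilon(v)=\int_v^{\infty}c_\varepsilon(\tau)\,d\tau .$$ Consider the Cauchy problem for the Lagrangian $p$-system $$\partial_t v-\partial_x u=0,\qquad \partial_t u+\partial_x p_\varepsilon(v)=0,\qquad (v,u)|_{t=0}=(v^0,u^0),\qquad x\in\mathbb R .$$ Write $w^0=u^0+\theta_\varepsilon(v^0)$, $z^0=u^0-\theta_\varepsilon(v^0)$ and $c^0=c_\varepsilon(v^0)$. The datum is called rarefactive at $x$ if $\partial_xw^0(x)\ge0$ and $\partial_xz^0(x)\ge0$, and compressive at $x$ otherwise. A $C^1$ solution on $I\times\mathbb R$, with $I=[0,T)$ or $I=[0,\infty)$, is a pair $(v,u)$ of $C^1$ functions on $I\times\mathbb R$ with $v>1$ that solves the Cauchy problem pointwise and has finite $C^1([0,T']\times\mathbb R)$ norm for every $T'\in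 I$. There is $\varepsilon_0>0$, depending only on $\kappa,\gamma,\widetilde\gamma$, such that for all $M_1,M_2,Y^0,Q^0>0$ there are a function $K:\mathbb R\to\mathbb R$ and a constant $C>0$, depending only on $\kappa,\gamma,\widetilde\gamma,M_1,M_2,Y^0,Q^0$ (in particular not on $\varepsilon$), with the following properties. Let $0<\varepsilon\le\varepsilon_0$, and let $v^0,u^0\in C^1(\mathbb R)$ with $v^0>1$ satisfy $$(v^0-1)^{\gamma-1}\ge M_1^{-1}\varepsilon,\qquad \|(v^0,u^0)\|_{L^\infty(\mathbb R)}+\|(\partial_xv^0,\partial_xu^0)\|_{L^\infty(\mathbb R)}\le M_2,\qquad \sqrt{c^0}\,\partial_xw^0\le Y^0,\qquad \sqrt{c^0}\,\partial_xz^0\le Q^0,$$ where the norm of a pair is the maximum norm. 1. If the datum is rarefactive at every $x\in\mathbb R$, then there is a unique global $C^1$ solution $(v,u)$ on $[0,\infty)\times\mathbb R$; moreover, every $C^1$ solution on some $[0,T)\times\mathbb R$, $T>0$, is its restriction. For every $T>0$, on $[0,T]\times\mathbb R$, $$|v|,\ |u|,\ |\partial_xv|,\ |\partial_xu|,\ |\partial_tv|\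 \le K(T),\qquad |\partial_tu|\le K(T)\,\varepsilon^{-\frac1{2(\gamma-1)}} .$$ 2. If the datum is compressive at some point, then there are a time $T^*_\varepsilon\in(0,\infty)$ and a $C^1$ solution $(v,u)$ on $[0,T^*_\varepsilon)\times\mathbb R$ such that every $C^1$ solution on some $[0,T)\times\mathbb R$, $T>0$, satisfies $T\le T^*_\varepsilon$ and coincides with $(v,u)$ on $[0,T)\times\mathbb R$ (unique maximal solution). It breaks down at $T^*_\varepsilon$: $$\sup_{x\in\mathbb R}\max\{|\partial_xv(t,x)|,|\partial_xu(t,x)|\}\to\infty\qquad\text{as } t\uparrow T^*_\varepsilon .$$ Moreover $$T^*_\varepsilon\ \ge\ \inf_{x^*}\ \frac{\varepsilon^{\beta}}{C\,\sqrt{c^0(x^*)}\,\max\{-\partial_xw^0(x^*),-\partial_xz^0(x^*)\}},\qquad \beta=\begin{cases}\frac{1}{2(\gamma-1)},&1<\gamma<3,\\[2pt]\frac14,&\gamma=3,\\[2pt]\frac1{\gamma+1},&\gamma>3,\end{cases}$$ where the infimum runs over the points $x^*\in\mathbb R$ at which the datum is compressive. -/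

import Mathlib

open Set Filter Topology

namespace PSystem

/-- The singular pressure law `p_ε(v) = ε / (v - 1)^γ + κ / v^γt` (used for `v > 1`). -/
noncomputable def pressure (κ γ γt ε v : ℝ) : ℝ :=
  ε / (v - 1) ^ γ + κ / v ^ γt

/-- The characteristic speed `c_ε(v) = √(-p_ε'(v))`. -/
noncomputable def soundSpeed (κ γ γt ε v : ℝ) : ℝ :=
  Real.sqrt (-(deriv (pressure κ γ γt ε) v))

/-- `θ_ε(v) = ∫_v^∞ c_ε(τ) dτ`. -/
noncomputable def theta (κ γ γt ε v : ℝ) : ℝ :=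
  ∫ τ in Ioi v, soundSpeed κ γ γt ε τ

/-- The Riemann invariant `w = u + θ_ε(v)` of a pair of functions of `x`. -/
noncomputable def riemannW (κ γ γt ε : ℝ) (v u : ℝ → ℝ) (x : ℝ) : ℝ :=
  u x + theta κ γ γt ε (v x)

/-- The Riemann invariant `z = u - θ_ε(v)` of a pair of functions of `x`. -/
noncomputable def riemannZ (κ γ γt ε : ℝ) (v u : ℝ → ℝ) (x : ℝ) : ℝ :=
  u x - theta κ γ γt ε (v x)

/-- The initial datum `(v₀, u₀)` is rarefactive at `x`: `∂ₓw⁰(x) ≥ 0` and `∂ₓz⁰(x) ≥ 0`. -/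
def RarefactiveAt (κ γ γt ε : ℝ) (v₀ u₀ : ℝ → ℝ) (x : ℝ) : Prop :=
  0 ≤ deriv (riemannW κ γ γt ε v₀ u₀) x ∧ 0 ≤ deriv (riemannZ κ γ γt ε v₀ u₀) x

/-- `max {-∂ₓw⁰(x), -∂ₓz⁰(x)}`; it is positive exactly at the compressive points. -/
noncomputable def compression (κ γ γt ε : ℝ) (v₀ u₀ : ℝ → ℝ) (x : ℝ) : ℝ :=
  max (-(deriv (riemannW κ γ γt ε v₀ u₀) x)) (-(deriv (riemannZ κ γ γt ε v₀ u₀) x))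

/-- Admissible initial data at the parameter `ε`, with bounds `M₁`, `M₂`, `Y₀`, `Q₀`. -/
structure AdmissibleData (κ γ γt M₁ M₂ Y₀ Q₀ ε : ℝ) (v₀ u₀ : ℝ → ℝ) : Prop where
  contDiff_v : ContDiff ℝ 1 v₀
  contDiff_u : ContDiff ℝ 1 u₀
  one_lt : ∀ x, 1 < v₀ x
  /-- `(v₀ - 1)^(γ - 1) ≥ M₁⁻¹ ε`. -/
  away_from_one : ∀ x, M₁⁻¹ * ε ≤ (v₀ x - 1) ^ (γ - 1)
  /-- `‖(v₀, u₀)‖_∞ + ‖(∂ₓv₀, ∂ₓu₀)‖_∞ ≤ M₂`. -/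
  c1_bound : ∀ x y, max |v₀ x| |u₀ x| + max |deriv v₀ y| |deriv u₀ y| ≤ M₂
  w_bound : ∀ x, Real.sqrt (soundSpeed κ γ γt ε (v₀ x)) *
    deriv (riemannW κ γ γt ε v₀ u₀) x ≤ Y₀
  z_bound : ∀ x, Real.sqrt (soundSpeed κ γ γt ε (v₀ x)) *
    deriv (riemannZ κ γ γt ε v₀ u₀) x ≤ Q₀

/-- `(v, u)` is a `C¹` solution of `∂ₜv - ∂ₓu = 0`, `∂ₜu + ∂ₓ p_ε(v) = 0` with initial datum
`(v₀, u₀)` on `I × ℝ`. Here `I` is a time interval `[0, T)` or `[0, ∞)`. The functions are `C¹` up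
to and including `t = 0`, with finite `C¹([0, T'] × ℝ)` norm for every `T' ∈ I`. -/
structure IsC1Solution (κ γ γt ε : ℝ) (v₀ u₀ : ℝ → ℝ) (I : Set ℝ) (v u : ℝ → ℝ → ℝ) : Prop where
  contDiffOn_v : ContDiffOn ℝ 1 (fun q : ℝ × ℝ => v q.1 q.2) (I ×ˢ univ)
  contDiffOn_u : ContDiffOn ℝ 1 (fun q : ℝ × ℝ => u q.1 q.2) (I ×ˢ univ)
  one_lt : ∀ t ∈ I, ∀ x, 1 < v t x
  mass : ∀ t ∈ I, ∀ x, derivWithin (fun s => v s x) I t - deriv (fun y => u t y) x = 0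
  momentum : ∀ t ∈ I, ∀ x, derivWithin (fun s => u s x) I t +
    deriv (fun y => pressure κ γ γt ε (v t y)) x = 0
  initial_v : ∀ x, v 0 x = v₀ x
  initial_u : ∀ x, u 0 x = u₀ x
  bounded : ∀ T' ∈ I, ∃ B : ℝ, ∀ t ∈ Icc 0 T', ∀ x,
    |v t x| ≤ B ∧ |u t x| ≤ B ∧
    |deriv (fun y => v t y) x| ≤ B ∧ |deriv (fun y => u t y) x| ≤ B ∧
    |derivWithin (fun s => v s x) I t| ≤ B ∧ |derivWithin (fun s => u s x) I t| ≤ B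

/-- The two pairs of functions coincide on `I × ℝ`. -/
def AgreeOn (I : Set ℝ) (v u v' u' : ℝ → ℝ → ℝ) : Prop :=
  ∀ t ∈ I, ∀ x, v' t x = v t x ∧ u' t x = u t x

/-- The exponent of `ε` in the lower bound of the life-span. -/
noncomputable def lifespanExponent (γ : ℝ) : ℝ :=
  if γ < 3 then 1 / (2 * (γ - 1)) else if γ = 3 then 1 / 4 else 1 / (γ + 1)

end PSystem

open Set Filter Topology

namespace PSystem

-- The Riemann invariants w = u + θ(v) and z = u - θ(v) diagonalise the system: w is constant along
-- dx/dt = c, z along dx/dt = -c. Hence |u| + θ(v) = max(w, -z) never exceeds its initial bound R,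
-- which is independent of ε (`Solves.riemann_bound`). Since θ(v) → ∞ as v → 1, this keeps v away
-- from 1 (`Solves.low_bound`).
--
-- The weighted gradients √c ∂ₓw and √c ∂ₓz solve, along their characteristics, the Riccati equation
-- y' = -a y² with a = -c'/(2 c^(3/2)) > 0 (`Solves.exists_characteristic`); the weight √c is what
-- removes the product of the two gradients. So y is nonincreasing and keeps its sign. The upper
-- bounds Y⁰ and Q⁰ persist, and they give √c ∂ₜv = √c ∂ₓu ≤ D with D = (Y⁰ + Q⁰)/2. As γ̃ < 3, a
-- positive power of v then grows at most linearly in time, so on bounded times v is bounded and c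
-- is bounded below. There, bounded weighted gradients mean bounded gradients.
--
-- For rarefactive data the weighted gradients remain in [0, max(Y⁰, Q⁰)], and the solution never
-- stops. For compressive data some y starts negative, and (1/y)' = a. Integrating √c ∂ₓu ≤ D in
-- time gives v √c ≤ c₀ + D t, whence a ≥ 1/(2(c₀ + D t)); this is not integrable, so 1/y would
-- reach 0 in finite time (`BoundedSolution.false_of_global`). Conversely a ≤ C ε^(-β)
-- (`exists_riccatiCoeff_le`), so no gradient can blow up before the stated time. The exponent β is
-- that of the lower bound (v - 1) √c ≥ K ε^β, valid wherever θ(v) ≤ R.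
--
-- All this rests on a continuation principle (`BoundedData.exists_maximal`,
-- `BoundedSolution.exists_extension`): local solutions whose life-span depends only on bounds of
-- the data, uniqueness, and gluing. Local solutions come from characteristic coordinates (α, β), in
-- which w = w₀(α) and z = z₀(β) are known and t, x solve a linear problem. That problem is solved
-- by contraction near the diagonal (`exists_goursat`), and the map (α, β) ↦ (t, x) is then inverted
-- (`exists_inverse_characteristic`).

local notation "π₁" => ContinuousLinearMap.fst ℝ ℝ ℝ
local notation "π₂" => ContinuousLinearMap.snd ℝ ℝ ℝ

/-! ### A linear Goursat problem near the diagonal -/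

section

open scoped BoundedContinuousFunction

/-- The integral `∫ (k F)(α, s) ds` for `s` from `α` to `β`, with `β - α` truncated to `[-h, h]`. -/
noncomputable def stripIntegral (h : ℝ) (k F : ℝ × ℝ → ℝ) (p : ℝ × ℝ) : ℝ :=
  ∫ r in (0 : ℝ)..(max (-h) (min h (p.2 - p.1))), k (p.1, p.1 + r) * F (p.1, p.1 + r)

lemma continuous_stripIntegral {h : ℝ} {k F : ℝ × ℝ → ℝ} (hk : Continuous k) (hF : Continuous F) :
    Continuous (stripIntegral h k F) := by
  unfold stripIntegral
  apply intervalIntegral.continuous_parametric_intervalIntegral_of_continuous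
  · fun_prop
  · fun_prop

lemma abs_stripIntegral_le {h : ℝ} (hh : 0 ≤ h) {k F : ℝ × ℝ → ℝ} {m S : ℝ}
    (hm : ∀ p, |k p| ≤ m) (hS : ∀ p, |F p| ≤ S) (p : ℝ × ℝ) :
    |stripIntegral h k F p| ≤ h * m * S := by
  have hm0 : 0 ≤ m := (abs_nonneg _).trans (hm p)
  have hS0 : 0 ≤ S := (abs_nonneg _).trans (hS p)
  have := intervalIntegral.norm_integral_le_of_norm_le_const (a := (0 : ℝ))
    (b := max (-h) (min h (p.2 - p.1))) (C := m * S)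
    (f := fun r => k (p.1, p.1 + r) * F (p.1, p.1 + r)) (by
      intro r _
      rw [Real.norm_eq_abs, abs_mul]
      exact mul_le_mul (hm _) (hS _) (abs_nonneg _) hm0)
  rw [Real.norm_eq_abs] at this
  have h1 : |max (-h) (min h (p.2 - p.1)) - 0| ≤ h := by
    rw [sub_zero, abs_le]
    exact ⟨le_max_left _ _, max_le (by linarith) (min_le_left _ _)⟩
  calc _ ≤ m * S * |max (-h) (min h (p.2 - p.1)) - 0| := this
    _ ≤ m * S * h := by gcongr
    _ = h * m * S := by ring

lemma stripIntegral_sub {h : ℝ} {k F F' : ℝ × ℝ → ℝ} (hk : Continuous k) (hF : Continuous F)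
    (hF' : Continuous F') (p : ℝ × ℝ) :
    stripIntegral h k F p - stripIntegral h k F' p =
      stripIntegral h k (fun q => F q - F' q) p := by
  unfold stripIntegral
  rw [← intervalIntegral.integral_sub]
  · simp only [mul_sub]
  · exact Continuous.intervalIntegrable (by fun_prop) _ _
  · exact Continuous.intervalIntegrable (by fun_prop) _ _

lemma stripIntegral_eq {h : ℝ} {k F : ℝ × ℝ → ℝ} {p : ℝ × ℝ} (hp : |p.2 - p.1| ≤ h) :
    stripIntegral h k F p = ∫ s in p.1..p.2, k (p.1, s) * F (p.1, s) := by
  unfold stripIntegral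
  rw [abs_le] at hp
  rw [min_eq_right hp.2, max_eq_right hp.1,
    intervalIntegral.integral_comp_add_left (fun s => k (p.1, s) * F (p.1, s)) p.1]
  simp

lemma hasDerivAt_stripIntegral {h : ℝ} {k F : ℝ × ℝ → ℝ} (hk : Continuous k) (hF : Continuous F)
    {α β : ℝ} (hp : |β - α| < h) :
    HasDerivAt (fun b => stripIntegral h k F (α, b)) (k (α, β) * F (α, β)) β := by
  have h1 : HasDerivAt (fun b => ∫ s in α..b, k (α, s) * F (α, s)) (k (α, β) * F (α, β)) β :=
    ((Continuous.integral_hasStrictDerivAt (f := fun s => k (α, s) * F (α, s))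
      (by fun_prop) α β)).hasDerivAt
  refine h1.congr_of_eventuallyEq ?_
  have h2 : ∀ᶠ b in 𝓝 β, |b - α| < h :=
    (continuous_abs.comp (continuous_id.sub continuous_const)).continuousAt.eventually
      (gt_mem_nhds hp)
  filter_upwards [h2] with b hb
  exact stripIntegral_eq (p := (α, b)) hb.le

/-- Solution of the linear Goursat-type problem `∂_β A = k₂ B`, `∂_α B = k₁ A` in a thin strip
around the diagonal, with prescribed values on the diagonal. -/
theorem exists_goursat {h m S : ℝ} (hh : 0 < h) {k₁ k₂ : ℝ × ℝ → ℝ} {a : ℝ → ℝ}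
    (hk₁ : Continuous k₁) (hk₂ : Continuous k₂) (ha : Continuous a)
    (hm₁ : ∀ p, |k₁ p| ≤ m) (hm₂ : ∀ p, |k₂ p| ≤ m) (hS : ∀ x, |a x| ≤ S) (hhm : h * m ≤ 1 / 2) :
    ∃ A B : ℝ × ℝ → ℝ, Continuous A ∧ Continuous B ∧
      (∀ p, |A p - a p.1| ≤ 2 * h * m * S) ∧ (∀ p, |B p - a p.2| ≤ 2 * h * m * S) ∧
      (∀ x, A (x, x) = a x) ∧ (∀ x, B (x, x) = a x) ∧
      (∀ α β, |β - α| < h → HasDerivAt (fun b => A (α, b)) (k₂ (α, β) * B (α, β)) β) ∧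
      (∀ α β, |β - α| < h → HasDerivAt (fun s => B (s, β)) (k₁ (α, β) * A (α, β)) α) := by
  have hm0 : 0 ≤ m := (abs_nonneg _).trans (hm₁ 0)
  have hS0 : 0 ≤ S := (abs_nonneg _).trans (hS 0)
  let a' : ℝ × ℝ →ᵇ ℝ := BoundedContinuousFunction.ofNormedAddCommGroup
    (fun p => a p.1) (by fun_prop) S (fun p => hS p.1)
  let J (k : ℝ × ℝ → ℝ) (hk : Continuous k) (hm : ∀ p, |k p| ≤ m) (F : ℝ × ℝ →ᵇ ℝ) : ℝ × ℝ →ᵇ ℝ :=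
    BoundedContinuousFunction.ofNormedAddCommGroup
      (stripIntegral h k (fun p => F p.swap))
      (continuous_stripIntegral hk (F.continuous.comp continuous_swap)) (h * m * ‖F‖)
      (fun p => abs_stripIntegral_le hh.le hm (fun q => F.norm_coe_le_norm _) p)
  have hJ : ∀ k hk hm F F', dist (J k hk hm F) (J k hk hm F') ≤ 1 / 2 * dist F F' := by
    intro k hk hm F F'
    rw [BoundedContinuousFunction.dist_le (by positivity)]
    intro p
    have h1 : dist (J k hk hm F p) (J k hk hm F' p) =
        |stripIntegral h k (fun q => F q.swap - F' q.swap) p| := by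
      rw [Real.dist_eq]
      exact congrArg abs (stripIntegral_sub hk (F.continuous.comp continuous_swap)
        (F'.continuous.comp continuous_swap) p)
    rw [h1]
    have h2 := abs_stripIntegral_le (F := fun q => F q.swap - F' q.swap) (S := dist F F')
      hh.le hm (fun q => by
        rw [← Real.dist_eq]; exact BoundedContinuousFunction.dist_coe_le_dist _) p
    exact h2.trans (mul_le_mul_of_nonneg_right hhm dist_nonneg)
  -- The second unknown is stored with its arguments swapped, so that both equations integrate in
  -- the second variable and the one operator `J` serves for both.
  let k₁' : ℝ × ℝ → ℝ := fun p => k₁ p.swap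
  have hk₁' : Continuous k₁' := hk₁.comp continuous_swap
  have hm₁' : ∀ p, |k₁' p| ≤ m := fun p => hm₁ _
  let T : (ℝ × ℝ →ᵇ ℝ) × (ℝ × ℝ →ᵇ ℝ) → (ℝ × ℝ →ᵇ ℝ) × (ℝ × ℝ →ᵇ ℝ) := fun X =>
    (a' + J k₂ hk₂ hm₂ X.2, a' + J k₁' hk₁' hm₁' X.1)
  have hT : ContractingWith (1 / 2) T := by
    refine ⟨by
      rw [← NNReal.coe_lt_coe]; norm_num, LipschitzWith.of_dist_le_mul fun X Y => ?_⟩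
    rw [Prod.dist_eq, Prod.dist_eq]
    have e : (((1 / 2 : NNReal)) : ℝ) = 1 / 2 := by norm_num
    rw [e]
    refine max_le ?_ ?_
    · change dist (a' + J k₂ hk₂ hm₂ X.2) (a' + J k₂ hk₂ hm₂ Y.2) ≤ _
      rw [dist_add_left]
      exact (hJ k₂ hk₂ hm₂ _ _).trans (mul_le_mul_of_nonneg_left (le_max_right _ _) (by norm_num))
    · change dist (a' + J k₁' hk₁' hm₁' X.1) (a' + J k₁' hk₁' hm₁' Y.1) ≤ _
      rw [dist_add_left]
      exact (hJ k₁' hk₁' hm₁' _ _).trans (mul_le_mul_of_nonneg_left (le_max_left _ _) (by norm_num))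
  obtain ⟨⟨A, B⟩, hfix⟩ : ∃ X, T X = X := ⟨hT.fixedPoint, hT.fixedPoint_isFixedPt⟩
  have eA : ∀ p, A p = a p.1 + stripIntegral h k₂ (fun q => B q.swap) p := fun p =>
    (DFunLike.congr_fun (congrArg Prod.fst hfix) p).symm
  have eB : ∀ p, B p = a p.1 + stripIntegral h k₁' (fun q => A q.swap) p := fun p =>
    (DFunLike.congr_fun (congrArg Prod.snd hfix) p).symm
  -- The norm X of the fixed point obeys X ≤ S + X / 2. With X ≤ 2 * S, the integral terms are at
  -- most 2 * h * m * S.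
  have bd : max ‖A‖ ‖B‖ ≤ 2 * S := by
    have h1 : ‖A‖ ≤ S + 1 / 2 * max ‖A‖ ‖B‖ := by
      rw [BoundedContinuousFunction.norm_le (by positivity)]
      intro p
      rw [eA p, Real.norm_eq_abs]
      refine (abs_add_le _ _).trans (add_le_add (hS _) ?_)
      refine (abs_stripIntegral_le hh.le hm₂ (fun q => B.norm_coe_le_norm _) p).trans ?_
      exact mul_le_mul hhm (le_max_right _ _) (norm_nonneg _) (by norm_num)
    have h2 : ‖B‖ ≤ S + 1 / 2 * max ‖A‖ ‖B‖ := by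
      rw [BoundedContinuousFunction.norm_le (by positivity)]
      intro p
      rw [eB p, Real.norm_eq_abs]
      refine (abs_add_le _ _).trans (add_le_add (hS _) ?_)
      refine (abs_stripIntegral_le hh.le (fun p => hm₁ _) (fun q => A.norm_coe_le_norm _) p).trans ?_
      exact mul_le_mul hhm (le_max_left _ _) (norm_nonneg _) (by norm_num)
    have := max_le h1 h2
    linarith
  have bA : ∀ p, |A p| ≤ 2 * S := fun p =>
    (A.norm_coe_le_norm p).trans ((le_max_left _ _).trans bd)
  have bB : ∀ p, |B p| ≤ 2 * S := fun p =>
    (B.norm_coe_le_norm p).trans ((le_max_right _ _).trans bd)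
  refine ⟨A, fun p => B p.swap, A.continuous, B.continuous.comp continuous_swap, ?_, ?_, ?_, ?_,
    ?_, ?_⟩
  · intro p
    rw [eA p, add_sub_cancel_left]
    exact (abs_stripIntegral_le hh.le hm₂ (fun q => bB _) p).trans (by linarith)
  · intro p
    change |B p.swap - a p.2| ≤ _
    rw [eB p.swap, Prod.fst_swap, add_sub_cancel_left]
    exact (abs_stripIntegral_le hh.le (fun p => hm₁ _) (fun q => bA _) p.swap).trans (by linarith)
  · intro x
    rw [eA, stripIntegral_eq (by simpa using hh.le)]; simp
  · intro x
    change B (x, x) = a x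
    rw [eB, stripIntegral_eq (by simpa using hh.le)]; simp
  · intro α β hp
    have := (hasDerivAt_stripIntegral hk₂ (B.continuous.comp continuous_swap) hp).const_add (a α)
    refine this.congr_of_eventuallyEq (Eventually.of_forall fun b => eA _)
  · intro α β hp
    rw [abs_sub_comm] at hp
    have := (hasDerivAt_stripIntegral hk₁' (A.continuous.comp continuous_swap) hp).const_add (a β)
    refine this.congr_of_eventuallyEq (Eventually.of_forall fun b => eB _)

end

/-! ### Potentials of closed forms in the strip -/

section

/-- The integral is (a - α) times an average over [0, 1], so its derivative at the base point needs
only continuity of the average and no differentiability of `F`. -/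
lemma hasDerivAt_integral_diagonal {F : ℝ × ℝ → ℝ} (hF : Continuous F) (α : ℝ) :
    HasDerivAt (fun a => ∫ s in α..a, F (a, s)) (F (α, α)) α := by
  let M : ℝ → ℝ := fun a => ∫ r in (0 : ℝ)..1, F (a, α + (a - α) * r)
  have hM : Continuous M := by
    apply intervalIntegral.continuous_parametric_intervalIntegral_of_continuous
    · fun_prop
    · fun_prop
  have h1 : ∀ a, ∫ s in α..a, F (a, s) = (a - α) * M a := by
    intro a
    have := intervalIntegral.mul_integral_comp_add_mul (a := 0) (b := 1)
      (f := fun s => F (a, s)) (a - α) α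
    rw [this]
    congr 1 <;> ring
  have h2 : M α = F (α, α) := by simp [M]
  rw [hasDerivAt_iff_tendsto_slope, ← h2]
  refine (hM.continuousAt.tendsto.mono_left nhdsWithin_le_nhds).congr' ?_
  filter_upwards [self_mem_nhdsWithin] with a ha
  have : a - α ≠ 0 := sub_ne_zero.mpr ha
  rw [slope_def_field, h1, h1]
  field_simp
  ring

/-- The interval is split at α. Over the fixed interval from α to β one differentiates under the
integral, and `D`, being also the β-derivative of `H`, integrates back to a difference of `H`. The
remaining piece from α to a contributes the diagonal value of `F`. -/
lemma hasDerivAt_integral_of_partial {h : ℝ} {F H D : ℝ × ℝ → ℝ} (hF : Continuous F)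
    (hD : Continuous D)
    (dF : ∀ α β, |β - α| < h → HasDerivAt (fun a => F (a, β)) (D (α, β)) α)
    (dH : ∀ α β, |β - α| < h → HasDerivAt (fun b => H (α, b)) (D (α, β)) β)
    {α β : ℝ} (hp : |β - α| < h) :
    HasDerivAt (fun a => ∫ s in a..β, F (a, s)) (H (α, β) - H (α, α) - F (α, α)) α := by
  have hs : ∀ s ∈ uIcc α β, |s - α| ≤ |β - α| := by
    intro s hs
    exact abs_sub_left_of_mem_uIcc hs
  obtain ⟨C, hC⟩ : ∃ C, ∀ a ∈ Metric.closedBall α 1, ∀ s ∈ uIcc α β, |D (a, s)| ≤ C := by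
    obtain ⟨C, hC⟩ := ((isCompact_closedBall α 1).prod (isCompact_uIcc (a := α) (b := β))).exists_bound_of_continuousOn
      hD.continuousOn
    exact ⟨C, fun a ha s hs => hC (a, s) ⟨ha, hs⟩⟩
  -- For a within η of α, every point (a, s) with s between α and β still lies in the strip.
  let η := min 1 (h - |β - α|)
  have hη : 0 < η := lt_min one_pos (by linarith)
  have h1 := (intervalIntegral.hasDerivAt_integral_of_dominated_loc_of_deriv_le
    (F := fun a s => F (a, s)) (F' := fun a s => D (a, s)) (a := α) (b := β) (x₀ := α)
    (s := Metric.ball α η) (bound := fun _ => C) (μ := MeasureTheory.volume)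
    (Metric.ball_mem_nhds α hη)
    (Eventually.of_forall fun a => (Continuous.aestronglyMeasurable (by fun_prop)))
    (Continuous.intervalIntegrable (by fun_prop) _ _)
    (Continuous.aestronglyMeasurable (by fun_prop))
    (Eventually.of_forall fun s hs' a ha =>
      hC a (Metric.ball_subset_closedBall (Metric.ball_subset_ball (min_le_left _ _) ha)) s
        (uIoc_subset_uIcc hs'))
    (by simp)
    (Eventually.of_forall fun s hs' a ha => dF a s (by
      have h2 := hs s (uIoc_subset_uIcc hs')
      have h3 : |a - α| < h - |β - α| := by
        rw [← Real.dist_eq]; exact lt_of_lt_of_le ha (min_le_right _ _)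
      have : |s - a| ≤ |s - α| + |a - α| := by
        rw [abs_sub_comm a α]; exact abs_sub_le s α a
      linarith))).2
  have h2 : ∫ s in α..β, D (α, s) = H (α, β) - H (α, α) :=
    intervalIntegral.integral_eq_sub_of_hasDerivAt
      (fun s hs' => dH α s (lt_of_le_of_lt (hs s hs') hp))
      (Continuous.intervalIntegrable (by fun_prop) _ _)
  rw [h2] at h1
  refine (h1.sub (hasDerivAt_integral_diagonal hF α)).congr_of_eventuallyEq
    (Eventually.of_forall fun a => ?_)
  have := intervalIntegral.integral_add_adjacent_intervals (μ := MeasureTheory.volume)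
    (a := α) (b := a) (c := β) (f := fun s => F (a, s))
    (Continuous.intervalIntegrable (by fun_prop) _ _)
    (Continuous.intervalIntegrable (by fun_prop) _ _)
  change _ = (∫ s in α..β, F (a, s)) - ∫ s in α..a, F (a, s)
  linarith

/-- A potential on the strip for the closed form `H dα + F dβ`. -/
theorem hasStrictFDerivAt_potential {h : ℝ} {F H D : ℝ × ℝ → ℝ} {φ : ℝ → ℝ} (hF : Continuous F)
    (hH : Continuous H) (hD : Continuous D)
    (dF : ∀ α β, |β - α| < h → HasDerivAt (fun a => F (a, β)) (D (α, β)) α)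
    (dH : ∀ α β, |β - α| < h → HasDerivAt (fun b => H (α, b)) (D (α, β)) β)
    (dφ : ∀ α, HasDerivAt φ (F (α, α) + H (α, α)) α)
    {p : ℝ × ℝ} (hp : |p.2 - p.1| < h) :
    HasStrictFDerivAt (fun q : ℝ × ℝ => φ q.1 + ∫ s in q.1..q.2, F (q.1, s))
      (H p • ContinuousLinearMap.fst ℝ ℝ ℝ + F p • ContinuousLinearMap.snd ℝ ℝ ℝ) p := by
  have hnear : ∀ᶠ q : ℝ × ℝ in 𝓝 p, |q.2 - q.1| < h :=
    (by fun_prop : Continuous fun q : ℝ × ℝ => |q.2 - q.1|).continuousAt.eventually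
      (gt_mem_nhds hp)
  -- Continuous partial derivatives yield a strict derivative, which the local inversion of (t, x)
  -- requires.
  have key := hasStrictFDerivAt_uncurry_coprod (𝕜 := ℝ) (u := p)
    (f := fun a b => φ a + ∫ s in a..b, F (a, s))
    (f₁ := fun a b => H (a, b) • ContinuousLinearMap.id ℝ ℝ)
    (f₂ := fun a b => F (a, b) • ContinuousLinearMap.id ℝ ℝ) ?_ ?_ ?_ ?_
  · refine key.congr_fderiv ?_
    ext <;> simp [Function.HasUncurry.uncurry]
  · filter_upwards [hnear] with q hq
    have := (dφ q.1).add (hasDerivAt_integral_of_partial hF hD dF dH hq)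
    -- The derivative of φ is chosen to cancel the diagonal terms of the integral.
    have e : F (q.1, q.1) + H (q.1, q.1) + (H (q.1, q.2) - H (q.1, q.1) - F (q.1, q.1)) =
      H (q.1, q.2) := by ring
    rw [e] at this
    exact this.hasFDerivAt.congr_fderiv (by ext; simp [Function.HasUncurry.uncurry])
  · refine Eventually.of_forall fun q => ?_
    exact ((Continuous.integral_hasStrictDerivAt (f := fun s => F (q.1, s))
      (by fun_prop) q.1 q.2).hasDerivAt.const_add (φ q.1)).hasFDerivAt.congr_fderiv (by
        ext; simp [Function.HasUncurry.uncurry])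
  · have : Continuous fun q : ℝ × ℝ => H q • ContinuousLinearMap.id ℝ ℝ := by fun_prop
    exact this.continuousAt
  · have : Continuous fun q : ℝ × ℝ => F q • ContinuousLinearMap.id ℝ ℝ := by fun_prop
    exact this.continuousAt

end

/-! ### Inverting the change to characteristic coordinates -/

section

/-- The derivative of the change of variables from characteristic coordinates to `(t, x)`. -/
noncomputable def characteristicEquiv (N P C : ℝ) (hN : 0 < N) (hP : 0 < P) (hC : 0 < C) :
    (ℝ × ℝ) ≃L[ℝ] (ℝ × ℝ) :=
  ContinuousLinearEquiv.equivOfInverse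
    (((-N) • π₁ + P • π₂).prod ((C * N) • π₁ + (C * P) • π₂))
    (((2 * C * N)⁻¹ • (π₂ - C • π₁)).prod ((2 * C * P)⁻¹ • (π₂ + C • π₁)))
    (by
      intro q
      ext
      · simp; field_simp; ring
      · simp; field_simp; ring)
    (by
      intro q
      ext
      · simp; field_simp; ring
      · simp; field_simp; ring)

/-- Mean value theorem along a segment. The intermediate point depends on the function, so t and x
are later evaluated at two different points. -/
lemma exists_hasFDerivAt_eq_sub {f : ℝ × ℝ → ℝ} {f' : ℝ × ℝ → (ℝ × ℝ →L[ℝ] ℝ)} {s : Set (ℝ × ℝ)}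
    (hs : Convex ℝ s) (hf : ∀ p ∈ s, HasFDerivAt f (f' p) p) {p q : ℝ × ℝ} (hp : p ∈ s)
    (hq : q ∈ s) : ∃ r ∈ s, f q - f p = f' r (q - p) := by
  have hmem : ∀ r ∈ Icc (0 : ℝ) 1, p + r • (q - p) ∈ s := fun r hr =>
    hs.add_smul_sub_mem hp hq hr
  have hd : ∀ r ∈ Icc (0 : ℝ) 1,
      HasDerivAt (fun r : ℝ => f (p + r • (q - p))) (f' (p + r • (q - p)) (q - p)) r := by
    intro r hr
    have h1 : HasDerivAt (fun r : ℝ => p + r • (q - p)) (q - p) r := by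
      simpa using ((hasDerivAt_id r).smul_const (q - p)).const_add p
    exact (hf _ (hmem r hr)).comp_hasDerivAt r h1
  obtain ⟨r, hr, h⟩ := exists_hasDerivAt_eq_slope (fun r : ℝ => f (p + r • (q - p)))
    (fun r => f' (p + r • (q - p)) (q - p)) one_pos
    (fun r hr => (hd r hr).continuousAt.continuousWithinAt)
    (fun r hr => hd r (Ioo_subset_Icc_self hr))
  refine ⟨_, hmem r (Ioo_subset_Icc_self hr), ?_⟩
  rw [h]
  simp

lemma convex_strip (h : ℝ) : Convex ℝ {p : ℝ × ℝ | |p.2 - p.1| < h} := by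
  have : {p : ℝ × ℝ | |p.2 - p.1| < h} = (π₂ - π₁ : ℝ × ℝ →L[ℝ] ℝ) ⁻¹' (Metric.ball 0 h) := by
    ext p; simp
  rw [this]
  exact (convex_ball _ _).linear_preimage (π₂ - π₁ : ℝ × ℝ →L[ℝ] ℝ).toLinearMap

/-- Inversion of the change of variables from characteristic coordinates `(α, β)` in a strip
around the diagonal to `(t, x)`. -/
theorem exists_inverse_characteristic {h n n' cM : ℝ} (hh : 0 < h) (hn : 0 < n)
    {t x N P C : ℝ × ℝ → ℝ}
    (ht : ∀ p : ℝ × ℝ, |p.2 - p.1| < h → HasStrictFDerivAt t ((-N p) • π₁ + P p • π₂) p)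
    (hx : ∀ p : ℝ × ℝ, |p.2 - p.1| < h →
      HasStrictFDerivAt x ((C p * N p) • π₁ + (C p * P p) • π₂) p)
    (hN : ∀ p, n ≤ N p) (hP : ∀ p, n ≤ P p) (hP' : ∀ p, P p ≤ n')
    (hC : ∀ p, 0 < C p) (hC' : ∀ p, C p ≤ cM)
    (ht0 : ∀ a, t (a, a) = 0) (hx0 : ∀ a, x (a, a) = a) :
    ∃ Ψ : ℝ × ℝ → ℝ × ℝ, (∀ a, Ψ (0, a) = (a, a)) ∧
      ∀ q : ℝ × ℝ, |q.1| < n * h / 4 → |(Ψ q).2 - (Ψ q).1| < h ∧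
        HasStrictFDerivAt Ψ
          (((2 * C (Ψ q) * N (Ψ q))⁻¹ • (π₂ - C (Ψ q) • π₁)).prod
            ((2 * C (Ψ q) * P (Ψ q))⁻¹ • (π₂ + C (Ψ q) • π₁))) q := by
  have hNp : ∀ p, 0 < N p := fun p => hn.trans_le (hN p)
  have hPp : ∀ p, 0 < P p := fun p => hn.trans_le (hP p)
  have hn' : 0 < n' := (hPp 0).trans_le (hP' 0)
  have hcM : 0 < cM := (hC 0).trans_le (hC' 0)
  -- Equal values of t force the increments of α and β to have the same sign, equal values of x
  -- force opposite signs. Only the signs of the coefficients matter, so it is harmless that they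
  -- are taken at different points.
  have inj : ∀ p q : ℝ × ℝ, |p.2 - p.1| < h → |q.2 - q.1| < h → t p = t q → x p = x q →
      p = q := by
    intro p q hp hq et ex
    obtain ⟨r, -, h1⟩ := exists_hasFDerivAt_eq_sub (convex_strip h)
      (fun p hp => (ht p hp).hasFDerivAt) hp hq
    obtain ⟨s, -, h2⟩ := exists_hasFDerivAt_eq_sub (convex_strip h)
      (fun p hp => (hx p hp).hasFDerivAt) hp hq
    rw [et, sub_self] at h1
    rw [ex, sub_self] at h2
    replace h1 : 0 = -N r * (q.1 - p.1) + P r * (q.2 - p.2) := h1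
    replace h2 : 0 = C s * N s * (q.1 - p.1) + C s * P s * (q.2 - p.2) := h2
    have h2' : N s * (q.1 - p.1) + P s * (q.2 - p.2) = 0 := by
      have : C s * (N s * (q.1 - p.1) + P s * (q.2 - p.2)) = 0 := by linarith
      exact (mul_eq_zero.mp this).resolve_left (hC s).ne'
    have hNr := hNp r; have hPr := hPp r; have hNs := hNp s; have hPs := hPp s
    have e1 : q.1 - p.1 = 0 := by
      rcases lt_trichotomy (q.1 - p.1) 0 with hlt | heq | hgt
      · have a1 : q.2 - p.2 < 0 := by
          by_contra hcon
          push Not at hcon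
          nlinarith [mul_nonneg hPr.le hcon, mul_pos_of_neg_of_neg (neg_lt_zero.mpr hNr) hlt]
        nlinarith [mul_pos_of_neg_of_neg (neg_lt_zero.mpr hNs) hlt,
          mul_pos_of_neg_of_neg (neg_lt_zero.mpr hPs) a1]
      · exact heq
      · have a1 : 0 < q.2 - p.2 := by
          by_contra hcon
          push Not at hcon
          nlinarith [mul_nonneg hPr.le (sub_nonneg.mpr hcon), mul_pos hNr hgt]
        nlinarith [mul_pos hNs hgt, mul_pos hPs a1]
    rw [e1] at h2'
    have e2 : q.2 - p.2 = 0 := by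
      have : P s * (q.2 - p.2) = 0 := by linarith
      exact (mul_eq_zero.mp this).resolve_left hPs.ne'
    exact Prod.ext (by linarith) (by linarith)
  have diag : ∀ p : ℝ × ℝ, |p.2 - p.1| < h → ∃ r, t p = P r * (p.2 - p.1) ∧
      ∃ s, x p - p.1 = C s * P s * (p.2 - p.1) := by
    intro p hp
    have h0 : |((p.1, p.1) : ℝ × ℝ).2 - ((p.1, p.1) : ℝ × ℝ).1| < h := by simpa using hh
    obtain ⟨r, -, h1⟩ := exists_hasFDerivAt_eq_sub (convex_strip h)
      (fun p hp => (ht p hp).hasFDerivAt) h0 hp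
    obtain ⟨s, -, h2⟩ := exists_hasFDerivAt_eq_sub (convex_strip h)
      (fun p hp => (hx p hp).hasFDerivAt) h0 hp
    rw [ht0] at h1
    rw [hx0] at h2
    simp at h1 h2
    exact ⟨r, h1, s, h2⟩
  -- The squared distance from (t, x) to the target is minimised over a compact box around (q.2,
  -- q.2). The minimiser is interior, and the Jacobian is invertible there, so the distance is zero.
  have surj : ∀ q : ℝ × ℝ, |q.1| < n * h / 4 → ∃ p : ℝ × ℝ, |p.2 - p.1| < h ∧
      t p = q.1 ∧ x p = q.2 := by
    intro q hq
    set τ := n * h / 4 with hτ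
    have hτ0 : 0 < τ := by positivity
    set R := cM * n' * (h / 2) + τ with hR
    have hR0 : 0 < R := by positivity
    let K : Set (ℝ × ℝ) := {p | |p.2 - p.1| ≤ h / 2 ∧ |p.1 - q.2| ≤ R}
    have hKS : ∀ p ∈ K, |p.2 - p.1| < h := fun p hp => lt_of_le_of_lt hp.1 (by linarith)
    have hK : IsCompact K := by
      refine Metric.isCompact_of_isClosed_isBounded ?_ ?_
      · exact (isClosed_le (by fun_prop : Continuous fun p : ℝ × ℝ => |p.2 - p.1|)
          continuous_const).inter
          (isClosed_le (by fun_prop : Continuous fun p : ℝ × ℝ => |p.1 - q.2|) continuous_const)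
      · refine ((Metric.isBounded_Icc (q.2 - R) (q.2 + R)).prod
          (Metric.isBounded_Icc (q.2 - R - h) (q.2 + R + h))).subset ?_
        rintro p ⟨h1, h2⟩
        rw [abs_le] at h1 h2
        exact ⟨⟨by linarith, by linarith⟩, ⟨by linarith, by linarith⟩⟩
    let d : ℝ × ℝ → ℝ := fun p => (t p - q.1) ^ 2 + (x p - q.2) ^ 2
    have hdd : ∀ p : ℝ × ℝ, |p.2 - p.1| < h → HasFDerivAt d
        ((2 * (t p - q.1)) • ((-N p) • π₁ + P p • π₂) +
          (2 * (x p - q.2)) • ((C p * N p) • π₁ + (C p * P p) • π₂)) p := by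
      intro p hp
      have h1 := ((ht p hp).hasFDerivAt.sub_const q.1).pow 2
      have h2 := ((hx p hp).hasFDerivAt.sub_const q.2).pow 2
      refine (h1.add h2).congr_fderiv ?_
      simp
    have hxK : (q.2, q.2) ∈ K := ⟨by simpa using by positivity, by simpa using hR0.le⟩
    obtain ⟨p, hpK, hmin⟩ := hK.exists_isMinOn ⟨_, hxK⟩
      (fun p hp => (hdd p (hKS p hp)).continuousAt.continuousWithinAt)
    have hdp : d p ≤ q.1 ^ 2 := by
      have := hmin hxK
      simp only [mem_ofPred_eq, d, ht0, hx0] at this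
      simpa [d] using this
    have hq2 : q.1 ^ 2 < τ ^ 2 := sq_lt_sq' (abs_lt.mp hq).1 (abs_lt.mp hq).2
    obtain ⟨r, e1, s, e2⟩ := diag p (hKS p hpK)
    -- On the edge |β - α| = h / 2 the bound P ≥ n gives |t| ≥ 2 * τ, so this point is farther from
    -- the target than (q.2, q.2), whose squared distance is q.1 ^ 2 < τ ^ 2.
    have b1 : |p.2 - p.1| < h / 2 := by
      refine lt_of_le_of_ne hpK.1 fun heq => ?_
      have : 2 * τ ≤ |t p| := by
        rw [e1, abs_mul, heq, abs_of_pos (hPp r), hτ]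
        have := mul_le_mul_of_nonneg_right (hP r) (by positivity : 0 ≤ h / 2)
        linarith
      have h3 : τ ≤ |t p - q.1| := by
        have := abs_sub_abs_le_abs_sub (t p) q.1
        linarith
      have h4 : τ ^ 2 ≤ (t p - q.1) ^ 2 := by
        rw [← sq_abs (t p - q.1)]; exact pow_le_pow_left₀ hτ0.le h3 2
      have : 0 ≤ (x p - q.2) ^ 2 := sq_nonneg _
      simp only [d] at hdp
      linarith
    -- x differs from α by at most cM * n' * (h / 2), so at distance R the value of x misses q.2 by
    -- at least τ.
    have b2 : |p.1 - q.2| < R := by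
      refine lt_of_le_of_ne hpK.2 fun heq => ?_
      have h1 : |x p - p.1| ≤ cM * n' * (h / 2) := by
        rw [e2, abs_mul, abs_mul, abs_of_pos (hPp s), abs_of_pos (hC s)]
        exact mul_le_mul (mul_le_mul (hC' s) (hP' s) (hPp s).le hcM.le) hpK.1 (abs_nonneg _)
          (by positivity)
      have h3 : τ ≤ |x p - q.2| := by
        have := abs_sub_le p.1 (x p) q.2
        rw [heq, abs_sub_comm p.1] at this
        linarith
      have h4 : τ ^ 2 ≤ (x p - q.2) ^ 2 := by
        rw [← sq_abs (x p - q.2)]; exact pow_le_pow_left₀ hτ0.le h3 2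
      have : 0 ≤ (t p - q.1) ^ 2 := sq_nonneg _
      simp only [d] at hdp
      linarith
    have hnhds : K ∈ 𝓝 p := by
      have c1 : ∀ᶠ p' : ℝ × ℝ in 𝓝 p, |p'.2 - p'.1| < h / 2 :=
        (by fun_prop : Continuous fun q : ℝ × ℝ => |q.2 - q.1|).continuousAt.eventually
          (gt_mem_nhds b1)
      have c2 : ∀ᶠ p' : ℝ × ℝ in 𝓝 p, |p'.1 - q.2| < R :=
        (by fun_prop : Continuous fun p' : ℝ × ℝ => |p'.1 - q.2|).continuousAt.eventually
          (gt_mem_nhds b2)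
      filter_upwards [c1, c2] with p' h1 h2 using ⟨h1.le, h2.le⟩
    have hz := (hmin.isLocalMin hnhds).hasFDerivAt_eq_zero (hdd p (hKS p hpK))
    have z1 := DFunLike.congr_fun hz ((1, 0) : ℝ × ℝ)
    have z2 := DFunLike.congr_fun hz ((0, 1) : ℝ × ℝ)
    simp at z1 z2
    have hN0 := hNp p; have hP0 := hPp p; have hC0 := hC p
    have w1 : N p * (-(t p - q.1) + C p * (x p - q.2)) = 0 := by linarith
    have w2 : P p * ((t p - q.1) + C p * (x p - q.2)) = 0 := by linarith
    have w1' := (mul_eq_zero.mp w1).resolve_left hN0.ne'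
    have w2' := (mul_eq_zero.mp w2).resolve_left hP0.ne'
    have w3 : C p * (x p - q.2) = 0 := by linarith
    have w3' := (mul_eq_zero.mp w3).resolve_left hC0.ne'
    exact ⟨p, hKS p hpK, by linarith, by linarith⟩
  have : ∀ q : ℝ × ℝ, ∃ p : ℝ × ℝ, |q.1| < n * h / 4 → |p.2 - p.1| < h ∧
      t p = q.1 ∧ x p = q.2 := by
    intro q
    by_cases hq : |q.1| < n * h / 4
    · obtain ⟨p, hp⟩ := surj q hq
      exact ⟨p, fun _ => hp⟩
    · exact ⟨0, fun h => absurd h hq⟩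
  choose Ψ hΨ using this
  have left : ∀ p : ℝ × ℝ, |p.2 - p.1| < h → |t p| < n * h / 4 → Ψ (t p, x p) = p := by
    intro p hp hp'
    obtain ⟨h1, h2, h3⟩ := hΨ (t p, x p) hp'
    exact inj _ _ h1 hp h2 h3
  refine ⟨Ψ, fun a => ?_, fun q hq => ?_⟩
  · have := left (a, a) (by simpa using hh) (by rw [ht0]; simpa using by positivity)
    rwa [ht0, hx0] at this
  · obtain ⟨h1, h2, h3⟩ := hΨ q hq
    refine ⟨h1, ?_⟩
    set p := Ψ q with hp
    have hd : HasStrictFDerivAt (fun p => (t p, x p))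
        (characteristicEquiv (N p) (P p) (C p) (hNp p) (hPp p) (hC p) : ℝ × ℝ →L[ℝ] ℝ × ℝ) p :=
      (ht p h1).prodMk (hx p h1)
    have hl : ∀ᶠ p' in 𝓝 p, Ψ (t p', x p') = p' := by
      have c1 : ∀ᶠ p' : ℝ × ℝ in 𝓝 p, |p'.2 - p'.1| < h :=
        (by fun_prop : Continuous fun q : ℝ × ℝ => |q.2 - q.1|).continuousAt.eventually
          (gt_mem_nhds h1)
      have c2 : ∀ᶠ p' : ℝ × ℝ in 𝓝 p, |t p'| < n * h / 4 :=
        ((ht p h1).continuousAt.abs).eventually (gt_mem_nhds (by simpa only [h2] using hq))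
      filter_upwards [c1, c2] with p' a1 a2 using left p' a1 a2
    have := hd.to_local_left_inverse hl
    have e : (t p, x p) = q := Prod.ext h2 h3
    rw [e] at this
    exact this

end

/-! ### Local solutions of the diagonal system -/

section

/-- Local existence of `C¹` solutions, with a life-span depending only on the bounds of the data,
for the diagonal system `∂ₜw + g(w - z) ∂ₓw = 0`, `∂ₜz - g(w - z) ∂ₓz = 0`. -/
theorem exists_local_diagonal {g g' : ℝ → ℝ} {cm cM L M : ℝ} (hcm : 0 < cm)
    (hg : ∀ s, HasDerivAt g (g' s) s) (hg' : Continuous g') (hgm : ∀ s, cm ≤ g s)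
    (hgM : ∀ s, g s ≤ cM) (hgL : ∀ s, |g' s| ≤ L) (hM : 0 ≤ M) :
    ∃ τ > 0, ∃ E : ℝ, ∀ w₀ z₀ w₀' z₀' : ℝ → ℝ,
      (∀ a, HasDerivAt w₀ (w₀' a) a) → (∀ a, HasDerivAt z₀ (z₀' a) a) →
      Continuous w₀' → Continuous z₀' → (∀ a, |w₀' a| ≤ M) → (∀ a, |z₀' a| ≤ M) →
      ∃ w z wx zx : ℝ × ℝ → ℝ, (∀ a, w (0, a) = w₀ a) ∧ (∀ a, z (0, a) = z₀ a) ∧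
        ∀ q : ℝ × ℝ, |q.1| < τ →
          HasFDerivAt w ((-(g (w q - z q) * wx q)) • π₁ + wx q • π₂) q ∧
          HasFDerivAt z ((g (w q - z q) * zx q) • π₁ + zx q • π₂) q ∧
          ContinuousAt wx q ∧ ContinuousAt zx q ∧ |wx q| ≤ E ∧ |zx q| ≤ E := by
  have hcM : 0 < cM := hcm.trans_le ((hgm 0).trans (hgM 0))
  have hL : 0 ≤ L := (abs_nonneg _).trans (hgL 0)
  -- `m` bounds the logarithmic derivatives of √C, the added 1 making it positive. `S` and `a₀`
  -- bound the diagonal values 1 / (2√C) from above and below.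
  set m : ℝ := L * M / (2 * cm) + 1 with hm
  have hm0 : 0 < m := by positivity
  set S : ℝ := 1 / (2 * √cm) with hS
  have hS0 : 0 < S := by positivity
  set a₀ : ℝ := 1 / (2 * √cM) with ha₀
  have ha₀0 : 0 < a₀ := by positivity
  -- The first entry makes the Goursat problem contractive, the second keeps A and B above a₀ / 2,
  -- hence N and P positive.
  set h : ℝ := min (1 / (2 * m)) (a₀ / (4 * m * S)) with hh
  have hh0 : 0 < h := by positivity
  have hhm : h * m ≤ 1 / 2 := by
    calc h * m ≤ 1 / (2 * m) * m := by gcongr; exact min_le_left _ _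
      _ = 1 / 2 := by field_simp
  have hhS : 2 * h * m * S ≤ a₀ / 2 := by
    calc 2 * h * m * S ≤ 2 * (a₀ / (4 * m * S)) * m * S := by gcongr; exact min_le_right _ _
      _ = a₀ / 2 := by field_simp; norm_num
  set n : ℝ := a₀ / 2 / √cM with hn
  have hn0 : 0 < n := by positivity
  refine ⟨n * h / 4, by positivity, M / (2 * cm * n), ?_⟩
  intro w₀ z₀ w₀' z₀' dw dz cw cz bw bz
  have cw₀ : Continuous w₀ := continuous_iff_continuousAt.mpr fun a => (dw a).continuousAt
  have cz₀ : Continuous z₀ := continuous_iff_continuousAt.mpr fun a => (dz a).continuousAt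
  have cg : Continuous g := continuous_iff_continuousAt.mpr fun a => (hg a).continuousAt
  -- The speed is a known function of (α, β). The characteristic relations x_β = C t_β and x_α = -C
  -- t_α are built in by t_α = -N, t_β = P, x_α = C N, x_β = C P.
  let C : ℝ × ℝ → ℝ := fun p => g (w₀ p.1 - z₀ p.2)
  have hC : ∀ p, 0 < C p := fun p => hcm.trans_le (hgm _)
  have cC : Continuous C := by fun_prop
  let r : ℝ × ℝ → ℝ := fun p => √(C p)
  have hr : ∀ p, 0 < r p := fun p => Real.sqrt_pos.mpr (hC p)
  have hr2 : ∀ p, r p * r p = C p := fun p => Real.mul_self_sqrt (hC p).le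
  have cr : Continuous r := by fun_prop
  let k₂ : ℝ × ℝ → ℝ := fun p => g' (w₀ p.1 - z₀ p.2) * w₀' p.1 / (2 * C p)
  let k₁ : ℝ × ℝ → ℝ := fun p => -(g' (w₀ p.1 - z₀ p.2) * z₀' p.2) / (2 * C p)
  have ck₂ : Continuous k₂ :=
    Continuous.div (by fun_prop) (by fun_prop) (fun p => (mul_pos two_pos (hC p)).ne')
  have ck₁ : Continuous k₁ :=
    Continuous.div (by fun_prop) (by fun_prop) (fun p => (mul_pos two_pos (hC p)).ne')
  have bk₂ : ∀ p, |k₂ p| ≤ m := by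
    intro p
    rw [abs_div, abs_mul, abs_of_pos (mul_pos two_pos (hC p))]
    have : |g' (w₀ p.1 - z₀ p.2)| * |w₀' p.1| / (2 * C p) ≤ L * M / (2 * cm) := by
      gcongr
      exacts [hgL _, bw _, hgm _]
    linarith
  have bk₁ : ∀ p, |k₁ p| ≤ m := by
    intro p
    rw [abs_div, abs_neg, abs_mul, abs_of_pos (mul_pos two_pos (hC p))]
    have : |g' (w₀ p.1 - z₀ p.2)| * |z₀' p.2| / (2 * C p) ≤ L * M / (2 * cm) := by
      gcongr
      exacts [hgL _, bz _, hgm _]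
    linarith
  have drα : ∀ α β, HasDerivAt (fun a => r (a, β)) (r (α, β) * k₂ (α, β)) α := by
    intro α β
    have h1 : HasDerivAt (fun a => C (a, β)) (g' (w₀ α - z₀ β) * w₀' α) α :=
      (hg (w₀ α - z₀ β)).comp α ((dw α).sub_const (z₀ β))
    have h2 := h1.sqrt (hC (α, β)).ne'
    convert h2 using 1
    have e1 := hr2 (α, β)
    have e2 := (hr (α, β)).ne'
    change r (α, β) * (g' (w₀ α - z₀ β) * w₀' α / (2 * C (α, β))) =
      g' (w₀ α - z₀ β) * w₀' α / (2 * r (α, β))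
    rw [← e1]; field_simp
  have drβ : ∀ α β, HasDerivAt (fun b => r (α, b)) (r (α, β) * k₁ (α, β)) β := by
    intro α β
    have h1 : HasDerivAt (fun b => C (α, b)) (g' (w₀ α - z₀ β) * (-z₀' β)) β :=
      (hg (w₀ α - z₀ β)).comp β ((dz β).const_sub (w₀ α))
    have h2 := h1.sqrt (hC (α, β)).ne'
    convert h2 using 1
    have e1 := hr2 (α, β)
    have e2 := (hr (α, β)).ne'
    change r (α, β) * (-(g' (w₀ α - z₀ β) * z₀' β) / (2 * C (α, β))) =
      g' (w₀ α - z₀ β) * (-z₀' β) / (2 * r (α, β))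
    rw [← e1]; field_simp
  have hrm : ∀ p, √cm ≤ r p := fun p => Real.sqrt_le_sqrt (hgm _)
  have hrM : ∀ p, r p ≤ √cM := fun p => Real.sqrt_le_sqrt (hgM _)
  have hsm : 0 < √cm := Real.sqrt_pos.mpr hcm
  have hsM : 0 < √cM := Real.sqrt_pos.mpr hcM
  -- On the diagonal t = 0 forces A = B, and x = α forces √C (A + B) = 1.
  let a : ℝ → ℝ := fun x => 1 / (2 * r (x, x))
  have ca : Continuous a :=
    Continuous.div (by fun_prop) (by fun_prop) (fun x => (mul_pos two_pos (hr _)).ne')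
  have ha_nonneg : ∀ x, 0 < a x := fun x => by have := hr (x, x); positivity
  have haS : ∀ x, a x ≤ S := fun x => by
    have := hrm (x, x)
    change 1 / (2 * r (x, x)) ≤ 1 / (2 * √cm)
    gcongr
  have haS' : ∀ x, a₀ ≤ a x := fun x => by
    have := hrM (x, x)
    have := hr (x, x)
    change 1 / (2 * √cM) ≤ 1 / (2 * r (x, x))
    gcongr
  obtain ⟨A, B, cA, cB, bA, bB, dA, dB, dAβ, dBα⟩ := exists_goursat (a := a) (S := S) hh0 ck₁ ck₂ ca
    bk₁ bk₂ (fun x => by rw [abs_of_pos (ha_nonneg x)]; exact haS x) hhm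
  have hA : ∀ p, a₀ / 2 ≤ A p := fun p => by
    have h1 := (abs_le.mp ((bA p).trans hhS)).1
    have h2 := haS' p.1
    linarith
  have hB : ∀ p, a₀ / 2 ≤ B p := fun p => by
    have h1 := (abs_le.mp ((bB p).trans hhS)).1
    have h2 := haS' p.2
    linarith
  have hB' : ∀ p, B p ≤ S + a₀ / 2 := fun p => by
    have h1 := (abs_le.mp ((bB p).trans hhS)).2
    have h2 := haS p.2
    linarith
  let N : ℝ × ℝ → ℝ := fun p => A p / r p
  let P : ℝ × ℝ → ℝ := fun p => B p / r p
  have hrne : ∀ p, r p ≠ 0 := fun p => (hr p).ne'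
  have cN : Continuous N := cA.div cr hrne
  have cP : Continuous P := cB.div cr hrne
  have hN : ∀ p, n ≤ N p := fun p => by
    have h1 := hA p; have h2 := hrM p; have h3 := hr p
    have h4 : 0 < A p := by linarith
    change a₀ / 2 / √cM ≤ A p / r p
    gcongr
  have hP : ∀ p, n ≤ P p := fun p => by
    have h1 := hB p; have h2 := hrM p; have h3 := hr p
    have h4 : 0 < B p := by linarith
    change a₀ / 2 / √cM ≤ B p / r p
    gcongr
  have hP' : ∀ p, P p ≤ (S + a₀ / 2) / √cm := fun p => by
    have h1 := hB' p; have h2 := hrm p; have h3 := hr p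
    change B p / r p ≤ (S + a₀ / 2) / √cm
    gcongr
  let t : ℝ × ℝ → ℝ := fun q => 0 + ∫ s in q.1..q.2, P (q.1, s)
  let x : ℝ × ℝ → ℝ := fun q => q.1 + ∫ s in q.1..q.2, r (q.1, s) * B (q.1, s)
  -- Put N = A / r and P = B / r with r = √C, r_α = r k₂, r_β = r k₁. Equality of the mixed
  -- derivatives of both t and x is then equivalent to the Goursat equations A_β = k₂ B and B_α = k₁
  -- A.
  have dt : ∀ p : ℝ × ℝ, |p.2 - p.1| < h → HasStrictFDerivAt t ((-N p) • π₁ + P p • π₂) p := by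
    intro p hp
    refine hasStrictFDerivAt_potential (h := h) (F := P) (H := fun p => -N p) (φ := fun _ => 0)
      (D := fun p => (k₁ p * A p - k₂ p * B p) / r p) cP cN.neg
      (Continuous.div (by fun_prop) cr hrne) ?_ ?_ ?_ hp
    · intro α β hp
      refine ((dBα α β hp).div (drα α β) (hrne _)).congr_deriv ?_
      have := hrne (α, β)
      field_simp
    · intro α β hp
      refine ((dAβ α β hp).div (drβ α β) (hrne _)).neg.congr_deriv ?_
      have := hrne (α, β)
      field_simp
      ring
    · intro α
      have : P (α, α) + -N (α, α) = 0 := by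
        change B (α, α) / r (α, α) + -(A (α, α) / r (α, α)) = 0
        rw [dA, dB]; ring
      change HasDerivAt _ (P (α, α) + -N (α, α)) α
      rw [this]
      exact hasDerivAt_const _ _
  have eCN : ∀ p, C p * N p = r p * A p := fun p => by
    change C p * (A p / r p) = _
    rw [← hr2]; have := hrne p; field_simp
  have eCP : ∀ p, C p * P p = r p * B p := fun p => by
    change C p * (B p / r p) = _
    rw [← hr2]; have := hrne p; field_simp
  have dx : ∀ p : ℝ × ℝ, |p.2 - p.1| < h →
      HasStrictFDerivAt x ((C p * N p) • π₁ + (C p * P p) • π₂) p := by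
    intro p hp
    rw [eCN, eCP]
    refine hasStrictFDerivAt_potential (h := h) (F := fun p => r p * B p) (H := fun p => r p * A p)
      (φ := fun x => x)
      (D := fun p => r p * (k₁ p * A p + k₂ p * B p)) (by fun_prop) (by fun_prop)
      (by fun_prop) ?_ ?_ ?_ hp
    · intro α β hp
      refine ((drα α β).mul (dBα α β hp)).congr_deriv ?_
      ring
    · intro α β hp
      refine ((drβ α β).mul (dAβ α β hp)).congr_deriv ?_
      ring
    · intro α
      have : r (α, α) * B (α, α) + r (α, α) * A (α, α) = 1 := by
        rw [dA, dB]
        change r (α, α) * (1 / (2 * r (α, α))) + r (α, α) * (1 / (2 * r (α, α))) = 1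
        have := hrne (α, α)
        field_simp; norm_num
      change HasDerivAt _ (r (α, α) * B (α, α) + r (α, α) * A (α, α)) α
      rw [this]
      exact hasDerivAt_id _
  obtain ⟨Ψ, Ψ0, hΨ⟩ := exists_inverse_characteristic hh0 hn0 dt dx hN hP hP' hC
    (fun p => hgM _) (fun a => by simp [t]) (fun a => by simp [x])
  have hNp : ∀ p, 0 < N p := fun p => hn0.trans_le (hN p)
  have hPp : ∀ p, 0 < P p := fun p => hn0.trans_le (hP p)
  refine ⟨fun q => w₀ (Ψ q).1, fun q => z₀ (Ψ q).2,
    fun q => w₀' (Ψ q).1 * (2 * C (Ψ q) * N (Ψ q))⁻¹,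
    fun q => z₀' (Ψ q).2 * (2 * C (Ψ q) * P (Ψ q))⁻¹,
    fun a => by simp only [Ψ0], fun a => by simp only [Ψ0], fun q hq => ?_⟩
  obtain ⟨-, dΨ⟩ := hΨ q hq
  have cΨ : ContinuousAt Ψ q := dΨ.continuousAt
  have pCN : 0 < 2 * C (Ψ q) * N (Ψ q) := mul_pos (mul_pos two_pos (hC _)) (hNp _)
  have pCP : 0 < 2 * C (Ψ q) * P (Ψ q) := mul_pos (mul_pos two_pos (hC _)) (hPp _)
  have bound : ∀ {y X : ℝ}, |y| ≤ M → n ≤ X → |y * (2 * C (Ψ q) * X)⁻¹| ≤ M / (2 * cm * n) := by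
    intro y X hy hX
    have h1 : 0 < 2 * C (Ψ q) * X := mul_pos (mul_pos two_pos (hC _)) (hn0.trans_le hX)
    rw [abs_mul, abs_inv, abs_of_pos h1, ← div_eq_mul_inv]
    have h2 := hC (Ψ q)
    have h3 : cm ≤ C (Ψ q) := hgm _
    gcongr
  refine ⟨?_, ?_, ?_, ?_, bound (bw _) (hN _), bound (bz _) (hP _)⟩
  · refine ((dw _).comp_hasFDerivAt q dΨ.hasFDerivAt.fst).congr_fderiv ?_
    ext
    · simp [C]; ring
    · simp [C]
  · refine ((dz _).comp_hasFDerivAt q dΨ.hasFDerivAt.snd).congr_fderiv ?_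
    ext
    · simp [C]; ring
    · simp [C]
  · have c1 : Continuous fun p : ℝ × ℝ => w₀' p.1 * (2 * C p * N p)⁻¹ :=
      Continuous.mul (by fun_prop)
        (Continuous.inv₀ (by fun_prop) fun p => (mul_pos (mul_pos two_pos (hC p)) (hNp p)).ne')
    exact c1.continuousAt.comp cΨ
  · have c1 : Continuous fun p : ℝ × ℝ => z₀' p.2 * (2 * C p * P p)⁻¹ :=
      Continuous.mul (by fun_prop)
        (Continuous.inv₀ (by fun_prop) fun p => (mul_pos (mul_pos two_pos (hC p)) (hPp p)).ne')
    exact c1.continuousAt.comp cΨ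

end

/-! ### The pressure law, the sound speed and θ -/

section

/-- The standing assumptions on the parameters of the pressure law. -/
structure Parameters (κ γ γt ε : ℝ) : Prop where
  κ_pos : 0 < κ
  one_lt_γ : 1 < γ
  one_lt_γt : 1 < γt
  γt_lt : γt < 3
  ε_pos : 0 < ε

/-- `c_ε(v)² = -p_ε'(v)`. -/
noncomputable def speedSq (κ γ γt ε v : ℝ) : ℝ :=
  ε * γ * (v - 1) ^ (-(γ + 1)) + κ * γt * v ^ (-(γt + 1))

/-- `p_ε''(v)`. -/
noncomputable def pressureDeriv₂ (κ γ γt ε v : ℝ) : ℝ :=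
  ε * γ * (γ + 1) * (v - 1) ^ (-(γ + 2)) + κ * γt * (γt + 1) * v ^ (-(γt + 2))

/-- `c_ε'(v)`. -/
noncomputable def speedDeriv (κ γ γt ε v : ℝ) : ℝ :=
  -(pressureDeriv₂ κ γ γt ε v) / (2 * soundSpeed κ γ γt ε v)

lemma hasDerivAt_sub_rpow_neg {b v : ℝ} (a : ℝ) (hv : b < v) :
    HasDerivAt (fun x => (x - b) ^ (-a)) (-a * (v - b) ^ (-(a + 1))) v := by
  have h := ((hasDerivAt_id v).sub_const b).rpow_const (p := -a) (Or.inl (sub_pos.mpr hv).ne')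
  refine h.congr_deriv ?_
  rw [show -(a + 1) = -a - 1 by ring]
  simp

variable {κ γ γt ε : ℝ} {v : ℝ}

lemma hasDerivAt_pressure (κ γ γt ε : ℝ) (hv : 1 < v) :
    HasDerivAt (pressure κ γ γt ε) (-speedSq κ γ γt ε v) v := by
  have h1 := (hasDerivAt_sub_rpow_neg γ hv).const_mul ε
  have h2 := (hasDerivAt_sub_rpow_neg (b := 0) γt (by linarith : (0 : ℝ) < v)).const_mul κ
  have h3 := h1.add h2
  refine (h3.congr_of_eventuallyEq ?_).congr_deriv ?_
  · filter_upwards [lt_mem_nhds hv] with x hx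
    change ε / (x - 1) ^ γ + κ / x ^ γt = ε * (x - 1) ^ (-γ) + κ * (x - 0) ^ (-γt)
    rw [sub_zero, Real.rpow_neg (by linarith), Real.rpow_neg (by linarith)]
    ring
  · simp only [sub_zero, speedSq]; ring

lemma hasDerivAt_speedSq (κ γ γt ε : ℝ) (hv : 1 < v) :
    HasDerivAt (speedSq κ γ γt ε) (-pressureDeriv₂ κ γ γt ε v) v := by
  have h1 := (hasDerivAt_sub_rpow_neg (γ + 1) hv).const_mul (ε * γ)
  have h2 := (hasDerivAt_sub_rpow_neg (b := 0) (γt + 1) (by linarith : (0 : ℝ) < v)).const_mul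
    (κ * γt)
  have h3 := h1.add h2
  refine (h3.congr_of_eventuallyEq ?_).congr_deriv ?_
  · filter_upwards with x
    change speedSq κ γ γt ε x = _ + κ * γt * (x - 0) ^ (-(γt + 1))
    rw [sub_zero, speedSq]
  · simp only [sub_zero, pressureDeriv₂, show γ + 1 + 1 = γ + 2 by ring,
      show γt + 1 + 1 = γt + 2 by ring]
    ring

namespace Parameters
variable (hp : Parameters κ γ γt ε)
include hp

lemma γ_pos : 0 < γ := one_pos.trans hp.one_lt_γ
lemma γt_pos : 0 < γt := one_pos.trans hp.one_lt_γt

lemma speedSq_pos (hv : 1 < v) : 0 < speedSq κ γ γt ε v := by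
  have := hp.κ_pos; have := hp.γ_pos; have := hp.γt_pos; have := hp.ε_pos
  have h1 : 0 < v - 1 := by linarith
  have h2 : 0 < v := by linarith
  unfold speedSq
  positivity

lemma pressureDeriv₂_pos (hv : 1 < v) : 0 < pressureDeriv₂ κ γ γt ε v := by
  have := hp.κ_pos; have := hp.γ_pos; have := hp.γt_pos; have := hp.ε_pos
  have h1 : 0 < v - 1 := by linarith
  have h2 : 0 < v := by linarith
  unfold pressureDeriv₂
  positivity

omit hp in
lemma soundSpeed_eq (κ γ γt ε : ℝ) (hv : 1 < v) :
    soundSpeed κ γ γt ε v = √(speedSq κ γ γt ε v) := by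
  rw [soundSpeed, (hasDerivAt_pressure κ γ γt ε hv).deriv, neg_neg]

lemma soundSpeed_pos (hv : 1 < v) : 0 < soundSpeed κ γ γt ε v := by
  rw [soundSpeed_eq _ _ _ _ hv]
  exact Real.sqrt_pos.mpr (hp.speedSq_pos hv)

lemma soundSpeed_mul_self (hv : 1 < v) :
    soundSpeed κ γ γt ε v * soundSpeed κ γ γt ε v = speedSq κ γ γt ε v := by
  rw [soundSpeed_eq _ _ _ _ hv]
  exact Real.mul_self_sqrt (hp.speedSq_pos hv).le

lemma hasDerivAt_soundSpeed (hv : 1 < v) :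
    HasDerivAt (soundSpeed κ γ γt ε) (speedDeriv κ γ γt ε v) v := by
  have h := (hasDerivAt_speedSq κ γ γt ε hv).sqrt (hp.speedSq_pos hv).ne'
  refine (h.congr_of_eventuallyEq ?_).congr_deriv ?_
  · filter_upwards [lt_mem_nhds hv] with x hx using soundSpeed_eq _ _ _ _ hx
  · rw [speedDeriv, soundSpeed_eq _ _ _ _ hv]

lemma speedDeriv_neg (hv : 1 < v) : speedDeriv κ γ γt ε v < 0 := by
  unfold speedDeriv
  exact div_neg_of_neg_of_pos (neg_neg_of_pos (hp.pressureDeriv₂_pos hv))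
    (mul_pos two_pos (hp.soundSpeed_pos hv))

lemma continuousOn_soundSpeed : ContinuousOn (soundSpeed κ γ γt ε) (Ioi 1) := fun _ hv =>
  (hp.hasDerivAt_soundSpeed hv).continuousAt.continuousWithinAt

lemma continuousOn_speedDeriv : ContinuousOn (speedDeriv κ γ γt ε) (Ioi 1) := by
  refine ContinuousOn.div ?_ (continuousOn_const.mul hp.continuousOn_soundSpeed)
    (fun v hv => (mul_pos two_pos (hp.soundSpeed_pos hv)).ne')
  refine ContinuousOn.neg (ContinuousOn.add (ContinuousOn.mul continuousOn_const ?_)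
    (ContinuousOn.mul continuousOn_const ?_))
  · intro v hv
    exact (hasDerivAt_sub_rpow_neg (γ + 2) hv).continuousAt.continuousWithinAt
  · intro v hv
    have := (hasDerivAt_sub_rpow_neg (b := 0) (γt + 2)
      (by have : (1 : ℝ) < v := hv; linarith : (0 : ℝ) < v)).continuousAt.continuousWithinAt (s := Ioi 1)
    simpa using this

lemma antitoneOn_soundSpeed : AntitoneOn (soundSpeed κ γ γt ε) (Ioi 1) := by
  refine antitoneOn_of_deriv_nonpos (convex_Ioi 1) hp.continuousOn_soundSpeed ?_ ?_
  · intro v hv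
    rw [interior_Ioi] at hv
    exact (hp.hasDerivAt_soundSpeed hv).differentiableAt.differentiableWithinAt
  · intro v hv
    rw [interior_Ioi] at hv
    rw [(hp.hasDerivAt_soundSpeed hv).deriv]
    exact (hp.speedDeriv_neg hv).le

/-- Differentiating multiplies the two power terms of c² by (γ + 1) / (v - 1) and (γt + 1) / v up to
sign, and the stated factor dominates both. This bounds the Riccati coefficient from above. -/
lemma pressureDeriv₂_le (hv : 1 < v) :
    pressureDeriv₂ κ γ γt ε v ≤ (γ + γt + 2) / (v - 1) * speedSq κ γ γt ε v := by
  have hκ := hp.κ_pos; have hγ := hp.γ_pos; have hγt := hp.γt_pos; have hε := hp.ε_pos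
  have h1 : 0 < v - 1 := by linarith
  have h2 : 0 < v := by linarith
  have e1 : (v - 1) ^ (-(γ + 2)) = (v - 1) ^ (-(γ + 1)) / (v - 1) := by
    rw [← Real.rpow_sub_one h1.ne']; ring_nf
  have e2 : v ^ (-(γt + 2)) = v ^ (-(γt + 1)) / v := by
    rw [← Real.rpow_sub_one h2.ne']; ring_nf
  unfold pressureDeriv₂ speedSq
  rw [e1, e2]
  have p1 := Real.rpow_pos_of_pos h1 (-(γ + 1))
  have p2 := Real.rpow_pos_of_pos h2 (-(γt + 1))
  set X := (v - 1) ^ (-(γ + 1))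
  set Y := v ^ (-(γt + 1))
  have i1 : ε * γ * (γ + 1) * (X / (v - 1)) ≤ (γ + γt + 2) / (v - 1) * (ε * γ * X) := by
    rw [show ε * γ * (γ + 1) * (X / (v - 1)) = (γ + 1) / (v - 1) * (ε * γ * X) by ring]
    have : γ + 1 ≤ γ + γt + 2 := by linarith
    gcongr
  have i2 : κ * γt * (γt + 1) * (Y / v) ≤ (γ + γt + 2) / (v - 1) * (κ * γt * Y) := by
    rw [show κ * γt * (γt + 1) * (Y / v) = (γt + 1) / v * (κ * γt * Y) by ring]
    gcongr <;> linarith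
  exact (add_le_add i1 i2).trans_eq (mul_add _ _ _).symm

/-- Both factors gained by differentiation are at least 2 / v, since both exponents exceed 1. This
bounds the Riccati coefficient from below and drives the breakdown. -/
lemma le_pressureDeriv₂ (hv : 1 < v) :
    2 / v * speedSq κ γ γt ε v ≤ pressureDeriv₂ κ γ γt ε v := by
  have hκ := hp.κ_pos; have hγ := hp.γ_pos; have hγt := hp.γt_pos; have hε := hp.ε_pos
  have hγ1 := hp.one_lt_γ; have hγt1 := hp.one_lt_γt
  have h1 : 0 < v - 1 := by linarith
  have h2 : 0 < v := by linarith
  have e1 : (v - 1) ^ (-(γ + 2)) = (v - 1) ^ (-(γ + 1)) / (v - 1) := by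
    rw [← Real.rpow_sub_one h1.ne']; ring_nf
  have e2 : v ^ (-(γt + 2)) = v ^ (-(γt + 1)) / v := by
    rw [← Real.rpow_sub_one h2.ne']; ring_nf
  unfold pressureDeriv₂ speedSq
  rw [e1, e2]
  have p1 := Real.rpow_pos_of_pos h1 (-(γ + 1))
  have p2 := Real.rpow_pos_of_pos h2 (-(γt + 1))
  set X := (v - 1) ^ (-(γ + 1))
  set Y := v ^ (-(γt + 1))
  have i1 : 2 / v * (ε * γ * X) ≤ ε * γ * (γ + 1) * (X / (v - 1)) := by
    rw [show ε * γ * (γ + 1) * (X / (v - 1)) = (γ + 1) / (v - 1) * (ε * γ * X) by ring]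
    gcongr <;> linarith
  have i2 : 2 / v * (κ * γt * Y) ≤ κ * γt * (γt + 1) * (Y / v) := by
    rw [show κ * γt * (γt + 1) * (Y / v) = (γt + 1) / v * (κ * γt * Y) by ring]
    gcongr; linarith
  exact (mul_add _ _ _).trans_le (add_le_add i1 i2)

omit hp in
lemma sqrt_mul_rpow {k x a : ℝ} (hk : 0 ≤ k) (hx : 0 < x) :
    √(k * x ^ (-a)) = √k * x ^ (-(a / 2)) := by
  rw [Real.sqrt_mul hk, Real.sqrt_eq_rpow (x ^ (-a)), ← Real.rpow_mul hx.le]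
  ring_nf

lemma soundSpeed_ge_singular (hv : 1 < v) :
    √(ε * γ) * (v - 1) ^ (-((γ + 1) / 2)) ≤ soundSpeed κ γ γt ε v := by
  have hκ := hp.κ_pos; have hγ := hp.γ_pos; have hγt := hp.γt_pos; have hε := hp.ε_pos
  have h1 : 0 < v - 1 := by linarith
  have h2 : 0 < v := by linarith
  rw [soundSpeed_eq _ _ _ _ hv, ← sqrt_mul_rpow (by positivity) h1]
  apply Real.sqrt_le_sqrt
  unfold speedSq
  have : 0 ≤ κ * γt * v ^ (-(γt + 1)) := by positivity
  linarith

lemma soundSpeed_ge_regular (hv : 1 < v) :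
    √(κ * γt) * v ^ (-((γt + 1) / 2)) ≤ soundSpeed κ γ γt ε v := by
  have hκ := hp.κ_pos; have hγ := hp.γ_pos; have hγt := hp.γt_pos; have hε := hp.ε_pos
  have h1 : 0 < v - 1 := by linarith
  have h2 : 0 < v := by linarith
  rw [soundSpeed_eq _ _ _ _ hv, ← sqrt_mul_rpow (by positivity) h2]
  apply Real.sqrt_le_sqrt
  unfold speedSq
  have : 0 ≤ ε * γ * (v - 1) ^ (-(γ + 1)) := by positivity
  linarith

lemma soundSpeed_le (hv : 1 < v) : soundSpeed κ γ γt ε v ≤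
    √(ε * γ) * (v - 1) ^ (-((γ + 1) / 2)) + √(κ * γt) * v ^ (-((γt + 1) / 2)) := by
  have hκ := hp.κ_pos; have hγ := hp.γ_pos; have hγt := hp.γt_pos; have hε := hp.ε_pos
  have h1 : 0 < v - 1 := by linarith
  have h2 : 0 < v := by linarith
  rw [soundSpeed_eq _ _ _ _ hv, ← sqrt_mul_rpow (by positivity) h1,
    ← sqrt_mul_rpow (by positivity) h2, speedSq]
  refine Real.sqrt_le_iff.mpr ⟨by positivity, ?_⟩
  have a1 := Real.sq_sqrt (by positivity : 0 ≤ ε * γ * (v - 1) ^ (-(γ + 1)))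
  have a2 := Real.sq_sqrt (by positivity : 0 ≤ κ * γt * v ^ (-(γt + 1)))
  have a3 : 0 ≤ √(ε * γ * (v - 1) ^ (-(γ + 1))) * √(κ * γt * v ^ (-(γt + 1))) := by positivity
  nlinarith

end Parameters

lemma integrableOn_sub_rpow {a b v : ℝ} (ha : 1 < a) (hv : b < v) :
    MeasureTheory.IntegrableOn (fun x => (x - b) ^ (-a)) (Ioi v) := by
  have := integrableOn_add_rpow_Ioi_of_lt (a := -a) (c := v) (m := -b) (by linarith) (by linarith)
  simpa only [sub_eq_add_neg] using this

lemma integral_sub_rpow {a b v : ℝ} (ha : 1 < a) (hv : b < v) :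
    ∫ x in Ioi v, (x - b) ^ (-a) = (v - b) ^ (-(a - 1)) / (a - 1) := by
  have ha' : a - 1 ≠ 0 := by linarith
  have h := MeasureTheory.integral_Ioi_of_hasDerivAt_of_tendsto'
    (f := fun x => -((x - b) ^ (-(a - 1)) / (a - 1))) (f' := fun x => (x - b) ^ (-a)) (a := v)
    (m := 0) ?_ (integrableOn_sub_rpow ha hv) ?_
  · rw [h]; ring
  · intro x hx
    refine ((hasDerivAt_sub_rpow_neg (a - 1) (hv.trans_le hx)).div_const (a - 1)).neg.congr_deriv ?_
    rw [sub_add_cancel]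
    field_simp
  · have h1 : Tendsto (fun x : ℝ => (x - b) ^ (-(a - 1))) atTop (𝓝 0) :=
      (tendsto_rpow_neg_atTop (by linarith : 0 < a - 1)).comp
        (tendsto_atTop_add_const_right _ (-b) tendsto_id)
    simpa using (h1.div_const (a - 1)).neg

namespace Parameters
variable (hp : Parameters κ γ γt ε)
include hp

lemma integrableOn_soundSpeed (hv : 1 < v) :
    MeasureTheory.IntegrableOn (soundSpeed κ γ γt ε) (Ioi v) := by
  have h1 := (integrableOn_sub_rpow (a := (γ + 1) / 2) (b := 1)
    (by have := hp.one_lt_γ; linarith) hv).const_mul (√(ε * γ))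
  have h2 := (integrableOn_sub_rpow (a := (γt + 1) / 2) (b := 0)
    (by have := hp.one_lt_γt; linarith) (by linarith : (0 : ℝ) < v)).const_mul (√(κ * γt))
  refine MeasureTheory.Integrable.mono' (h1.add h2) ?_ ?_
  · exact (hp.continuousOn_soundSpeed.mono
      (Ioi_subset_Ioi hv.le)).aestronglyMeasurable measurableSet_Ioi
  · refine (MeasureTheory.ae_restrict_iff' measurableSet_Ioi).mpr (Eventually.of_forall ?_)
    intro x hx
    have hx1 : 1 < x := hv.trans hx
    rw [Real.norm_of_nonneg (hp.soundSpeed_pos hx1).le]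
    simpa using hp.soundSpeed_le hx1

lemma theta_le (hv : 1 < v) : theta κ γ γt ε v ≤
    √(ε * γ) * (2 / (γ - 1)) * (v - 1) ^ (-((γ - 1) / 2)) +
      √(κ * γt) * (2 / (γt - 1)) * v ^ (-((γt - 1) / 2)) := by
  have g1 := hp.one_lt_γ
  have g2 := hp.one_lt_γt
  have hv0 : (0 : ℝ) < v := by linarith
  have h1 := (integrableOn_sub_rpow (a := (γ + 1) / 2) (b := 1)
    (by linarith) hv).const_mul (√(ε * γ))
  have h2 := (integrableOn_sub_rpow (a := (γt + 1) / 2) (b := 0)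
    (by linarith) hv0).const_mul (√(κ * γt))
  have h3 := MeasureTheory.setIntegral_mono_on (hp.integrableOn_soundSpeed hv) (h1.add h2)
    measurableSet_Ioi (fun x hx => by
      have hx1 : 1 < x := hv.trans hx
      simpa using hp.soundSpeed_le hx1)
  refine h3.trans (le_of_eq ?_)
  have h4 := MeasureTheory.integral_add h1 h2
  refine h4.trans ?_
  rw [MeasureTheory.integral_const_mul, MeasureTheory.integral_const_mul,
    integral_sub_rpow (by linarith) hv, integral_sub_rpow (by linarith) hv0, sub_zero,
    show (γ + 1) / 2 - 1 = (γ - 1) / 2 by ring, show (γt + 1) / 2 - 1 = (γt - 1) / 2 by ring]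
  have : γ - 1 ≠ 0 := by linarith
  have : γt - 1 ≠ 0 := by linarith
  field_simp

lemma le_theta (hv : 1 < v) :
    √(ε * γ) * (2 / (γ - 1)) * (v - 1) ^ (-((γ - 1) / 2)) ≤ theta κ γ γt ε v := by
  have g1 := hp.one_lt_γ
  have h1 := (integrableOn_sub_rpow (a := (γ + 1) / 2) (b := 1)
    (by linarith) hv).const_mul (√(ε * γ))
  have h3 := MeasureTheory.setIntegral_mono_on h1 (hp.integrableOn_soundSpeed hv)
    measurableSet_Ioi (fun x hx => hp.soundSpeed_ge_singular (hv.trans hx))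
  refine le_trans (le_of_eq ?_) h3
  rw [MeasureTheory.integral_const_mul, integral_sub_rpow (by linarith) hv,
    show (γ + 1) / 2 - 1 = (γ - 1) / 2 by ring]
  have : γ - 1 ≠ 0 := by linarith
  field_simp

lemma theta_pos (hv : 1 < v) : 0 < theta κ γ γt ε v := by
  refine lt_of_lt_of_le ?_ (hp.le_theta hv)
  have h1 := hp.one_lt_γ; have h2 := hp.γ_pos; have h3 := hp.ε_pos
  have h4 : 0 < γ - 1 := by linarith
  have h5 : 0 < v - 1 := by linarith
  positivity

/-- Near v, θ equals a constant minus the integral of the continuous function c over a bounded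
interval. Strictness serves to differentiate the inverse of θ. -/
lemma hasStrictDerivAt_theta (hv : 1 < v) :
    HasStrictDerivAt (theta κ γ γt ε) (-soundSpeed κ γ γt ε v) v := by
  obtain ⟨a, ha, hav⟩ := exists_between hv
  have hint : ∀ x, 1 < x → IntervalIntegrable (soundSpeed κ γ γt ε) MeasureTheory.volume a x := by
    intro x hx
    exact (hp.continuousOn_soundSpeed.mono (fun y hy =>
      lt_of_lt_of_le (lt_min ha hx) hy.1)).intervalIntegrable
  have h1 := intervalIntegral.integral_hasStrictDerivAt_right (hint v hv)
    (hp.continuousOn_soundSpeed.stronglyMeasurableAtFilter isOpen_Ioi v hv)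
    (hp.hasDerivAt_soundSpeed hv).continuousAt
  refine (h1.const_sub (theta κ γ γt ε a)).congr_of_eventuallyEq ?_
  filter_upwards [lt_mem_nhds hv] with x hx
  have := intervalIntegral.integral_Ioi_sub_Ioi' (hp.integrableOn_soundSpeed ha)
    (hp.integrableOn_soundSpeed hx)
  unfold theta
  linarith

lemma hasDerivAt_theta (hv : 1 < v) :
    HasDerivAt (theta κ γ γt ε) (-soundSpeed κ γ γt ε v) v :=
  (hp.hasStrictDerivAt_theta hv).hasDerivAt

lemma continuousOn_theta : ContinuousOn (theta κ γ γt ε) (Ioi 1) := fun _ hv =>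
  (hp.hasDerivAt_theta hv).continuousAt.continuousWithinAt

lemma strictAntiOn_theta : StrictAntiOn (theta κ γ γt ε) (Ioi 1) := by
  refine strictAntiOn_of_deriv_neg (convex_Ioi 1) hp.continuousOn_theta ?_
  intro v hv
  rw [interior_Ioi] at hv
  rw [(hp.hasDerivAt_theta hv).deriv]
  exact neg_neg_of_pos (hp.soundSpeed_pos hv)

lemma tendsto_theta_atTop : Tendsto (theta κ γ γt ε) atTop (𝓝 0) := by
  have g1 := hp.one_lt_γ
  have g2 := hp.one_lt_γt
  have h1 : Tendsto (fun x : ℝ => (x - 1) ^ (-((γ - 1) / 2))) atTop (𝓝 0) :=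
    (tendsto_rpow_neg_atTop (by linarith : 0 < (γ - 1) / 2)).comp
      (tendsto_atTop_add_const_right _ (-1) tendsto_id)
  have h2 : Tendsto (fun x : ℝ => x ^ (-((γt - 1) / 2))) atTop (𝓝 0) :=
    tendsto_rpow_neg_atTop (by linarith : 0 < (γt - 1) / 2)
  have h3 := (h1.const_mul (√(ε * γ) * (2 / (γ - 1)))).add
    (h2.const_mul (√(κ * γt) * (2 / (γt - 1))))
  rw [mul_zero, mul_zero, add_zero] at h3
  refine tendsto_of_tendsto_of_tendsto_of_le_of_le' tendsto_const_nhds h3 ?_ ?_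
  · filter_upwards [eventually_gt_atTop 1] with x hx using (hp.theta_pos hx).le
  · filter_upwards [eventually_gt_atTop 1] with x hx using hp.theta_le hx

/-- The singular part of the pressure alone makes θ diverge, because γ > 1. Thus θ takes every
positive value, and a bound on θ keeps v away from 1. -/
lemma tendsto_theta_one : Tendsto (theta κ γ γt ε) (𝓝[>] 1) atTop := by
  have g1 := hp.one_lt_γ
  have g2 : 0 < γ - 1 := by linarith
  have g3 : 0 < ε * γ := mul_pos hp.ε_pos hp.γ_pos
  have h1 : Tendsto (fun x : ℝ => x - 1) (𝓝[>] 1) (𝓝[>] 0) := by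
    refine tendsto_nhdsWithin_iff.mpr ⟨?_, ?_⟩
    · have : Tendsto (fun x : ℝ => x - 1) (𝓝 1) (𝓝 (1 - 1)) :=
        (continuous_id.sub continuous_const).tendsto 1
      rw [sub_self] at this
      exact this.mono_left nhdsWithin_le_nhds
    · filter_upwards [self_mem_nhdsWithin] with x hx
      exact sub_pos.mpr (mem_Ioi.mp hx)
  have h2 : Tendsto (fun x : ℝ => (x - 1) ^ (-((γ - 1) / 2))) (𝓝[>] 1) atTop :=
    (tendsto_rpow_neg_nhdsGT_zero (by linarith : -((γ - 1) / 2) < 0)).comp h1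
  have h3 := h2.const_mul_atTop (by positivity : 0 < √(ε * γ) * (2 / (γ - 1)))
  refine tendsto_atTop_mono' _ ?_ h3
  filter_upwards [self_mem_nhdsWithin] with x hx using hp.le_theta hx

lemma exists_theta_eq {s : ℝ} (hs : 0 < s) : ∃ v, 1 < v ∧ theta κ γ γt ε v = s := by
  obtain ⟨a, ha1, ha⟩ := ((hp.tendsto_theta_one.eventually_ge_atTop s).and
    self_mem_nhdsWithin).exists
  obtain ⟨b, hb1, hb⟩ := ((hp.tendsto_theta_atTop.eventually (gt_mem_nhds hs)).and
    (eventually_gt_atTop 1)).exists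
  have hb' : theta κ γ γt ε b ≤ s := hb1.le
  have : s ∈ theta κ γ γt ε '' uIcc a b := by
    refine intermediate_value_uIcc (hp.continuousOn_theta.mono fun y hy =>
      lt_of_lt_of_le (lt_min ha hb) hy.1) ?_
    rw [mem_uIcc]
    exact Or.inr ⟨hb', ha1⟩
  obtain ⟨v, hv, e⟩ := this
  exact ⟨v, lt_of_lt_of_le (lt_min ha hb) hv.1, e⟩

/-- The inverse function of `θ_ε`. -/
lemma exists_theta_inverse : ∃ G : ℝ → ℝ, (∀ s, 0 < s → 1 < G s ∧ theta κ γ γt ε (G s) = s) ∧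
    (∀ v, 1 < v → G (theta κ γ γt ε v) = v) ∧
    ∀ s, 0 < s → HasDerivAt G (-soundSpeed κ γ γt ε (G s))⁻¹ s := by
  have : ∀ s, ∃ v, 0 < s → 1 < v ∧ theta κ γ γt ε v = s := by
    intro s
    by_cases hs : 0 < s
    · obtain ⟨v, hv⟩ := hp.exists_theta_eq hs
      exact ⟨v, fun _ => hv⟩
    · exact ⟨0, fun h => absurd h hs⟩
  choose G hG using this
  have left : ∀ v, 1 < v → G (theta κ γ γt ε v) = v := by
    intro v hv
    obtain ⟨h1, h2⟩ := hG _ (hp.theta_pos hv)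
    exact hp.strictAntiOn_theta.injOn h1 hv h2
  refine ⟨G, hG, left, fun s hs => ?_⟩
  obtain ⟨h1, h2⟩ := hG s hs
  have h3 := (hp.hasStrictDerivAt_theta h1).to_local_left_inverse
    (neg_ne_zero.mpr (hp.soundSpeed_pos h1).ne')
    (g := G) (by filter_upwards [lt_mem_nhds h1] with x hx using left x hx)
  rw [h2] at h3
  exact h3.hasDerivAt

end Parameters

end

/-! ### Local solutions of the p-system -/

section

lemma hasDerivWithinAt_along {f : ℝ × ℝ → ℝ} {I J : Set ℝ} {a b t X' : ℝ} {X : ℝ → ℝ}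
    (hJ : J ⊆ I) (h : HasFDerivWithinAt f (a • π₁ + b • π₂) (I ×ˢ univ) (t, X t))
    (hX : HasDerivWithinAt X X' J t) :
    HasDerivWithinAt (fun s => f (s, X s)) (a + b * X') J t := by
  have h1 : HasDerivWithinAt (fun s => (s, X s)) (1, X') J t :=
    (hasDerivWithinAt_id t J).prodMk hX
  have hm : MapsTo (fun s => (s, X s)) J (I ×ˢ univ) := fun s hs => ⟨hJ hs, mem_univ _⟩
  have h2 := h.comp_hasDerivWithinAt t h1 hm
  refine h2.congr_deriv ?_
  simp

lemma hasDerivAt_slice {f : ℝ × ℝ → ℝ} {I : Set ℝ} {a b t x : ℝ} (ht : t ∈ I)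
    (h : HasFDerivWithinAt f (a • π₁ + b • π₂) (I ×ˢ univ) (t, x)) :
    HasDerivAt (fun y => f (t, y)) b x := by
  have h1 : HasDerivWithinAt (fun y : ℝ => (t, y)) (0, 1) univ x :=
    ((hasDerivAt_const x t).prodMk (hasDerivAt_id x)).hasDerivWithinAt
  have hm : MapsTo (fun y : ℝ => (t, y)) univ (I ×ˢ univ) := fun s _ => ⟨ht, mem_univ _⟩
  have h2 := h.comp_hasDerivWithinAt x h1 hm
  exact (h2.congr_deriv (by simp)).hasDerivAt univ_mem

/-- `(v, u)` is a `C¹` solution of the p-system on `I × ℝ`. -/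
structure Solves (κ γ γt ε : ℝ) (I : Set ℝ) (v u : ℝ → ℝ → ℝ) : Prop where
  one_lt : ∀ t ∈ I, ∀ x, 1 < v t x
  fderiv_v : ∀ t ∈ I, ∀ x, HasFDerivWithinAt (fun q : ℝ × ℝ => v q.1 q.2)
    (deriv (u t) x • π₁ + deriv (v t) x • π₂) (I ×ˢ univ) (t, x)
  fderiv_u : ∀ t ∈ I, ∀ x, HasFDerivWithinAt (fun q : ℝ × ℝ => u q.1 q.2)
    ((speedSq κ γ γt ε (v t x) * deriv (v t) x) • π₁ + deriv (u t) x • π₂) (I ×ˢ univ) (t, x)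
  continuousOn_dv : ContinuousOn (fun q : ℝ × ℝ => deriv (v q.1) q.2) (I ×ˢ univ)
  continuousOn_du : ContinuousOn (fun q : ℝ × ℝ => deriv (u q.1) q.2) (I ×ˢ univ)

/-- A smooth truncation of the identity to a compact interval of positive numbers. -/
lemma exists_smooth_truncation {a b : ℝ} (ha : 0 < a) (hab : a < b) :
    ∃ (ψ ψ' : ℝ → ℝ) (a' b' L : ℝ), 0 < a' ∧ (∀ s, HasDerivAt ψ (ψ' s) s) ∧ Continuous ψ' ∧
      (∀ s, |ψ' s| ≤ L) ∧ (∀ s, ψ s ∈ Icc a' b') ∧ ∀ s ∈ Icc a b, ψ s = s := by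
  let c := (a + b) / 2
  -- The bump is 1 on [a, b] and supported in [a / 2, b + a / 2], so the truncated identity keeps
  -- its values in the latter interval.
  let χ : ContDiffBump c := ⟨(b - a) / 2, (b - a) / 2 + a / 2, by linarith, by linarith⟩
  let φ : ℝ → ℝ := fun s => χ s * (s - c)
  have hφ : ContDiff ℝ 1 φ := χ.contDiff.mul (contDiff_id.sub contDiff_const)
  have hφc : HasCompactSupport φ := χ.hasCompactSupport.mul_right
  have hφ' : Continuous (deriv φ) := hφ.continuous_deriv le_rfl
  obtain ⟨L, hL⟩ := hφc.deriv.exists_bound_of_continuous hφ'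
  refine ⟨fun s => c + φ s, deriv φ, a / 2, b + a / 2, L, by positivity, fun s => ?_, hφ', hL,
    fun s => ?_, fun s hs => ?_⟩
  · exact ((hφ.differentiable (by norm_num) s).hasDerivAt).const_add c
  · have h1 : |φ s| ≤ (b - a) / 2 + a / 2 := by
      by_cases hs : s ∈ Metric.ball c ((b - a) / 2 + a / 2)
      · change |χ s * (s - c)| ≤ _
        rw [abs_mul, abs_of_nonneg χ.nonneg]
        rw [Metric.mem_ball, Real.dist_eq] at hs
        calc χ s * |s - c| ≤ 1 * |s - c| := by gcongr; exact χ.le_one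
          _ ≤ _ := by linarith
      · have : χ s = 0 := by
          rw [← Function.notMem_support, χ.support_eq]; exact hs
        change |χ s * (s - c)| ≤ _
        rw [this, zero_mul, abs_zero]; linarith
    rw [abs_le] at h1
    change a / 2 ≤ (a + b) / 2 + φ s ∧ (a + b) / 2 + φ s ≤ b + a / 2
    constructor <;> linarith
  · have : χ s = 1 := by
      apply χ.one_of_mem_closedBall
      rw [Metric.mem_closedBall, Real.dist_eq, abs_le]
      change -((b - a) / 2) ≤ s - (a + b) / 2 ∧ s - (a + b) / 2 ≤ (b - a) / 2
      constructor <;> linarith [hs.1, hs.2]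
    change c + χ s * (s - c) = s
    rw [this]; ring

variable {κ γ γt ε : ℝ}

/-- The slice derivatives of a function with known partial derivatives on an open strip. -/
lemma Solves.of_hasFDerivAt {τ : ℝ} {v u : ℝ → ℝ → ℝ} {vx ux : ℝ × ℝ → ℝ}
    (h1 : ∀ q : ℝ × ℝ, |q.1| < τ → 1 < v q.1 q.2)
    (hv : ∀ q : ℝ × ℝ, |q.1| < τ → HasFDerivAt (fun q : ℝ × ℝ => v q.1 q.2)
      (ux q • π₁ + vx q • π₂) q)
    (hu : ∀ q : ℝ × ℝ, |q.1| < τ → HasFDerivAt (fun q : ℝ × ℝ => u q.1 q.2)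
      ((speedSq κ γ γt ε (v q.1 q.2) * vx q) • π₁ + ux q • π₂) q)
    (cv : ∀ q : ℝ × ℝ, |q.1| < τ → ContinuousAt vx q)
    (cu : ∀ q : ℝ × ℝ, |q.1| < τ → ContinuousAt ux q) :
    Solves κ γ γt ε (Ioo (-τ) τ) v u ∧
      ∀ t ∈ Ioo (-τ) τ, ∀ x, deriv (v t) x = vx (t, x) ∧ deriv (u t) x = ux (t, x) := by
  have key : ∀ t ∈ Ioo (-τ) τ, ∀ x, deriv (v t) x = vx (t, x) ∧ deriv (u t) x = ux (t, x) := by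
    intro t ht x
    have ht' : |t| < τ := abs_lt.mpr ht
    exact ⟨(hasDerivAt_slice (I := univ) (mem_univ t) (hv (t, x) ht').hasFDerivWithinAt).deriv,
      (hasDerivAt_slice (I := univ) (mem_univ t) (hu (t, x) ht').hasFDerivWithinAt).deriv⟩
  refine ⟨⟨fun t ht x => h1 (t, x) (abs_lt.mpr ht), fun t ht x => ?_, fun t ht x => ?_, ?_, ?_⟩,
    key⟩
  · rw [(key t ht x).1, (key t ht x).2]
    exact (hv (t, x) (abs_lt.mpr ht)).hasFDerivWithinAt
  · rw [(key t ht x).1, (key t ht x).2]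
    exact (hu (t, x) (abs_lt.mpr ht)).hasFDerivWithinAt
  · refine ContinuousOn.congr (f := vx)
      (fun q hq => (cv q (abs_lt.mpr hq.1)).continuousWithinAt) ?_
    rintro ⟨t, x⟩ hq
    exact (key t hq.1 x).1
  · refine ContinuousOn.congr (f := ux)
      (fun q hq => (cu q (abs_lt.mpr hq.1)).continuousWithinAt) ?_
    rintro ⟨t, x⟩ hq
    exact (key t hq.1 x).2

/-- Local existence for the p-system, with a life-span depending only on the bounds. -/
theorem Parameters.exists_local (hp : Parameters κ γ γt ε) {δ V M : ℝ} (hδ : 0 < δ)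
    (hV : 1 + δ ≤ V) (hM : 0 ≤ M) :
    ∃ τ > 0, ∀ v₀ u₀ : ℝ → ℝ, ContDiff ℝ 1 v₀ → ContDiff ℝ 1 u₀ → (∀ x, 1 + δ ≤ v₀ x) →
      (∀ x, v₀ x ≤ V) → (∀ x, |u₀ x| ≤ M) → (∀ x, |deriv v₀ x| ≤ M) → (∀ x, |deriv u₀ x| ≤ M) →
      ∃ v u : ℝ → ℝ → ℝ, Solves κ γ γt ε (Ioo (-τ) τ) v u ∧ (∀ x, v 0 x = v₀ x) ∧
        (∀ x, u 0 x = u₀ x) ∧ ∃ B, ∀ t ∈ Ioo (-τ) τ, ∀ x, |v t x| ≤ B ∧ |u t x| ≤ B ∧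
          |deriv (v t) x| ≤ B ∧ |deriv (u t) x| ≤ B := by
  obtain ⟨G, hG, hGθ, hG'⟩ := hp.exists_theta_inverse
  set c := soundSpeed κ γ γt ε with hc
  set θ := theta κ γ γt ε with hθ
  have hδ1 : 1 < 1 + δ := by linarith
  have hV1 : 1 < V := by linarith
  set θm := θ V with hθm
  set θ1 := θ (1 + δ) with hθ1
  have hθm0 : 0 < θm := hp.theta_pos hV1
  have hθ10 : θm ≤ θ1 := hp.strictAntiOn_theta.antitoneOn hδ1 hV1 hV
  -- The data have θ(v₀) in [θm, θ1]. Truncating only outside [θm / 2, θ1 + θm] leaves the solution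
  -- room to move, while the truncated speed has global positive bounds and a bounded derivative.
  obtain ⟨ψ, ψ', a, b, L, ha, dψ, cψ', bψ', hψ, hψid⟩ :=
    exists_smooth_truncation (a := θm / 2) (b := θ1 + θm) (by positivity) (by linarith)
  have hψ0 : ∀ s, 0 < ψ s := fun s => ha.trans_le (hψ s).1
  have cψ : Continuous ψ := continuous_iff_continuousAt.mpr fun s => (dψ s).continuousAt
  have cG : ContinuousOn G (Icc a b) := fun s hs =>
    (hG' s (ha.trans_le hs.1)).continuousAt.continuousWithinAt
  have mG : MapsTo G (Icc a b) (Ioi 1) := fun s hs => (hG s (ha.trans_le hs.1)).1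
  have ccG : ContinuousOn (fun s => c (G s)) (Icc a b) := hp.continuousOn_soundSpeed.comp cG mG
  have hab : (Icc a b).Nonempty := ⟨_, hψ 0⟩
  obtain ⟨sm, hsm, hmin⟩ := isCompact_Icc.exists_isMinOn hab ccG
  obtain ⟨sM, hsM, hmax⟩ := isCompact_Icc.exists_isMaxOn hab ccG
  set cm := c (G sm) with hcm
  set cM := c (G sM) with hcM
  have hcm0 : 0 < cm := hp.soundSpeed_pos (mG hsm)
  have hcm1 : ∀ s ∈ Icc a b, cm ≤ c (G s) := fun s hs => hmin hs
  have hcM1 : ∀ s ∈ Icc a b, c (G s) ≤ cM := fun s hs => hmax hs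
  have hcM0 : 0 < cM := hp.soundSpeed_pos (mG hsM)
  let φ : ℝ → ℝ := fun s => speedDeriv κ γ γt ε (G s) * (-c (G s))⁻¹
  have cφ : ContinuousOn φ (Icc a b) :=
    (hp.continuousOn_speedDeriv.comp cG mG).mul
      (ccG.neg.inv₀ fun s hs => neg_ne_zero.mpr (hp.soundSpeed_pos (mG hs)).ne')
  obtain ⟨Lφ, hLφ⟩ := isCompact_Icc.exists_bound_of_continuousOn cφ
  -- Since w - z = 2 θ(v), this is the sound speed as a function of w - z, after truncation.
  let g : ℝ → ℝ := fun s => c (G (ψ (s / 2)))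
  let g' : ℝ → ℝ := fun s => φ (ψ (s / 2)) * (ψ' (s / 2) * (1 / 2))
  have dg : ∀ s, HasDerivAt g (g' s) s := by
    intro s
    have h1 : HasDerivAt (fun s => ψ (s / 2)) (ψ' (s / 2) * (1 / 2)) s :=
      (dψ (s / 2)).comp s ((hasDerivAt_id s).div_const 2)
    have h2 := (hG' _ (hψ0 (s / 2)))
    have h3 := hp.hasDerivAt_soundSpeed (hG _ (hψ0 (s / 2))).1
    have h4 : HasDerivAt (fun y => c (G y)) (φ (ψ (s / 2))) (ψ (s / 2)) := h3.comp _ h2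
    exact HasDerivAt.comp (h₂ := fun y => c (G y)) (h := fun s => ψ (s / 2)) s h4 h1
  have cg' : Continuous g' :=
    (cφ.comp_continuous (by fun_prop) (fun s => hψ _)).mul (by fun_prop)
  have hg'L : ∀ s, |g' s| ≤ Lφ * (L * (1 / 2)) := by
    intro s
    have h1 : |φ (ψ (s / 2))| ≤ Lφ := hLφ _ (hψ _)
    have h2 := bψ' (s / 2)
    change |φ (ψ (s / 2)) * (ψ' (s / 2) * (1 / 2))| ≤ _
    rw [abs_mul (φ _), abs_mul (ψ' _), abs_of_pos (by norm_num : (0 : ℝ) < 1 / 2)]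
    have := (abs_nonneg _).trans h1
    gcongr
  have hM' : 0 ≤ M + c (1 + δ) * M := by
    have := hp.soundSpeed_pos hδ1
    positivity
  obtain ⟨τ₀, hτ₀, E, hE⟩ := exists_local_diagonal hcm0 dg cg' (fun s => hcm1 _ (hψ _))
    (fun s => hcM1 _ (hψ _)) hg'L hM'
  -- The time derivatives of w and z are at most cM * |E|, so up to this time each moves by at most
  -- θm / 2 and (w - z) / 2 stays where the truncation is the identity.
  refine ⟨min τ₀ (θm / (2 * (cM * |E| + 1))), by positivity, ?_⟩
  set τ := min τ₀ (θm / (2 * (cM * |E| + 1))) with hτ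
  intro v₀ u₀ sv su hv1 hvV hu0 hdv hdu
  have hv01 : ∀ x, 1 < v₀ x := fun x => hδ1.trans_le (hv1 x)
  have dv₀ : ∀ x, HasDerivAt v₀ (deriv v₀ x) x := fun x =>
    (sv.differentiable (by norm_num) x).hasDerivAt
  have du₀ : ∀ x, HasDerivAt u₀ (deriv u₀ x) x := fun x =>
    (su.differentiable (by norm_num) x).hasDerivAt
  have dθ : ∀ x, HasDerivAt (fun x => θ (v₀ x)) (-c (v₀ x) * deriv v₀ x) x := fun x =>
    (hp.hasDerivAt_theta (hv01 x)).comp x (dv₀ x)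
  have cc : Continuous fun x => c (v₀ x) :=
    hp.continuousOn_soundSpeed.comp_continuous sv.continuous hv01
  have cdv := sv.continuous_deriv le_rfl
  have cdu := su.continuous_deriv le_rfl
  have bcv : ∀ x, |c (v₀ x) * deriv v₀ x| ≤ c (1 + δ) * M := by
    intro x
    rw [abs_mul, abs_of_pos (hp.soundSpeed_pos (hv01 x))]
    exact mul_le_mul (hp.antitoneOn_soundSpeed hδ1 (hv01 x) (hv1 x)) (hdv x) (abs_nonneg _)
      (hp.soundSpeed_pos hδ1).le
  obtain ⟨w, z, wx, zx, w0, z0, hwz⟩ := hE (fun x => u₀ x + θ (v₀ x)) (fun x => u₀ x - θ (v₀ x))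
    (fun x => deriv u₀ x + -c (v₀ x) * deriv v₀ x) (fun x => deriv u₀ x - -c (v₀ x) * deriv v₀ x)
    (fun x => (du₀ x).add (dθ x)) (fun x => (du₀ x).sub (dθ x)) (cdu.add (cc.neg.mul cdv)) (cdu.sub (cc.neg.mul cdv))
    (fun x => by
      refine (abs_add_le _ _).trans (add_le_add (hdu x) ?_)
      rw [neg_mul, abs_neg]; exact bcv x)
    (fun x => by
      refine (abs_sub _ _).trans (add_le_add (hdu x) ?_)
      rw [neg_mul, abs_neg]; exact bcv x)
  have near : ∀ (f : ℝ × ℝ → ℝ) (ft fx : ℝ × ℝ → ℝ),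
      (∀ q : ℝ × ℝ, |q.1| < τ → HasFDerivAt f (ft q • π₁ + fx q • π₂) q) →
      (∀ q : ℝ × ℝ, |q.1| < τ → |ft q| ≤ cM * |E|) →
      ∀ q : ℝ × ℝ, |q.1| < τ → |f q - f (0, q.2)| ≤ θm / 2 := by
    intro f ft fx hf hft q hq
    have hd : ∀ s ∈ Ioo (-τ) τ, HasDerivWithinAt (fun s => f (s, q.2)) (ft (s, q.2)) (Ioo (-τ) τ) s
        := by
      intro s hs
      have := hasDerivWithinAt_along (X := fun _ => q.2) (subset_univ (Ioo (-τ) τ))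
        (hf (s, q.2) (abs_lt.mpr hs)).hasFDerivWithinAt (hasDerivWithinAt_const s _ q.2)
      simpa using this
    have hτ0 : 0 < τ := (abs_nonneg _).trans_lt hq
    have h1 := (convex_Ioo (-τ) τ).norm_image_sub_le_of_norm_hasDerivWithin_le hd
      (fun s hs => hft (s, q.2) (abs_lt.mpr hs)) (x := 0) (y := q.1) ⟨by linarith, hτ0⟩
      (abs_lt.mp hq)
    rw [sub_zero, Real.norm_eq_abs, Real.norm_eq_abs] at h1
    refine h1.trans ?_
    have h2 : |q.1| ≤ θm / (2 * (cM * |E| + 1)) := hq.le.trans (min_le_right _ _)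
    have h3 : 0 < cM * |E| + 1 := by positivity
    calc cM * |E| * |q.1| ≤ (cM * |E| + 1) * (θm / (2 * (cM * |E| + 1))) := by
          gcongr; linarith
      _ = θm / 2 := by field_simp
  have hτ₀' : ∀ q : ℝ × ℝ, |q.1| < τ → |q.1| < τ₀ := fun q hq => hq.trans_le (min_le_left _ _)
  have hgb : ∀ s, 0 < g s ∧ g s ≤ cM := fun s =>
    ⟨hcm0.trans_le (hcm1 _ (hψ _)), hcM1 _ (hψ _)⟩
  have bw : ∀ q : ℝ × ℝ, |q.1| < τ → |w q - w (0, q.2)| ≤ θm / 2 := by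
    refine near w _ wx (fun q hq => (hwz q (hτ₀' q hq)).1) (fun q hq => ?_)
    rw [abs_neg, abs_mul, abs_of_pos (hgb _).1]
    exact mul_le_mul (hgb _).2 ((hwz q (hτ₀' q hq)).2.2.2.2.1.trans (le_abs_self E))
      (abs_nonneg _) hcM0.le
  have bz : ∀ q : ℝ × ℝ, |q.1| < τ → |z q - z (0, q.2)| ≤ θm / 2 := by
    refine near z _ zx (fun q hq => (hwz q (hτ₀' q hq)).2.1) (fun q hq => ?_)
    rw [abs_mul, abs_of_pos (hgb _).1]
    exact mul_le_mul (hgb _).2 ((hwz q (hτ₀' q hq)).2.2.2.2.2.trans (le_abs_self E))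
      (abs_nonneg _) hcM0.le
  have hrange : ∀ q : ℝ × ℝ, |q.1| < τ → (w q - z q) / 2 ∈ Icc (θm / 2) (θ1 + θm) := by
    intro q hq
    have h1 := abs_le.mp (bw q hq)
    have h2 := abs_le.mp (bz q hq)
    rw [w0] at h1
    rw [z0] at h2
    have h3 : θ (v₀ q.2) ≤ θ1 := hp.strictAntiOn_theta.antitoneOn hδ1 (hv01 _) (hv1 _)
    have h4 : θm ≤ θ (v₀ q.2) := hp.strictAntiOn_theta.antitoneOn (hv01 _) hV1 (hvV _)
    constructor <;> linarith
  have hpos : ∀ q : ℝ × ℝ, |q.1| < τ → 0 < (w q - z q) / 2 := fun q hq =>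
    (by positivity : 0 < θm / 2).trans_le (hrange q hq).1
  have hgc : ∀ q : ℝ × ℝ, |q.1| < τ → g (w q - z q) = c (G ((w q - z q) / 2)) := by
    intro q hq
    change c (G (ψ ((w q - z q) / 2))) = _
    rw [hψid _ (hrange q hq)]
  let v : ℝ → ℝ → ℝ := fun t x => G ((w (t, x) - z (t, x)) / 2)
  let u : ℝ → ℝ → ℝ := fun t x => (w (t, x) + z (t, x)) / 2
  let cq : ℝ × ℝ → ℝ := fun q => c (v q.1 q.2)
  let vx : ℝ × ℝ → ℝ := fun q => (zx q - wx q) / (2 * cq q)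
  let ux : ℝ × ℝ → ℝ := fun q => (wx q + zx q) / 2
  have hv1' : ∀ q : ℝ × ℝ, |q.1| < τ → 1 < v q.1 q.2 := fun q hq => (hG _ (hpos q hq)).1
  have hcq : ∀ q : ℝ × ℝ, |q.1| < τ → cq q ∈ Icc cm cM := fun q hq => by
    have : cq q = g (w q - z q) := (hgc q hq).symm
    rw [this]
    exact ⟨hcm1 _ (hψ _), hcM1 _ (hψ _)⟩
  have hcq0 : ∀ q : ℝ × ℝ, |q.1| < τ → 0 < cq q := fun q hq => hcm0.trans_le (hcq q hq).1
  have hDv : ∀ q : ℝ × ℝ, |q.1| < τ → HasFDerivAt (fun q : ℝ × ℝ => v q.1 q.2)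
      (ux q • π₁ + vx q • π₂) q := by
    intro q hq
    obtain ⟨h1, h2, -⟩ := hwz q (hτ₀' q hq)
    rw [hgc q hq] at h1 h2
    have h3 := ((h1.sub h2).const_mul (1 / 2 : ℝ))
    have h3' : HasFDerivAt (fun q => (w q - z q) / 2) _ q := h3.congr_of_eventuallyEq
      (Eventually.of_forall fun p => by
        change (w p - z p) / 2 = 1 / 2 * (w p - z p); ring)
    refine ((hG' _ (hpos q hq)).comp_hasFDerivAt q h3').congr_fderiv ?_
    have := (hcq0 q hq).ne'
    ext
    · simp only [ux, vx]
      simp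
      change -((cq q)⁻¹ * (2⁻¹ * (-(cq q * wx q) - cq q * zx q))) = _
      field_simp; ring
    · simp only [ux, vx]
      simp
      change -((cq q)⁻¹ * (2⁻¹ * (wx q - zx q))) = _
      field_simp; ring
  have hDu : ∀ q : ℝ × ℝ, |q.1| < τ → HasFDerivAt (fun q : ℝ × ℝ => u q.1 q.2)
      ((speedSq κ γ γt ε (v q.1 q.2) * vx q) • π₁ + ux q • π₂) q := by
    intro q hq
    obtain ⟨h1, h2, -⟩ := hwz q (hτ₀' q hq)
    rw [hgc q hq] at h1 h2
    have h3 := ((h1.add h2).const_mul (1 / 2 : ℝ))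
    have h3' : HasFDerivAt (fun q => (w q + z q) / 2) _ q := h3.congr_of_eventuallyEq
      (Eventually.of_forall fun p => by
        change (w p + z p) / 2 = 1 / 2 * (w p + z p); ring)
    refine h3'.congr_fderiv ?_
    rw [← hp.soundSpeed_mul_self (hv1' q hq)]
    change _ = (cq q * cq q * vx q) • π₁ + ux q • π₂
    have := (hcq0 q hq).ne'
    ext
    · simp only [ux, vx]
      simp
      change -(2⁻¹ * (cq q * wx q)) + 2⁻¹ * (cq q * zx q) =
        cq q * cq q * ((zx q - wx q) / (2 * cq q))
      field_simp; ring
    · simp only [ux, vx]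
      simp
      ring
  have hcc : ∀ q : ℝ × ℝ, |q.1| < τ → ContinuousAt cq q := fun q hq =>
    ContinuousAt.comp (g := c) (f := fun q : ℝ × ℝ => v q.1 q.2)
      (hp.hasDerivAt_soundSpeed (hv1' q hq)).continuousAt (hDv q hq).continuousAt
  obtain ⟨hS, hSd⟩ := Solves.of_hasFDerivAt (τ := τ) hv1' hDv hDu
    (fun q hq => by
      obtain ⟨-, -, h1, h2, -⟩ := hwz q (hτ₀' q hq)
      exact (h2.sub h1).div (continuousAt_const.mul (hcc q hq))
        (mul_pos two_pos (hcq0 q hq)).ne')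
    (fun q hq => by
      obtain ⟨-, -, h1, h2, -⟩ := hwz q (hτ₀' q hq)
      exact (h1.add h2).div_const 2)
  obtain ⟨BG, hBG⟩ := (isCompact_Icc (a := θm / 2) (b := θ1 + θm)).exists_bound_of_continuousOn
    (f := G) (fun s hs => (hG' s ((by positivity : 0 < θm / 2).trans_le hs.1)).continuousAt.continuousWithinAt)
  refine ⟨v, u, hS, fun x => ?_, fun x => ?_, max (max BG (M + θm)) (max (|E| / cm) |E|),
    fun t ht x => ?_⟩
  · change G ((w (0, x) - z (0, x)) / 2) = _
    rw [w0, z0]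
    ring_nf
    exact hGθ _ (hv01 x)
  · change (w (0, x) + z (0, x)) / 2 = _
    rw [w0, z0]
    ring
  · have ht' : |t| < τ := abs_lt.mpr ht
    obtain ⟨-, -, -, -, h1, h2⟩ := hwz (t, x) (hτ₀' (t, x) ht')
    have h1' := h1.trans (le_abs_self E)
    have h2' := h2.trans (le_abs_self E)
    have h3 : |zx (t, x) - wx (t, x)| ≤ 2 * |E| := (abs_sub _ _).trans (by linarith)
    rw [(hSd t ht x).1, (hSd t ht x).2]
    refine ⟨le_max_of_le_left (le_max_of_le_left (hBG _ (hrange (t, x) ht'))),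
      le_max_of_le_left (le_max_of_le_right ?_), le_max_of_le_right (le_max_of_le_left ?_),
      le_max_of_le_right (le_max_of_le_right ?_)⟩
    · have h1 := abs_le.mp (bw (t, x) ht')
      have h2 := abs_le.mp (bz (t, x) ht')
      rw [w0] at h1
      rw [z0] at h2
      have h4 := abs_le.mp (hu0 x)
      change |(w (t, x) + z (t, x)) / 2| ≤ _
      simp only at h1 h2
      rw [abs_le]
      constructor <;> linarith
    · change |(zx (t, x) - wx (t, x)) / (2 * cq (t, x))| ≤ _
      have h5 := (hcq (t, x) ht').1
      have h6 := hcq0 (t, x) ht'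
      rw [abs_div, abs_of_pos (mul_pos two_pos h6)]
      calc _ ≤ 2 * |E| / (2 * cm) := by gcongr
        _ = |E| / cm := by field_simp
    · change |(wx (t, x) + zx (t, x)) / 2| ≤ _
      rw [abs_div, abs_two]
      have := abs_add_le (wx (t, x)) (zx (t, x))
      linarith

end

/-! ### Characteristics and transport of gradients -/

section

/-- Characteristic curves of a bounded `C¹` speed through any point of `[0, T] × ℝ`. -/
lemma exists_characteristic {T Λ L : ℝ} {σ σt σx : ℝ × ℝ → ℝ}
    (hσ : ∀ t ∈ Icc 0 T, ∀ x, HasFDerivWithinAt σ (σt (t, x) • π₁ + σx (t, x) • π₂)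
      (Icc 0 T ×ˢ univ) (t, x))
    (bσ : ∀ t ∈ Icc 0 T, ∀ x, |σ (t, x)| ≤ Λ) (bσx : ∀ t ∈ Icc 0 T, ∀ x, |σx (t, x)| ≤ L)
    {t₀ : ℝ} (ht₀ : t₀ ∈ Icc 0 T) (x₀ : ℝ) :
    ∃ X : ℝ → ℝ, X t₀ = x₀ ∧
      ∀ t ∈ Icc 0 T, HasDerivWithinAt X (σ (t, X t)) (Icc 0 T) t := by
  have hΛ : 0 ≤ Λ := (abs_nonneg _).trans (bσ t₀ ht₀ 0)
  have hL : 0 ≤ L := (abs_nonneg _).trans (bσx t₀ ht₀ 0)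
  have hT : 0 ≤ T := ht₀.1.trans ht₀.2
  lift Λ to NNReal using hΛ
  lift L to NNReal using hL
  -- The speed is bounded by Λ, so a ball of radius Λ T around x₀ cannot be left during [0, T]; the
  -- curve therefore exists on the whole interval.
  have hpl : IsPicardLindelof (fun t x => σ (t, x)) (⟨t₀, ht₀⟩ : Icc 0 T) x₀
      (Λ * T.toNNReal) 0 Λ L := by
    refine ⟨fun t ht => ?_, fun x _ => ?_, fun t ht x _ => ?_, ?_⟩
    · refine Convex.lipschitzOnWith_of_nnnorm_hasDerivWithin_le (convex_closedBall _ _)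
        (f' := fun x => σx (t, x))
        (fun x _ => (hasDerivAt_slice ht (hσ t ht x)).hasDerivWithinAt) (fun x _ => ?_)
      rw [← NNReal.coe_le_coe]
      exact bσx t ht x
    · intro t ht
      have := hasDerivWithinAt_along (X := fun _ => x) Subset.rfl (hσ t ht x)
        (hasDerivWithinAt_const t _ x)
      exact this.continuousWithinAt
    · exact bσ t ht x
    · rw [NNReal.coe_mul, Real.coe_toNNReal _ hT, NNReal.coe_zero, sub_zero, sub_zero]
      exact mul_le_mul_of_nonneg_left (max_le (by linarith [ht₀.1]) ht₀.2) Λ.2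
  exact hpl.exists_eq_forall_mem_Icc_hasDerivWithinAt₀

lemma eq_of_hasDerivWithinAt_zero {T : ℝ} {f : ℝ → ℝ}
    (hf : ∀ t ∈ Icc 0 T, HasDerivWithinAt f 0 (Icc 0 T) t) {s t : ℝ} (hs : s ∈ Icc 0 T)
    (ht : t ∈ Icc 0 T) : f s = f t := by
  have := (convex_Icc 0 T).norm_image_sub_le_of_norm_hasDerivWithin_le (C := 0) hf
    (fun _ _ => by simp) hs ht
  rw [zero_mul, norm_le_zero_iff] at this
  linarith

lemma hasDerivWithinAt_integral_Icc {T t : ℝ} {m : ℝ → ℝ} (hm : ContinuousOn m (Icc 0 T))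
    (ht : t ∈ Icc 0 T) :
    HasDerivWithinAt (fun t => ∫ s in (0 : ℝ)..t, m s) (m t) (Icc 0 T) t := by
  have : Fact (t ∈ Icc 0 T) := ⟨ht⟩
  apply intervalIntegral.integral_hasDerivWithinAt_right _
    (hm.stronglyMeasurableAtFilter_nhdsWithin measurableSet_Icc t) (hm t ht)
  apply ContinuousOn.intervalIntegrable
  exact hm.mono (uIcc_subset_Icc ⟨le_rfl, ht.1.trans ht.2⟩ ht)

/-- Solutions of scalar linear equations keep their sign. -/
lemma exists_exp_of_linear {T : ℝ} {f m : ℝ → ℝ} (hm : ContinuousOn m (Icc 0 T))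
    (hf : ∀ t ∈ Icc 0 T, HasDerivWithinAt f (m t * f t) (Icc 0 T) t) {t : ℝ}
    (ht : t ∈ Icc 0 T) : ∃ r > 0, f t = r * f 0 := by
  let P : ℝ → ℝ := fun t => ∫ s in (0 : ℝ)..t, m s
  have h1 : ∀ t ∈ Icc 0 T, HasDerivWithinAt (fun t => f t * Real.exp (-P t)) 0 (Icc 0 T) t := by
    intro t ht
    refine ((hf t ht).mul ((hasDerivWithinAt_integral_Icc hm ht).neg.exp)).congr_deriv ?_
    ring
  have h2 := eq_of_hasDerivWithinAt_zero h1 (⟨le_rfl, ht.1.trans ht.2⟩ : (0 : ℝ) ∈ Icc 0 T) ht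
  have h3 : P 0 = 0 := intervalIntegral.integral_same
  refine ⟨Real.exp (P t), Real.exp_pos _, ?_⟩
  simp only [h3, neg_zero, Real.exp_zero, mul_one] at h2
  rw [h2, mul_comm (f t), ← mul_assoc, ← Real.exp_add, add_neg_cancel, Real.exp_zero, one_mul]

/-- Transport of the gradient along characteristics, for `C¹` solutions of `∂ₜf + σ ∂ₓf = 0`. -/
theorem hasDerivWithinAt_gradient_along {T B L : ℝ} {f fx σ σx : ℝ × ℝ → ℝ}
    (hf : ∀ t ∈ Icc 0 T, ∀ x, HasFDerivWithinAt f
      ((-(σ (t, x) * fx (t, x))) • π₁ + fx (t, x) • π₂) (Icc 0 T ×ˢ univ) (t, x))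
    (cfx : ContinuousOn fx (Icc 0 T ×ˢ univ)) (bfx : ∀ t ∈ Icc 0 T, ∀ x, |fx (t, x)| ≤ B)
    (cσ : ContinuousOn σ (Icc 0 T ×ˢ univ)) (cσx : ContinuousOn σx (Icc 0 T ×ˢ univ))
    (hσ : ∀ t ∈ Icc 0 T, ∀ x, HasDerivAt (fun y => σ (t, y)) (σx (t, x)) x)
    (bσx : ∀ t ∈ Icc 0 T, ∀ x, |σx (t, x)| ≤ L)
    {X : ℝ → ℝ} (hX : ∀ t ∈ Icc 0 T, HasDerivWithinAt X (σ (t, X t)) (Icc 0 T) t)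
    {t : ℝ} (ht : t ∈ Icc 0 T) :
    HasDerivWithinAt (fun s => fx (s, X s)) (-σx (t, X t) * fx (t, X t)) (Icc 0 T) t := by
  have cX : ContinuousOn X (Icc 0 T) := fun t ht => (hX t ht).continuousWithinAt
  have along : ∀ (F : ℝ × ℝ → ℝ) (h : ℝ), ContinuousOn F (Icc 0 T ×ˢ univ) →
      ContinuousOn (fun s => F (s, X s + h)) (Icc 0 T) := fun F h hF =>
    hF.comp (continuousOn_id.prodMk (cX.add continuousOn_const)) (fun s hs => ⟨hs, mem_univ _⟩)
  have along0 : ∀ F : ℝ × ℝ → ℝ, ContinuousOn F (Icc 0 T ×ˢ univ) →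
      ContinuousOn (fun s => F (s, X s)) (Icc 0 T) := fun F hF => by
    simpa using along F 0 hF
  have h0 : (0 : ℝ) ∈ Icc 0 T := ⟨le_rfl, ht.1.trans ht.2⟩
  -- The solution is only C¹, so the equation cannot be differentiated in x. The difference
  -- quotients `D h` along the curve have derivative `d h`, in which only a difference quotient of σ
  -- appears; the integrated identity passes to the limit h → 0 by dominated convergence.
  let D : ℝ → ℝ → ℝ := fun h s => h⁻¹ • (f (s, X s + h) - f (s, X s))
  let d : ℝ → ℝ → ℝ := fun h s => -(h⁻¹ • (σ (s, X s + h) - σ (s, X s))) * fx (s, X s + h)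
  let e : ℝ → ℝ := fun s => -σx (s, X s) * fx (s, X s)
  have ce : ContinuousOn e (Icc 0 T) := (along0 _ cσx).neg.mul (along0 _ cfx)
  have cd : ∀ h, ContinuousOn (d h) (Icc 0 T) := fun h =>
    (((along σ h cσ).sub (along0 σ cσ)).const_smul h⁻¹).neg.mul (along fx h cfx)
  have hD : ∀ h, ∀ s ∈ Icc 0 T, HasDerivWithinAt (D h) (d h s) (Icc 0 T) s := by
    intro h s hs
    have h1 := hasDerivWithinAt_along (X := fun s => X s + h) Subset.rfl (hf s hs (X s + h))
      ((hX s hs).add_const h)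
    have h2 := hasDerivWithinAt_along Subset.rfl (hf s hs (X s)) (hX s hs)
    refine ((h1.sub h2).const_smul h⁻¹).congr_deriv ?_
    simp only [d, smul_eq_mul]
    ring
  have hint : ∀ s ∈ Icc 0 T, fx (s, X s) = fx (0, X 0) + ∫ r in (0 : ℝ)..s, e r := by
    intro s hs
    have hsub : Icc 0 s ⊆ Icc 0 T := Icc_subset_Icc_right hs.2
    have hI : uIoc 0 s ⊆ Icc 0 T := by
      rw [uIoc_of_le hs.1]; exact Ioc_subset_Icc_self.trans hsub
    have eqD : ∀ h, ∫ r in (0 : ℝ)..s, d h r = D h s - D h 0 := by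
      intro h
      refine intervalIntegral.integral_eq_sub_of_hasDerivAt_of_le hs.1
        (fun r hr => ((hD h r (hsub hr)).mono hsub).continuousWithinAt) (fun r hr => ?_) ?_
      · exact (hD h r (hsub (Ioo_subset_Icc_self hr))).hasDerivAt
          (Icc_mem_nhds hr.1 (hr.2.trans_le hs.2))
      · exact ((cd h).mono (by rw [uIcc_of_le hs.1]; exact hsub)).intervalIntegrable
    have limD : ∀ r ∈ Icc 0 T, Tendsto (fun h => D h r) (𝓝[≠] 0) (𝓝 (fx (r, X r))) :=
      fun r hr => (hasDerivAt_slice hr (hf r hr (X r))).tendsto_slope_zero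
    have limd : ∀ r ∈ Icc 0 T, Tendsto (fun h => d h r) (𝓝[≠] 0) (𝓝 (e r)) := by
      intro r hr
      refine ((hσ r hr (X r)).tendsto_slope_zero).neg.mul ?_
      have h1 : Continuous fun h => fx (r, X r + h) :=
        cfx.comp_continuous (by fun_prop) (fun h => ⟨hr, mem_univ _⟩)
      have h2 := h1.tendsto 0
      rw [add_zero] at h2
      exact h2.mono_left nhdsWithin_le_nhds
    have lim1 : Tendsto (fun h => ∫ r in (0 : ℝ)..s, d h r) (𝓝[≠] 0)
        (𝓝 (∫ r in (0 : ℝ)..s, e r)) := by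
      refine intervalIntegral.tendsto_integral_filter_of_dominated_convergence (fun _ => L * B)
        (Eventually.of_forall fun h => ((cd h).mono hI).aestronglyMeasurable measurableSet_uIoc)
        ?_ (by simp) (Eventually.of_forall fun r hr => limd r (hI hr))
      filter_upwards [self_mem_nhdsWithin] with h hh
      refine Eventually.of_forall fun r hr => ?_
      have hr' := hI hr
      have hL : 0 ≤ L := (abs_nonneg _).trans (bσx r hr' 0)
      rw [Real.norm_eq_abs, abs_mul, abs_neg, smul_eq_mul, abs_mul, abs_inv]
      refine mul_le_mul ?_ (bfx r hr' _) (abs_nonneg _) hL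
      have h1 := convex_univ.norm_image_sub_le_of_norm_hasDerivWithin_le
        (f := fun y => σ (r, y)) (f' := fun y => σx (r, y)) (C := L)
        (fun y _ => (hσ r hr' y).hasDerivWithinAt) (fun y _ => bσx r hr' y)
        (mem_univ (X r)) (mem_univ (X r + h))
      rw [add_sub_cancel_left, Real.norm_eq_abs, Real.norm_eq_abs] at h1
      have h2 : 0 < |h| := abs_pos.mpr hh
      rw [inv_mul_le_iff₀ h2]
      linarith
    have lim2 := (limD s hs).sub (limD 0 h0)
    simp only [eqD] at lim1
    have := tendsto_nhds_unique lim1 lim2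
    linarith
  refine ((hasDerivWithinAt_integral_Icc ce ht).const_add (fx (0, X 0))).congr hint (hint t ht)

end

/-! ### Riemann invariants and the Riccati equation -/

section

variable {κ γ γt ε : ℝ}

lemma exists_hasDerivAt_eq_mul_sub {f f' : ℝ → ℝ} {s : Set ℝ} (hs : OrdConnected s)
    (hf : ∀ x ∈ s, HasDerivAt f (f' x) x) {x y : ℝ} (hx : x ∈ s) (hy : y ∈ s) :
    ∃ ξ ∈ s, f y - f x = f' ξ * (y - x) := by
  rcases lt_trichotomy x y with h | h | h
  · obtain ⟨ξ, hξ, e⟩ := exists_hasDerivAt_eq_slope f f' h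
      (fun z hz => (hf z (hs.out hx hy hz)).continuousAt.continuousWithinAt)
      (fun z hz => hf z (hs.out hx hy (Ioo_subset_Icc_self hz)))
    exact ⟨ξ, hs.out hx hy (Ioo_subset_Icc_self hξ), by
      rw [e]; have : y - x ≠ 0 := by linarith
      field_simp⟩
  · exact ⟨x, hx, by rw [h]; ring⟩
  · obtain ⟨ξ, hξ, e⟩ := exists_hasDerivAt_eq_slope f f' h
      (fun z hz => (hf z (hs.out hy hx hz)).continuousAt.continuousWithinAt)
      (fun z hz => hf z (hs.out hy hx (Ioo_subset_Icc_self hz)))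
    exact ⟨ξ, hs.out hy hx (Ioo_subset_Icc_self hξ), by
      rw [e]; have : x - y ≠ 0 := by linarith
      field_simp; ring⟩

lemma Solves.mono {I J : Set ℝ} {v u : ℝ → ℝ → ℝ} (h : Solves κ γ γt ε I v u) (hJ : J ⊆ I) :
    Solves κ γ γt ε J v u :=
  ⟨fun t ht => h.one_lt t (hJ ht),
    fun t ht x => (h.fderiv_v t (hJ ht) x).mono (prod_mono_left hJ),
    fun t ht x => (h.fderiv_u t (hJ ht) x).mono (prod_mono_left hJ),
    h.continuousOn_dv.mono (prod_mono_left hJ), h.continuousOn_du.mono (prod_mono_left hJ)⟩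

/-- The `x`-derivative of the Riemann invariant `u + s θ(v)`, `s = ±1`. -/
noncomputable def riemannGrad (κ γ γt ε s : ℝ) (v u : ℝ → ℝ → ℝ) (q : ℝ × ℝ) : ℝ :=
  deriv (u q.1) q.2 - s * (soundSpeed κ γ γt ε (v q.1 q.2) * deriv (v q.1) q.2)

/-- The Riemann invariant `u + s θ(v)`, `s = ±1`. -/
noncomputable def riemann (κ γ γt ε s : ℝ) (v u : ℝ → ℝ → ℝ) (q : ℝ × ℝ) : ℝ :=
  u q.1 q.2 + s * theta κ γ γt ε (v q.1 q.2)

/-- The coefficient `-c'/(2 c^{3/2})` of the Riccati equation for the gradients. -/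
noncomputable def riccatiCoeff (κ γ γt ε v : ℝ) : ℝ :=
  -speedDeriv κ γ γt ε v / (2 * soundSpeed κ γ γt ε v * √(soundSpeed κ γ γt ε v))

/-- The weighted gradient `√c ∂ₓ(u + s θ(v))`. -/
noncomputable def weightedGrad (κ γ γt ε s : ℝ) (v u : ℝ → ℝ → ℝ) (q : ℝ × ℝ) : ℝ :=
  √(soundSpeed κ γ γt ε (v q.1 q.2)) * riemannGrad κ γ γt ε s v u q

/-- As c' = -p'' / (2c) and p'' is at most a multiple of c² / (v - 1), |c'| is at most a multiple of
c / (v - 1), which is largest at the smallest admissible v. -/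
lemma Parameters.abs_speedDeriv_le (hp : Parameters κ γ γt ε) {δ v : ℝ} (hδ : 0 < δ)
    (hv : 1 + δ ≤ v) :
    |speedDeriv κ γ γt ε v| ≤ (γ + γt + 2) / (2 * δ) * soundSpeed κ γ γt ε (1 + δ) := by
  have h1 : 1 < v := by linarith
  have hγ := hp.γ_pos; have hγt := hp.γt_pos
  have hc := hp.soundSpeed_pos h1
  rw [speedDeriv, abs_div, abs_neg, abs_of_pos (hp.pressureDeriv₂_pos h1),
    abs_of_pos (mul_pos two_pos hc), div_le_iff₀ (by positivity)]
  have h2 := hp.pressureDeriv₂_le h1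
  rw [← hp.soundSpeed_mul_self h1] at h2
  have h3 : soundSpeed κ γ γt ε v ≤ soundSpeed κ γ γt ε (1 + δ) :=
    hp.antitoneOn_soundSpeed (by simpa using hδ) h1 hv
  set c := soundSpeed κ γ γt ε v
  set c₁ := soundSpeed κ γ γt ε (1 + δ)
  have h4 : (γ + γt + 2) / (v - 1) ≤ (γ + γt + 2) / δ := by
    gcongr; linarith
  calc _ ≤ (γ + γt + 2) / (v - 1) * (c * c) := h2
    _ ≤ (γ + γt + 2) / δ * (c₁ * c) := by gcongr
    _ = _ := by field_simp

lemma Parameters.riccatiCoeff_pos (hp : Parameters κ γ γt ε) {v : ℝ} (hv : 1 < v) :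
    0 < riccatiCoeff κ γ γt ε v := by
  have h1 := hp.soundSpeed_pos hv
  have h2 := hp.speedDeriv_neg hv
  have h3 := Real.sqrt_pos.mpr h1
  unfold riccatiCoeff
  apply div_pos (by linarith) (by positivity)

namespace Solves

variable {I : Set ℝ} {v u : ℝ → ℝ → ℝ} (hS : Solves κ γ γt ε I v u) (hp : Parameters κ γ γt ε)
include hS hp

omit hp in
lemma fderiv_comp_v {φ φ' : ℝ → ℝ} (hφ : ∀ y, 1 < y → HasDerivAt φ (φ' y) y) {t : ℝ} (ht : t ∈ I)
    (x : ℝ) : HasFDerivWithinAt (fun q : ℝ × ℝ => φ (v q.1 q.2))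
      ((φ' (v t x) * deriv (u t) x) • π₁ + (φ' (v t x) * deriv (v t) x) • π₂)
      (I ×ˢ univ) (t, x) := by
  refine ((hφ _ (hS.one_lt t ht x)).comp_hasFDerivWithinAt (t, x)
    (hS.fderiv_v t ht x)).congr_fderiv ?_
  ext <;> simp

/-- Inserting ∂ₜv = ∂ₓu and ∂ₜu = c² ∂ₓv diagonalises the system. The relation s * s = 1 treats both
invariants at once. -/
lemma fderiv_riemann {s : ℝ} (hs : s * s = 1) {t : ℝ} (ht : t ∈ I) (x : ℝ) :
    HasFDerivWithinAt (riemann κ γ γt ε s v u)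
      ((-(s * soundSpeed κ γ γt ε (v t x) * riemannGrad κ γ γt ε s v u (t, x))) • π₁ +
        riemannGrad κ γ γt ε s v u (t, x) • π₂) (I ×ˢ univ) (t, x) := by
  have h1 := hS.fderiv_comp_v (fun y hy => hp.hasDerivAt_theta hy) ht x
  refine ((hS.fderiv_u t ht x).add (h1.const_mul s)).congr_fderiv ?_
  rw [← hp.soundSpeed_mul_self (hS.one_lt t ht x)]
  ext
  · simp [riemannGrad]
    linear_combination (-(soundSpeed κ γ γt ε (v t x)) ^ 2 * deriv (v t) x) * hs
  · simp [riemannGrad]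
    ring

omit hp in
lemma continuousOn_v : ContinuousOn (fun q : ℝ × ℝ => v q.1 q.2) (I ×ˢ univ) := by
  rintro ⟨t, x⟩ hq
  exact (hS.fderiv_v t hq.1 x).continuousWithinAt

omit hp in
lemma continuousOn_comp_v {φ : ℝ → ℝ} (hφ : ContinuousOn φ (Ioi 1)) :
    ContinuousOn (fun q : ℝ × ℝ => φ (v q.1 q.2)) (I ×ˢ univ) :=
  hφ.comp hS.continuousOn_v (fun q hq => hS.one_lt q.1 hq.1 q.2)

lemma continuousOn_riemannGrad (s : ℝ) :
    ContinuousOn (riemannGrad κ γ γt ε s v u) (I ×ˢ univ) :=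
  hS.continuousOn_du.sub (continuousOn_const.mul
    ((hS.continuousOn_comp_v hp.continuousOn_soundSpeed).mul hS.continuousOn_dv))

lemma abs_riemannGrad_le {s : ℝ} (hs : s * s = 1) {δ B : ℝ} (hδ : 0 < δ)
    {t : ℝ} (ht : t ∈ I) {x : ℝ} (hlow : 1 + δ ≤ v t x) (bv : |deriv (v t) x| ≤ B)
    (bu : |deriv (u t) x| ≤ B) :
    |riemannGrad κ γ γt ε s v u (t, x)| ≤ B + soundSpeed κ γ γt ε (1 + δ) * B := by
  have h1 : 1 < v t x := hS.one_lt t ht x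
  have hs1 : |s| = 1 := by
    rcases mul_self_eq_one_iff.mp hs with h | h <;> simp [h]
  have h3 : soundSpeed κ γ γt ε (v t x) ≤ soundSpeed κ γ γt ε (1 + δ) :=
    hp.antitoneOn_soundSpeed (by simpa using hδ) h1 hlow
  refine (abs_sub _ _).trans (add_le_add bu ?_)
  rw [abs_mul, hs1, one_mul, abs_mul, abs_of_pos (hp.soundSpeed_pos h1)]
  exact mul_le_mul h3 bv (abs_nonneg _) ((hp.soundSpeed_pos h1).le.trans h3)

end Solves

/-- Through every point there is a characteristic along which the Riemann invariant is constant
and the weighted gradient solves the Riccati equation. -/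
theorem Solves.exists_characteristic {T : ℝ} {v u : ℝ → ℝ → ℝ}
    (hS : Solves κ γ γt ε (Icc 0 T) v u) (hp : Parameters κ γ γt ε) {δ B : ℝ} (hδ : 0 < δ)
    (hlow : ∀ t ∈ Icc 0 T, ∀ x, 1 + δ ≤ v t x) (bv : ∀ t ∈ Icc 0 T, ∀ x, |deriv (v t) x| ≤ B)
    (bu : ∀ t ∈ Icc 0 T, ∀ x, |deriv (u t) x| ≤ B) {s : ℝ} (hs : s * s = 1) {t₀ : ℝ}
    (ht₀ : t₀ ∈ Icc 0 T) (x₀ : ℝ) :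
    ∃ X : ℝ → ℝ, X t₀ = x₀ ∧
      (∀ t ∈ Icc 0 T,
        HasDerivWithinAt X (s * soundSpeed κ γ γt ε (v t (X t))) (Icc 0 T) t) ∧
      (∀ t ∈ Icc 0 T, riemann κ γ γt ε s v u (t, X t) = riemann κ γ γt ε s v u (0, X 0)) ∧
      ∀ t ∈ Icc 0 T, HasDerivWithinAt (fun t => weightedGrad κ γ γt ε s v u (t, X t))
        (-riccatiCoeff κ γ γt ε (v t (X t)) * weightedGrad κ γ γt ε s v u (t, X t) ^ 2)
        (Icc 0 T) t := by
  have hs1 : |s| = 1 := by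
    rcases mul_self_eq_one_iff.mp hs with h | h <;> simp [h]
  have hδ1 : (1 : ℝ) < 1 + δ := by linarith
  set c := soundSpeed κ γ γt ε with hc
  set c' := speedDeriv κ γ γt ε with hc'
  let σ : ℝ × ℝ → ℝ := fun q => s * c (v q.1 q.2)
  let σt : ℝ × ℝ → ℝ := fun q => s * (c' (v q.1 q.2) * deriv (u q.1) q.2)
  let σx : ℝ × ℝ → ℝ := fun q => s * (c' (v q.1 q.2) * deriv (v q.1) q.2)
  have hσ : ∀ t ∈ Icc 0 T, ∀ x, HasFDerivWithinAt σ (σt (t, x) • π₁ + σx (t, x) • π₂)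
      (Icc 0 T ×ˢ univ) (t, x) := by
    intro t ht x
    refine ((hS.fderiv_comp_v (fun y hy => hp.hasDerivAt_soundSpeed hy) ht x).const_mul
      s).congr_fderiv ?_
    ext <;> simp [σt, σx, hc']
  have bσ : ∀ t ∈ Icc 0 T, ∀ x, |σ (t, x)| ≤ c (1 + δ) := by
    intro t ht x
    change |s * c (v t x)| ≤ _
    rw [abs_mul, hs1, one_mul, abs_of_pos (hp.soundSpeed_pos (hS.one_lt t ht x))]
    exact hp.antitoneOn_soundSpeed hδ1 (hS.one_lt t ht x) (hlow t ht x)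
  have bσx : ∀ t ∈ Icc 0 T, ∀ x, |σx (t, x)| ≤ (γ + γt + 2) / (2 * δ) * c (1 + δ) * B := by
    intro t ht x
    change |s * (c' (v t x) * deriv (v t) x)| ≤ _
    rw [abs_mul, hs1, one_mul, abs_mul]
    have h1 := hp.abs_speedDeriv_le hδ (hlow t ht x)
    exact mul_le_mul h1 (bv t ht x) (abs_nonneg _) ((abs_nonneg _).trans h1)
  obtain ⟨X, hX0, hX⟩ := PSystem.exists_characteristic hσ bσ bσx ht₀ x₀
  refine ⟨X, hX0, hX, ?_, ?_⟩
  · intro t ht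
    have h0 : (0 : ℝ) ∈ Icc 0 T := ⟨le_rfl, ht.1.trans ht.2⟩
    refine eq_of_hasDerivWithinAt_zero (f := fun t => riemann κ γ γt ε s v u (t, X t))
      (fun r hr => ?_) ht h0
    refine (hasDerivWithinAt_along Subset.rfl (hS.fderiv_riemann hp hs hr (X r))
      (hX r hr)).congr_deriv ?_
    change -(s * c (v r (X r)) * _) + _ * (s * c (v r (X r))) = 0
    ring
  · intro t ht
    have hc0 : 0 < c (v t (X t)) := hp.soundSpeed_pos (hS.one_lt t ht _)
    have hη := hasDerivWithinAt_gradient_along (f := riemann κ γ γt ε s v u)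
      (fx := riemannGrad κ γ γt ε s v u) (σ := σ) (σx := σx)
      (fun t ht x => hS.fderiv_riemann hp hs ht x) (hS.continuousOn_riemannGrad hp s)
      (fun t ht x => hS.abs_riemannGrad_le hp hs hδ ht (hlow t ht x) (bv t ht x) (bu t ht x))
      (continuousOn_const.mul (hS.continuousOn_comp_v hp.continuousOn_soundSpeed))
      (continuousOn_const.mul ((hS.continuousOn_comp_v hp.continuousOn_speedDeriv).mul
        hS.continuousOn_dv)) (fun t ht x => hasDerivAt_slice ht (hσ t ht x)) bσx hX ht
    have hcv := (hasDerivWithinAt_along Subset.rfl (hS.fderiv_comp_v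
      (fun y hy => hp.hasDerivAt_soundSpeed hy) ht (X t)) (hX t ht)).sqrt hc0.ne'
    -- With η the gradient, η' = -s c' v_x η, and √c has derivative c' (u_x + s c v_x) / (2√c) along
    -- the curve. The sum is c' η (u_x - s c v_x) / (2√c), and the bracket is η itself, so the
    -- equation closes.
    refine (hcv.mul hη).congr_deriv ?_
    have hr := Real.sqrt_pos.mpr hc0
    have hr2 : √(c (v t (X t))) * √(c (v t (X t))) = c (v t (X t)) := Real.mul_self_sqrt hc0.le
    simp only [weightedGrad, riemannGrad, riccatiCoeff, σx, σ, ← hc, ← hc']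
    generalize √(c (v t (X t))) = r at hr hr2 ⊢
    rw [← hr2]
    field_simp
    ring

end

/-! ### Bounds on the solution and uniqueness -/

section

variable {κ γ γt ε : ℝ}

/-- |u| + θ(v) is the larger of u + θ(v) and -(u - θ(v)). Each is carried unchanged from time 0
along its backward characteristic. -/
lemma Solves.riemann_bound {T : ℝ} {v u : ℝ → ℝ → ℝ}
    (hS : Solves κ γ γt ε (Icc 0 T) v u) (hp : Parameters κ γ γt ε) {δ B R : ℝ} (hδ : 0 < δ)
    (hlow : ∀ t ∈ Icc 0 T, ∀ x, 1 + δ ≤ v t x) (bv : ∀ t ∈ Icc 0 T, ∀ x, |deriv (v t) x| ≤ B)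
    (bu : ∀ t ∈ Icc 0 T, ∀ x, |deriv (u t) x| ≤ B)
    (h0 : ∀ x, |u 0 x| + theta κ γ γt ε (v 0 x) ≤ R) {t : ℝ} (ht : t ∈ Icc 0 T) (x : ℝ) :
    |u t x| + theta κ γ γt ε (v t x) ≤ R := by
  obtain ⟨X, hX0, -, hX, -⟩ := hS.exists_characteristic hp hδ hlow bv bu (s := 1) (by norm_num) ht x
  obtain ⟨Y, hY0, -, hY, -⟩ := hS.exists_characteristic hp hδ hlow bv bu (s := -1) (by norm_num)
    ht x
  have e1 := hX t ht
  have e2 := hY t ht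
  rw [hX0] at e1
  rw [hY0] at e2
  simp only [riemann] at e1 e2
  have a1 := h0 (X 0)
  have a2 := h0 (Y 0)
  have b1 := le_abs_self (u 0 (X 0))
  have b2 := neg_abs_le (u 0 (Y 0))
  rcases abs_cases (u t x) with ⟨h, -⟩ | ⟨h, -⟩ <;> rw [h] <;> linarith

/-- The specific volume stays away from the singular value `1`. -/
theorem Solves.low_bound {T : ℝ} {v u : ℝ → ℝ → ℝ}
    (hS : Solves κ γ γt ε (Icc 0 T) v u) (hp : Parameters κ γ γt ε) {δ B R : ℝ} (hδ : 0 < δ)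
    (hR : theta κ γ γt ε (1 + δ) = R) (bv : ∀ t ∈ Icc 0 T, ∀ x, |deriv (v t) x| ≤ B)
    (bu : ∀ t ∈ Icc 0 T, ∀ x, |deriv (u t) x| ≤ B)
    (h0 : ∀ x, |u 0 x| + theta κ γ γt ε (v 0 x) ≤ R) :
    ∀ t ∈ Icc 0 T, ∀ x, 1 + δ ≤ v t x := by
  have hδ1 : (1 : ℝ) < 1 + δ := by linarith
  have step : ∀ t ∈ Icc 0 T, ∀ x, |u t x| + theta κ γ γt ε (v t x) ≤ R → 1 + δ ≤ v t x := by
    intro t ht x h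
    by_contra hcon
    push Not at hcon
    have h1 := hp.strictAntiOn_theta (hS.one_lt t ht x) hδ1 hcon
    have h2 := abs_nonneg (u t x)
    linarith
  by_cases hT : 0 ≤ T
  swap
  · intro t ht; exact absurd (ht.1.trans ht.2) hT
  have hB : 0 ≤ B := (abs_nonneg _).trans (bu 0 ⟨le_rfl, hT⟩ 0)
  -- As |∂ₜv| ≤ B, during a time η the volume drops by at most δ / 2. So v ≥ 1 + δ weakens to v ≥ 1
  -- + δ / 2 over one step, which suffices for characteristics to exist; conservation of the
  -- invariants then restores 1 + δ, and one iterates.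
  set η := δ / (2 * B + 1) with hη
  have hη0 : 0 < η := by positivity
  have claim : ∀ n : ℕ, ∀ t ∈ Icc 0 T, t ≤ n * η → ∀ x, 1 + δ ≤ v t x := by
    intro n
    induction n with
    | zero =>
      intro t ht htn x
      have : t = 0 := le_antisymm (by simpa using htn) ht.1
      subst this
      exact step 0 ht x (h0 x)
    | succ n ih =>
      intro t ht htn x
      have hsub : Icc 0 t ⊆ Icc 0 T := Icc_subset_Icc_right ht.2
      have hlow : ∀ r ∈ Icc 0 t, ∀ x, 1 + δ / 2 ≤ v r x := by
        intro r hr x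
        have hr' := hsub hr
        set r₀ := min r (n * η) with hr₀
        have hr₀0 : 0 ≤ r₀ := le_min hr.1 (by positivity)
        have hr₀T : r₀ ∈ Icc 0 T := ⟨hr₀0, (min_le_left _ _).trans hr'.2⟩
        have h1 := ih r₀ hr₀T (min_le_right _ _) x
        have h2 : |r - r₀| ≤ η := by
          have : r ≤ n * η + η := by
            have := hr.2.trans htn
            push_cast at this
            linarith
          rw [abs_le]
          constructor
          · have : r₀ ≤ r := min_le_left _ _
            linarith
          · rw [hr₀]
            rcases min_choice r (n * η) with h | h <;> rw [h] <;> linarith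
        have h3 := (convex_Icc 0 T).norm_image_sub_le_of_norm_hasDerivWithin_le
          (f := fun r => v r x) (f' := fun r => deriv (u r) x) (C := B) (fun r hr => by
            have := hasDerivWithinAt_along (X := fun _ => x) Subset.rfl (hS.fderiv_v r hr x)
              (hasDerivWithinAt_const r _ x)
            simpa using this) (fun r hr => bu r hr x) hr₀T hr'
        rw [Real.norm_eq_abs, Real.norm_eq_abs] at h3
        have h4 : B * |r - r₀| ≤ δ / 2 := by
          calc B * |r - r₀| ≤ B * η := by gcongr
            _ ≤ δ / 2 := by
              rw [hη, mul_div_assoc', div_le_div_iff₀ (by positivity) two_pos]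
              nlinarith
        have h5 := (abs_le.mp (h3.trans h4)).1
        linarith
      have hres := (hS.mono hsub).riemann_bound hp (half_pos hδ) hlow
        (fun r hr => bv r (hsub hr)) (fun r hr => bu r (hsub hr)) h0 ⟨ht.1, le_rfl⟩ x
      exact step t ht x hres
  intro t ht x
  obtain ⟨n, hn⟩ := exists_nat_ge (t / η)
  exact claim n t ht ((div_le_iff₀ hη0).mp hn) x

/-- Uniqueness of bounded `C¹` solutions. -/
theorem Solves.unique {T : ℝ} {v₁ u₁ v₂ u₂ : ℝ → ℝ → ℝ}
    (h₁ : Solves κ γ γt ε (Icc 0 T) v₁ u₁) (h₂ : Solves κ γ γt ε (Icc 0 T) v₂ u₂)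
    (hp : Parameters κ γ γt ε) {δ B : ℝ} (hδ : 0 < δ)
    (low₁ : ∀ t ∈ Icc 0 T, ∀ x, 1 + δ ≤ v₁ t x) (low₂ : ∀ t ∈ Icc 0 T, ∀ x, 1 + δ ≤ v₂ t x)
    (b₁ : ∀ t ∈ Icc 0 T, ∀ x, |v₁ t x| ≤ B ∧ |u₁ t x| ≤ B ∧ |deriv (v₁ t) x| ≤ B ∧
      |deriv (u₁ t) x| ≤ B)
    (b₂ : ∀ t ∈ Icc 0 T, ∀ x, |v₂ t x| ≤ B ∧ |u₂ t x| ≤ B ∧ |deriv (v₂ t) x| ≤ B ∧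
      |deriv (u₂ t) x| ≤ B)
    (hv : ∀ x, v₁ 0 x = v₂ 0 x) (hu : ∀ x, u₁ 0 x = u₂ 0 x) :
    ∀ t ∈ Icc 0 T, ∀ x, v₁ t x = v₂ t x ∧ u₁ t x = u₂ t x := by
  intro t₁ ht₁ x₁
  have hT0 : (0 : ℝ) ∈ Icc 0 T := ⟨le_rfl, ht₁.1.trans ht₁.2⟩
  have hδ1 : (1 : ℝ) < 1 + δ := by linarith
  have hB0 : 0 ≤ B := (abs_nonneg _).trans (b₁ 0 hT0 0).1
  have hB1 : 1 < B := hδ1.trans_le ((low₁ 0 hT0 0).trans ((le_abs_self _).trans (b₁ 0 hT0 0).1))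
  set c := soundSpeed κ γ γt ε with hc
  set θ := theta κ γ γt ε with hθ
  have hcB : 0 < c B := hp.soundSpeed_pos hB1
  set Lc := (γ + γt + 2) / (2 * δ) * c (1 + δ) with hLc
  have hLc0 : 0 ≤ Lc := by
    have := hp.γ_pos; have := hp.γt_pos; have := hp.soundSpeed_pos hδ1
    positivity
  have hc1 : 0 < c (1 + δ) := hp.soundSpeed_pos hδ1
  -- On [1 + δ, B] the speed is Lipschitz as a function of θ: c' is bounded there, and θ' = -c is
  -- bounded away from 0.
  have speed_diff : ∀ a b, 1 + δ ≤ a → 1 + δ ≤ b → a ≤ B → b ≤ B →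
      |c a - c b| ≤ Lc / c B * |θ a - θ b| := by
    intro a b ha hb haB hbB
    obtain ⟨ξ, hξ, e1⟩ := exists_hasDerivAt_eq_mul_sub (f := c) (ordConnected_Icc (a := 1 + δ) (b := B))
      (fun y hy => hp.hasDerivAt_soundSpeed (hδ1.trans_le hy.1)) ⟨hb, hbB⟩ ⟨ha, haB⟩
    obtain ⟨ζ, hζ, e2⟩ := exists_hasDerivAt_eq_mul_sub (f := θ) (ordConnected_Icc (a := 1 + δ) (b := B))
      (fun y hy => hp.hasDerivAt_theta (hδ1.trans_le hy.1)) ⟨hb, hbB⟩ ⟨ha, haB⟩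
    have i1 : c B ≤ c ζ := hp.antitoneOn_soundSpeed (hδ1.trans_le hζ.1) hB1 hζ.2
    rw [e1, e2, abs_mul, abs_mul, abs_neg, ← hc, abs_of_pos (hcB.trans_le i1)]
    have i2 := hp.abs_speedDeriv_le hδ hξ.1
    calc _ ≤ Lc * |a - b| := by gcongr
      _ = Lc / c B * (c B * |a - b|) := by field_simp
      _ ≤ _ := by gcongr
  let P : ℝ → ℝ × ℝ → ℝ := fun s q => riemann κ γ γt ε s v₁ u₁ q - riemann κ γ γt ε s v₂ u₂ q
  set S := 2 * B + 2 * θ (1 + δ) with hSdef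
  set E := B + c (1 + δ) * B with hE
  have hE0 : 0 ≤ E := by positivity
  set K := Lc / c B * E with hK
  have hK0 : 0 ≤ K := by positivity
  have v_le : ∀ t ∈ Icc 0 T, ∀ x, v₁ t x ≤ B ∧ v₂ t x ≤ B := fun t ht x =>
    ⟨(le_abs_self _).trans (b₁ t ht x).1, (le_abs_self _).trans (b₂ t ht x).1⟩
  -- Iterated Gronwall estimate. Along a characteristic of the first solution, the difference of the
  -- invariants changes at rate (c(v₁) - c(v₂)) times a gradient of the second, and c(v₁) - c(v₂) is
  -- controlled by the differences of both invariants. Each pass gains a factor K t / (n + 1).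
  have claim : ∀ n : ℕ, ∀ t ∈ Icc 0 T, ∀ x, ∀ s : ℝ, s * s = 1 →
      |P s (t, x)| ≤ S * ((K * t) ^ n / n.factorial) := by
    intro n
    induction n with
    | zero =>
      intro t ht x s hs
      have hs1 : |s| = 1 := by
        rcases mul_self_eq_one_iff.mp hs with h | h <;> simp [h]
      have th : ∀ y, 1 + δ ≤ y → |s * θ y| ≤ θ (1 + δ) := by
        intro y hy
        rw [abs_mul, hs1, one_mul, abs_of_pos (hp.theta_pos (hδ1.trans_le hy))]
        exact hp.strictAntiOn_theta.antitoneOn hδ1 (hδ1.trans_le hy) hy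
      have e1 := th _ (low₁ t ht x)
      have e2 := th _ (low₂ t ht x)
      have e3 := (b₁ t ht x).2.1
      have e4 := (b₂ t ht x).2.1
      rw [abs_le] at e1 e2 e3 e4
      change |(u₁ t x + s * θ (v₁ t x)) - (u₂ t x + s * θ (v₂ t x))| ≤ _
      simp only [pow_zero, Nat.factorial_zero, Nat.cast_one, div_one, mul_one]
      rw [abs_le]
      constructor <;> linarith
    | succ n ih =>
      intro t ht x s hs
      have hs1 : |s| = 1 := by
        rcases mul_self_eq_one_iff.mp hs with h | h <;> simp [h]
      obtain ⟨X, hX0, hX, hXr, -⟩ := h₁.exists_characteristic hp hδ low₁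
        (fun t ht x => (b₁ t ht x).2.2.1) (fun t ht x => (b₁ t ht x).2.2.2) hs ht x
      have hd : ∀ r ∈ Icc 0 T, HasDerivWithinAt (fun r => P s (r, X r))
          (-(s * (c (v₁ r (X r)) - c (v₂ r (X r))) *
            riemannGrad κ γ γt ε s v₂ u₂ (r, X r))) (Icc 0 T) r := by
        intro r hr
        have d1 := hasDerivWithinAt_along Subset.rfl (h₁.fderiv_riemann hp hs hr (X r)) (hX r hr)
        have d2 := hasDerivWithinAt_along Subset.rfl (h₂.fderiv_riemann hp hs hr (X r)) (hX r hr)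
        refine (d1.sub d2).congr_deriv ?_
        ring
      have hPs : P s (0, X 0) = 0 := by
        simp only [P, riemann, hv, hu, sub_self]
      have hsub : Icc 0 t ⊆ Icc 0 T := Icc_subset_Icc_right ht.2
      have hmain := image_norm_le_of_norm_deriv_right_le_deriv_boundary
        (f := fun r => P s (r, X r)) (a := 0) (b := t)
        (f' := fun r => -(s * (c (v₁ r (X r)) - c (v₂ r (X r))) *
            riemannGrad κ γ γt ε s v₂ u₂ (r, X r)))
        (B := fun r => S * ((K * r) ^ (n + 1) / (n + 1).factorial))
        (B' := fun r => K * (S * ((K * r) ^ n / n.factorial)))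
        (fun r hr => ((hd r (hsub hr)).mono hsub).continuousWithinAt)
        (fun r hr => by
          have hr' := hsub (Ico_subset_Icc_self hr)
          refine (hd r hr').mono_of_mem_nhdsWithin ?_
          exact mem_of_superset (Ico_mem_nhdsGE (hr.2.trans_le ht.2))
            (fun y hy => ⟨hr.1.trans hy.1, hy.2.le⟩))
        (by simp [hPs])
        (fun r => by
          have h1 := ((hasDerivAt_id r).const_mul K).pow (n + 1)
          have h2 := (h1.div_const ((n + 1).factorial : ℝ)).const_mul S
          refine h2.congr_deriv ?_
          rw [Nat.factorial_succ]
          push_cast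
          simp only [id, mul_one]
          field_simp)
        (fun r hr => by
          have hr' := hsub (Ico_subset_Icc_self hr)
          rw [Real.norm_eq_abs, abs_neg, abs_mul, abs_mul, hs1, one_mul]
          have g1 := h₂.abs_riemannGrad_le hp hs hδ hr' (low₂ r hr' (X r))
            (b₂ r hr' (X r)).2.2.1 (b₂ r hr' (X r)).2.2.2
          have g2 := speed_diff _ _ (low₁ r hr' (X r)) (low₂ r hr' (X r)) (v_le r hr' (X r)).1
            (v_le r hr' (X r)).2
          have g3 : |θ (v₁ r (X r)) - θ (v₂ r (X r))| ≤ S * ((K * r) ^ n / n.factorial) := by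
            have p1 := ih r hr' (X r) 1 (by norm_num)
            have p2 := ih r hr' (X r) (-1) (by norm_num)
            simp only [P, riemann] at p1 p2
            rw [abs_le] at p1 p2 ⊢
            constructor <;> linarith
          calc _ ≤ (Lc / c B * (S * ((K * r) ^ n / n.factorial))) * E := by
                refine mul_le_mul (g2.trans ?_) g1 (abs_nonneg _) ?_
                · gcongr
                · exact mul_nonneg (by positivity) ((abs_nonneg _).trans g3)
            _ = _ := by rw [hK]; ring)
      have := hmain (right_mem_Icc.mpr ht.1)
      rw [hX0] at this
      exact this
  have hzero : ∀ s : ℝ, s * s = 1 → P s (t₁, x₁) = 0 := by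
    intro s hs
    have h1 := (FloorSemiring.tendsto_pow_div_factorial_atTop (K * t₁)).const_mul S
    rw [mul_zero] at h1
    have h2 := ge_of_tendsto' h1 (fun n => claim n t₁ ht₁ x₁ s hs)
    exact abs_nonpos_iff.mp h2
  have z1 := hzero 1 (by norm_num)
  have z2 := hzero (-1) (by norm_num)
  simp only [P, riemann] at z1 z2
  refine ⟨hp.strictAntiOn_theta.injOn (h₁.one_lt t₁ ht₁ x₁) (h₂.one_lt t₁ ht₁ x₁) ?_, ?_⟩ <;> linarith

end

/-! ### Passing between the notions of solution; localisation and translation -/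

section

variable {κ γ γt ε : ℝ}

lemma eq_smul_fst_add_smul_snd (L : ℝ × ℝ →L[ℝ] ℝ) : L = L (1, 0) • π₁ + L (0, 1) • π₂ := by
  ext <;> simp

lemma hasFDerivWithinAt_of_contDiffOn {I : Set ℝ} (hI : UniqueDiffOn ℝ I) {f : ℝ → ℝ → ℝ}
    (hf : ContDiffOn ℝ 1 (fun q : ℝ × ℝ => f q.1 q.2) (I ×ˢ univ)) :
    (∀ t ∈ I, ∀ x, HasFDerivWithinAt (fun q : ℝ × ℝ => f q.1 q.2)
      (derivWithin (fun s => f s x) I t • π₁ + deriv (f t) x • π₂) (I ×ˢ univ) (t, x)) ∧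
    ContinuousOn (fun q : ℝ × ℝ => deriv (f q.1) q.2) (I ×ˢ univ) := by
  have key : ∀ t ∈ I, ∀ x, HasFDerivWithinAt (fun q : ℝ × ℝ => f q.1 q.2)
      (fderivWithin ℝ (fun q : ℝ × ℝ => f q.1 q.2) (I ×ˢ univ) (t, x)) (I ×ˢ univ) (t, x) :=
    fun t ht x => (hf.differentiableOn (by norm_num) (t, x) ⟨ht, mem_univ _⟩).hasFDerivWithinAt
  have hx : ∀ t ∈ I, ∀ x, deriv (f t) x =
      fderivWithin ℝ (fun q : ℝ × ℝ => f q.1 q.2) (I ×ˢ univ) (t, x) (0, 1) := by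
    intro t ht x
    have h := key t ht x
    rw [eq_smul_fst_add_smul_snd (fderivWithin ℝ _ _ _)] at h
    exact (hasDerivAt_slice ht h).deriv
  refine ⟨fun t ht x => ?_, ?_⟩
  · have h := key t ht x
    have e := eq_smul_fst_add_smul_snd
      (fderivWithin ℝ (fun q : ℝ × ℝ => f q.1 q.2) (I ×ˢ univ) (t, x))
    rw [e] at h
    have h2 := hasDerivWithinAt_along (X := fun _ => x) Subset.rfl h
      (hasDerivWithinAt_const t I x)
    rw [mul_zero, add_zero] at h2
    rw [hx t ht x, h2.derivWithin (hI t ht)]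
    exact h
  · have hc := hf.continuousOn_fderivWithin (hI.prod uniqueDiffOn_univ) le_rfl
    refine (hc.clm_apply (g := fun _ => ((0, 1) : ℝ × ℝ)) continuousOn_const).congr ?_
    rintro ⟨t, x⟩ hq
    exact hx t hq.1 x

lemma contDiffOn_of_hasFDerivWithinAt {I : Set ℝ} (hI : UniqueDiffOn ℝ I) {f a b : ℝ × ℝ → ℝ}
    (hf : ∀ q ∈ I ×ˢ (univ : Set ℝ), HasFDerivWithinAt f (a q • π₁ + b q • π₂) (I ×ˢ univ) q)
    (ha : ContinuousOn a (I ×ˢ univ)) (hb : ContinuousOn b (I ×ˢ univ)) :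
    ContDiffOn ℝ 1 f (I ×ˢ univ) := by
  have hU := hI.prod (uniqueDiffOn_univ (𝕜 := ℝ) (E := ℝ))
  rw [show (1 : WithTop ℕ∞) = 0 + 1 by norm_num, contDiffOn_succ_iff_fderivWithin hU]
  refine ⟨fun q hq => (hf q hq).differentiableWithinAt, by simp, ?_⟩
  rw [contDiffOn_zero]
  have : ContinuousOn (fun q => a q • π₁ + b q • π₂) (I ×ˢ univ) :=
    (ha.smul continuousOn_const).add (hb.smul continuousOn_const)
  exact this.congr fun q hq => (hf q hq).fderivWithin (hU q hq)

/-- A solution in the sense of the statement is a solution with explicit partial derivatives. -/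
lemma IsC1Solution.solves {v₀ u₀ : ℝ → ℝ} {I : Set ℝ} {v u : ℝ → ℝ → ℝ} (hI : UniqueDiffOn ℝ I)
    (h : IsC1Solution κ γ γt ε v₀ u₀ I v u) : Solves κ γ γt ε I v u := by
  obtain ⟨dv, cv⟩ := hasFDerivWithinAt_of_contDiffOn hI h.contDiffOn_v
  obtain ⟨du, cu⟩ := hasFDerivWithinAt_of_contDiffOn hI h.contDiffOn_u
  refine ⟨h.one_lt, fun t ht x => ?_, fun t ht x => ?_, cv, cu⟩
  · have := dv t ht x
    rwa [sub_eq_zero.mp (h.mass t ht x)] at this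
  · have h1 := du t ht x
    have h2 : HasDerivAt (fun y => pressure κ γ γt ε (v t y))
        (-speedSq κ γ γt ε (v t x) * deriv (v t) x) x :=
      (hasDerivAt_pressure κ γ γt ε (h.one_lt t ht x)).comp x (hasDerivAt_slice ht (dv t ht x))
    have h3 := h.momentum t ht x
    rw [h2.deriv] at h3
    have h4 : derivWithin (fun s => u s x) I t = speedSq κ γ γt ε (v t x) * deriv (v t) x := by
      linarith
    rwa [h4] at h1

lemma Solves.derivWithin_eq {I : Set ℝ} {v u : ℝ → ℝ → ℝ} (hI : UniqueDiffOn ℝ I)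
    (h : Solves κ γ γt ε I v u) {t : ℝ} (ht : t ∈ I) (x : ℝ) :
    derivWithin (fun s => v s x) I t = deriv (u t) x ∧
      derivWithin (fun s => u s x) I t = speedSq κ γ γt ε (v t x) * deriv (v t) x := by
  have h1 := hasDerivWithinAt_along (X := fun _ => x) Subset.rfl (h.fderiv_v t ht x)
    (hasDerivWithinAt_const t I x)
  have h2 := hasDerivWithinAt_along (X := fun _ => x) Subset.rfl (h.fderiv_u t ht x)
    (hasDerivWithinAt_const t I x)
  rw [mul_zero, add_zero] at h1 h2
  exact ⟨h1.derivWithin (hI t ht), h2.derivWithin (hI t ht)⟩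

lemma Solves.isC1Solution {v₀ u₀ : ℝ → ℝ} {I : Set ℝ} {v u : ℝ → ℝ → ℝ}
    (h : Solves κ γ γt ε I v u) (hp : Parameters κ γ γt ε) (hI : UniqueDiffOn ℝ I)
    (hI' : ∀ T ∈ I, Icc 0 T ⊆ I) (hv : ∀ x, v 0 x = v₀ x) (hu : ∀ x, u 0 x = u₀ x)
    {δ : ℝ} (hδ : 0 < δ) (low : ∀ t ∈ I, ∀ x, 1 + δ ≤ v t x)
    (hb : ∀ T ∈ I, ∃ B, ∀ t ∈ Icc 0 T, ∀ x, |v t x| ≤ B ∧ |u t x| ≤ B ∧ |deriv (v t) x| ≤ B ∧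
      |deriv (u t) x| ≤ B) : IsC1Solution κ γ γt ε v₀ u₀ I v u := by
  have hδ1 : (1 : ℝ) < 1 + δ := by linarith
  have csq : ContinuousOn (fun q : ℝ × ℝ => speedSq κ γ γt ε (v q.1 q.2)) (I ×ˢ univ) :=
    h.continuousOn_comp_v fun y hy =>
      (hasDerivAt_speedSq κ γ γt ε hy).continuousAt.continuousWithinAt
  refine ⟨?_, ?_, h.one_lt, fun t ht x => ?_, fun t ht x => ?_, hv, hu, fun T hT => ?_⟩
  · exact contDiffOn_of_hasFDerivWithinAt hI (fun q hq => h.fderiv_v q.1 hq.1 q.2)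
      h.continuousOn_du h.continuousOn_dv
  · exact contDiffOn_of_hasFDerivWithinAt hI (fun q hq => h.fderiv_u q.1 hq.1 q.2)
      (csq.mul h.continuousOn_dv) h.continuousOn_du
  · rw [(h.derivWithin_eq hI ht x).1, sub_self]
  · have h2 : HasDerivAt (fun y => pressure κ γ γt ε (v t y))
        (-speedSq κ γ γt ε (v t x) * deriv (v t) x) x :=
      (hasDerivAt_pressure κ γ γt ε (h.one_lt t ht x)).comp x
        (hasDerivAt_slice ht (h.fderiv_v t ht x))
    rw [(h.derivWithin_eq hI ht x).2, h2.deriv]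
    ring
  · obtain ⟨B, hB⟩ := hb T hT
    refine ⟨max B (soundSpeed κ γ γt ε (1 + δ) ^ 2 * B), fun t ht x => ?_⟩
    have ht' := hI' T hT ht
    obtain ⟨b1, b2, b3, b4⟩ := hB t ht x
    rw [(h.derivWithin_eq hI ht' x).1, (h.derivWithin_eq hI ht' x).2]
    refine ⟨le_max_of_le_left b1, le_max_of_le_left b2, le_max_of_le_left b3,
      le_max_of_le_left b4, le_max_of_le_left b4, le_max_of_le_right ?_⟩
    have hv1 := h.one_lt t ht' x
    rw [← hp.soundSpeed_mul_self hv1, ← sq, abs_mul, abs_of_nonneg (sq_nonneg _)]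
    have h1 := hp.antitoneOn_soundSpeed hδ1 hv1 (low t ht' x)
    have h2 := hp.soundSpeed_pos hv1
    gcongr

/-- Being a solution is a local property in time. -/
lemma Solves.of_locally {I : Set ℝ} {v u : ℝ → ℝ → ℝ}
    (h : ∀ t ∈ I, ∃ J : Set ℝ, t ∈ J ∧ J ∈ 𝓝[I] t ∧ ∃ v' u' : ℝ → ℝ → ℝ,
      Solves κ γ γt ε J v' u' ∧ ∀ r ∈ J, v r = v' r ∧ u r = u' r) :
    Solves κ γ γt ε I v u := by
  have nh : ∀ t x (J : Set ℝ), J ∈ 𝓝[I] t → J ×ˢ (univ : Set ℝ) ∈ 𝓝[I ×ˢ univ] (t, x) := by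
    intro t x J hJ
    rw [nhdsWithin_prod_eq]
    exact prod_mem_prod hJ univ_mem
  refine ⟨fun t ht x => ?_, fun t ht x => ?_, fun t ht x => ?_, ?_, ?_⟩
  · obtain ⟨J, htJ, -, v', u', hS, e⟩ := h t ht
    rw [(e t htJ).1]
    exact hS.one_lt t htJ x
  · obtain ⟨J, htJ, hJ, v', u', hS, e⟩ := h t ht
    rw [(e t htJ).1, (e t htJ).2]
    exact ((hS.fderiv_v t htJ x).congr (fun q hq => by rw [(e q.1 hq.1).1])
      (by rw [(e t htJ).1])).mono_of_mem_nhdsWithin (nh t x J hJ)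
  · obtain ⟨J, htJ, hJ, v', u', hS, e⟩ := h t ht
    rw [(e t htJ).1, (e t htJ).2]
    exact ((hS.fderiv_u t htJ x).congr (fun q hq => by rw [(e q.1 hq.1).2])
      (by rw [(e t htJ).2])).mono_of_mem_nhdsWithin (nh t x J hJ)
  · rintro ⟨t, x⟩ hq
    obtain ⟨J, htJ, hJ, v', u', hS, e⟩ := h t hq.1
    exact ((hS.continuousOn_dv (t, x) ⟨htJ, mem_univ _⟩).congr
      (fun q hq => by rw [(e q.1 hq.1).1]) (by rw [(e t htJ).1])).mono_of_mem_nhdsWithin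
      (nh t x J hJ)
  · rintro ⟨t, x⟩ hq
    obtain ⟨J, htJ, hJ, v', u', hS, e⟩ := h t hq.1
    exact ((hS.continuousOn_du (t, x) ⟨htJ, mem_univ _⟩).congr
      (fun q hq => by rw [(e q.1 hq.1).2]) (by rw [(e t htJ).2])).mono_of_mem_nhdsWithin
      (nh t x J hJ)

/-- Time translation. -/
lemma Solves.translate {I J : Set ℝ} {v u : ℝ → ℝ → ℝ} (h : Solves κ γ γt ε I v u) (a : ℝ)
    (hJ : ∀ t ∈ J, t + a ∈ I) :
    Solves κ γ γt ε J (fun t => v (t + a)) (fun t => u (t + a)) := by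
  have hm : MapsTo (fun q : ℝ × ℝ => (q.1 + a, q.2)) (J ×ˢ univ) (I ×ˢ univ) :=
    fun q hq => ⟨hJ _ hq.1, mem_univ _⟩
  have hd : ∀ q : ℝ × ℝ, HasFDerivWithinAt (fun q : ℝ × ℝ => (q.1 + a, q.2))
      (ContinuousLinearMap.id ℝ (ℝ × ℝ)) (J ×ˢ univ) q := by
    intro q
    have := ((hasFDerivAt_fst (𝕜 := ℝ) (p := q)).add_const a).prodMk
      (hasFDerivAt_snd (𝕜 := ℝ) (p := q))
    exact this.hasFDerivWithinAt
  have hc : Continuous fun q : ℝ × ℝ => (q.1 + a, q.2) := by fun_prop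
  refine ⟨fun t ht x => h.one_lt _ (hJ t ht) x, fun t ht x => ?_, fun t ht x => ?_, ?_, ?_⟩
  · have := HasFDerivWithinAt.comp (t, x) (h.fderiv_v _ (hJ t ht) x) (hd (t, x)) hm
    exact this
  · have := HasFDerivWithinAt.comp (t, x) (h.fderiv_u _ (hJ t ht) x) (hd (t, x)) hm
    exact this
  · exact h.continuousOn_dv.comp hc.continuousOn hm
  · exact h.continuousOn_du.comp hc.continuousOn hm

end

/-! ### Continuation and maximal solutions -/

section

variable {κ γ γt ε : ℝ}

/-- Time intervals `[0, T)`, `[0, T]`, `[0, ∞)`. -/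
structure IsInitialInterval (I : Set ℝ) : Prop where
  nonneg : ∀ t ∈ I, 0 ≤ t
  Icc_subset : ∀ t ∈ I, Icc 0 t ⊆ I

lemma isInitialInterval_Ico (T : ℝ) : IsInitialInterval (Ico 0 T) :=
  ⟨fun _ ht => ht.1, fun _ ht _ hr => ⟨hr.1, hr.2.trans_lt ht.2⟩⟩

lemma isInitialInterval_Ici : IsInitialInterval (Ici 0) :=
  ⟨fun _ ht => ht, fun _ _ _ hr => hr.1⟩

/-- A solution of the Cauchy problem which is bounded in `C¹` on compact time intervals. -/
structure BoundedSolution (κ γ γt ε : ℝ) (v₀ u₀ : ℝ → ℝ) (I : Set ℝ) (v u : ℝ → ℝ → ℝ) :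
    Prop where
  solves : Solves κ γ γt ε I v u
  initial_v : ∀ x, v 0 x = v₀ x
  initial_u : ∀ x, u 0 x = u₀ x
  bounded : ∀ T ∈ I, ∃ B, ∀ t ∈ Icc 0 T, ∀ x, |v t x| ≤ B ∧ |u t x| ≤ B ∧ |deriv (v t) x| ≤ B ∧
    |deriv (u t) x| ≤ B

/-- Data whose Riemann invariants are bounded by `R = θ(1 + δ)`, with bounded derivatives. -/
structure BoundedData (κ γ γt ε δ R V M : ℝ) (v₀ u₀ : ℝ → ℝ) : Prop where
  contDiff_v : ContDiff ℝ 1 v₀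
  contDiff_u : ContDiff ℝ 1 u₀
  δ_pos : 0 < δ
  theta_eq : theta κ γ γt ε (1 + δ) = R
  one_lt : ∀ x, 1 < v₀ x
  riemann_le : ∀ x, |u₀ x| + theta κ γ γt ε (v₀ x) ≤ R
  v_le : ∀ x, v₀ x ≤ V
  deriv_v_le : ∀ x, |deriv v₀ x| ≤ M
  deriv_u_le : ∀ x, |deriv u₀ x| ≤ M

variable {v₀ u₀ : ℝ → ℝ} {I : Set ℝ} {v u v' u' : ℝ → ℝ → ℝ} {δ R V M : ℝ}

lemma IsC1Solution.boundedSolution (hI : UniqueDiffOn ℝ I)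
    (h : IsC1Solution κ γ γt ε v₀ u₀ I v u) : BoundedSolution κ γ γt ε v₀ u₀ I v u := by
  refine ⟨h.solves hI, h.initial_v, h.initial_u, fun T hT => ?_⟩
  obtain ⟨B, hB⟩ := h.bounded T hT
  exact ⟨B, fun t ht x => ⟨(hB t ht x).1, (hB t ht x).2.1, (hB t ht x).2.2.1,
    (hB t ht x).2.2.2.1⟩⟩

lemma BoundedSolution.mono {J : Set ℝ} (h : BoundedSolution κ γ γt ε v₀ u₀ I v u) (hJ : J ⊆ I) :
    BoundedSolution κ γ γt ε v₀ u₀ J v u :=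
  ⟨h.solves.mono hJ, h.initial_v, h.initial_u, fun T hT => h.bounded T (hJ hT)⟩

lemma Parameters.one_add_le_of_theta_le (hp : Parameters κ γ γt ε) (hδ : 0 < δ)
    (hR : theta κ γ γt ε (1 + δ) = R) {a y : ℝ} (hy : 1 < y) (h : |a| + theta κ γ γt ε y ≤ R) :
    1 + δ ≤ y := by
  by_contra hcon
  push Not at hcon
  have h1 := hp.strictAntiOn_theta hy (lt_add_of_pos_right 1 hδ) hcon
  have h2 := abs_nonneg a
  linarith

namespace BoundedData

variable (hd : BoundedData κ γ γt ε δ R V M v₀ u₀) (hp : Parameters κ γ γt ε)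
include hd hp

lemma low (x : ℝ) : 1 + δ ≤ v₀ x :=
  hp.one_add_le_of_theta_le hd.δ_pos hd.theta_eq (hd.one_lt x) (hd.riemann_le x)

lemma R_pos : 0 < R := by
  rw [← hd.theta_eq]
  exact hp.theta_pos (by linarith [hd.δ_pos])

lemma abs_u_le (x : ℝ) : |u₀ x| ≤ R := by
  linarith [hd.riemann_le x, hp.theta_pos (hd.one_lt x)]

end BoundedData

namespace BoundedSolution

variable (h : BoundedSolution κ γ γt ε v₀ u₀ I v u) (hd : BoundedData κ γ γt ε δ R V M v₀ u₀)
  (hp : Parameters κ γ γt ε) (hI : IsInitialInterval I)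
include h hd hp hI

lemma low {t : ℝ} (ht : t ∈ I) (x : ℝ) : 1 + δ ≤ v t x := by
  obtain ⟨B, hB⟩ := h.bounded t ht
  refine (h.solves.mono (hI.Icc_subset t ht)).low_bound hp hd.δ_pos hd.theta_eq
    (fun t ht x => (hB t ht x).2.2.1) (fun t ht x => (hB t ht x).2.2.2) (fun x => ?_) t
    ⟨hI.nonneg t ht, le_rfl⟩ x
  rw [h.initial_v, h.initial_u]
  exact hd.riemann_le x

lemma riemann_le {t : ℝ} (ht : t ∈ I) (x : ℝ) : |u t x| + theta κ γ γt ε (v t x) ≤ R := by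
  obtain ⟨B, hB⟩ := h.bounded t ht
  refine (h.solves.mono (hI.Icc_subset t ht)).riemann_bound hp hd.δ_pos
    (fun r hr x => h.low hd hp hI (hI.Icc_subset t ht hr) x)
    (fun t ht x => (hB t ht x).2.2.1) (fun t ht x => (hB t ht x).2.2.2) (fun x => ?_)
    ⟨hI.nonneg t ht, le_rfl⟩ x
  rw [h.initial_v, h.initial_u]
  exact hd.riemann_le x

lemma isC1Solution (hU : UniqueDiffOn ℝ I) : IsC1Solution κ γ γt ε v₀ u₀ I v u :=
  h.solves.isC1Solution hp hU hI.Icc_subset h.initial_v h.initial_u hd.δ_pos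
    (fun _ ht x => h.low hd hp hI ht x) h.bounded

lemma agreeOn (h' : BoundedSolution κ γ γt ε v₀ u₀ I v' u') : AgreeOn I v u v' u' := by
  intro t ht x
  have hs := hI.Icc_subset t ht
  obtain ⟨B, hB⟩ := h.bounded t ht
  obtain ⟨B', hB'⟩ := h'.bounded t ht
  refine (h'.solves.mono hs).unique (h.solves.mono hs) hp (B := max B B') hd.δ_pos
    (fun r hr x => h'.low hd hp hI (hs hr) x) (fun r hr x => h.low hd hp hI (hs hr) x)
    (fun r hr x => ?_) (fun r hr x => ?_) (fun x => ?_) (fun x => ?_) t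
    ⟨hI.nonneg t ht, le_rfl⟩ x
  · obtain ⟨b1, b2, b3, b4⟩ := hB' r hr x
    exact ⟨le_max_of_le_right b1, le_max_of_le_right b2, le_max_of_le_right b3,
      le_max_of_le_right b4⟩
  · obtain ⟨b1, b2, b3, b4⟩ := hB r hr x
    exact ⟨le_max_of_le_left b1, le_max_of_le_left b2, le_max_of_le_left b3,
      le_max_of_le_left b4⟩
  · rw [h.initial_v, h'.initial_v]
  · rw [h.initial_u, h'.initial_u]

end BoundedSolution

/-- Local existence. -/
lemma BoundedData.exists_boundedSolution (hd : BoundedData κ γ γt ε δ R V M v₀ u₀)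
    (hp : Parameters κ γ γt ε) :
    ∃ T > 0, ∃ v u, BoundedSolution κ γ γt ε v₀ u₀ (Ico 0 T) v u := by
  have hR := hd.R_pos hp
  obtain ⟨τ, hτ, H⟩ := hp.exists_local (V := max V (1 + δ)) (M := max M R) hd.δ_pos
    (le_max_right _ _) (hR.le.trans (le_max_right _ _))
  obtain ⟨v, u, hs, hv, hu, B, hB⟩ := H v₀ u₀ hd.contDiff_v hd.contDiff_u (hd.low hp)
    (fun x => le_max_of_le_left (hd.v_le x)) (fun x => le_max_of_le_right (hd.abs_u_le hp x))
    (fun x => le_max_of_le_left (hd.deriv_v_le x)) (fun x => le_max_of_le_left (hd.deriv_u_le x))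
  have hsub : Ico 0 τ ⊆ Ioo (-τ) τ := fun t ht => ⟨by linarith [ht.1], ht.2⟩
  exact ⟨τ, hτ, v, u, hs.mono hsub, hv, hu, fun T hT => ⟨B, fun t ht x =>
    hB t (hsub ⟨ht.1, ht.2.trans_lt hT.2⟩) x⟩⟩

lemma Solves.contDiff_slice (h : Solves κ γ γt ε I v u) {t : ℝ} (ht : t ∈ I) :
    ContDiff ℝ 1 (v t) ∧ ContDiff ℝ 1 (u t) := by
  have hc : ∀ f : ℝ × ℝ → ℝ, ContinuousOn f (I ×ˢ univ) → Continuous fun x => f (t, x) := by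
    intro f hf
    exact hf.comp_continuous (f := fun x => (t, x)) (by fun_prop) fun x => ⟨ht, mem_univ _⟩
  refine ⟨contDiff_one_iff_deriv.mpr ⟨fun x => ?_, hc _ h.continuousOn_dv⟩,
    contDiff_one_iff_deriv.mpr ⟨fun x => ?_, hc _ h.continuousOn_du⟩⟩
  · exact (hasDerivAt_slice ht (h.fderiv_v t ht x)).differentiableAt
  · exact (hasDerivAt_slice ht (h.fderiv_u t ht x)).differentiableAt

/-- A solution whose gradient does not blow up at `T` extends beyond `T`. -/
lemma BoundedSolution.exists_extension {T : ℝ} (hT : 0 < T)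
    (h : BoundedSolution κ γ γt ε v₀ u₀ (Ico 0 T) v u)
    (hd : BoundedData κ γ γt ε δ R V M v₀ u₀) (hp : Parameters κ γ γt ε) {V' M' : ℝ}
    (hf : ∃ᶠ t in 𝓝[<] T, ∀ x, v t x ≤ V' ∧ |deriv (v t) x| ≤ M' ∧ |deriv (u t) x| ≤ M') :
    ∃ T' > T, ∃ v' u', BoundedSolution κ γ γt ε v₀ u₀ (Ico 0 T') v' u' := by
  have hR := hd.R_pos hp
  have hIT := isInitialInterval_Ico T
  obtain ⟨τ, hτ, H⟩ := hp.exists_local (V := max V' (1 + δ)) (M := max M' R) hd.δ_pos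
    (le_max_right _ _) (hR.le.trans (le_max_right _ _))
  -- The life-span τ is the same for all data with these bounds, so restarting at a time within τ /
  -- 2 of T carries the solution past T. Frequently good times suffice for choosing t₀.
  have ev : ∀ᶠ t in 𝓝[<] T, t ∈ Ioo (max 0 (T - τ / 2)) T :=
    Ioo_mem_nhdsLT (max_lt hT (by linarith))
  obtain ⟨t₀, hb, ht₀⟩ := (hf.and_eventually ev).exists
  have ht₀0 : 0 < t₀ := (le_max_left _ _).trans_lt ht₀.1
  have ht₀τ : T - τ / 2 < t₀ := (le_max_right _ _).trans_lt ht₀.1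
  have ht₀T : t₀ ∈ Ico 0 T := ⟨ht₀0.le, ht₀.2⟩
  obtain ⟨cv, cu⟩ := h.solves.contDiff_slice ht₀T
  have hRt := h.riemann_le hd hp hIT ht₀T
  have hlt := h.low hd hp hIT ht₀T
  obtain ⟨vl, ul, hs, hv, hu, B, hB⟩ := H (v t₀) (u t₀) cv cu hlt
    (fun x => le_max_of_le_left (hb x).1)
    (fun x => le_max_of_le_right (by linarith [hRt x, hp.theta_pos (h.solves.one_lt t₀ ht₀T x)]))
    (fun x => le_max_of_le_left (hb x).2.1) (fun x => le_max_of_le_left (hb x).2.2)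
  -- On the overlap the restarted solution and the translate of the given one coincide by
  -- uniqueness.
  have hagree : ∀ r ∈ Ico t₀ T, ∀ x, vl (r - t₀) x = v r x ∧ ul (r - t₀) x = u r x := by
    intro r hr x
    have hsub : Icc 0 (r - t₀) ⊆ Ioo (-τ) τ := fun q hq =>
      ⟨by linarith [hq.1], by linarith [hq.2, hr.2]⟩
    have hmem : ∀ q ∈ Icc 0 (r - t₀), q + t₀ ∈ Icc 0 r := fun q hq =>
      ⟨by linarith [hq.1], by linarith [hq.2]⟩
    have hrT : r ∈ Ico 0 T := ⟨ht₀0.le.trans hr.1, hr.2⟩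
    have hmem' : ∀ q ∈ Icc 0 (r - t₀), q + t₀ ∈ Ico 0 T := fun q hq =>
      hIT.Icc_subset r hrT (hmem q hq)
    obtain ⟨B', hB'⟩ := h.bounded r hrT
    have hs' := hs.mono hsub
    have key := hs'.unique (h.solves.translate t₀ hmem') hp (B := max B B') hd.δ_pos
      (hs'.low_bound hp hd.δ_pos hd.theta_eq (fun q hq x => (hB q (hsub hq) x).2.2.1)
        (fun q hq x => (hB q (hsub hq) x).2.2.2) (fun x => by rw [hv, hu]; exact hRt x))
      (fun q hq x => h.low hd hp hIT (hmem' q hq) x)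
      (fun q hq x => by
        obtain ⟨b1, b2, b3, b4⟩ := hB q (hsub hq) x
        exact ⟨le_max_of_le_left b1, le_max_of_le_left b2, le_max_of_le_left b3,
          le_max_of_le_left b4⟩)
      (fun q hq x => by
        obtain ⟨b1, b2, b3, b4⟩ := hB' _ (hmem q hq) x
        exact ⟨le_max_of_le_right b1, le_max_of_le_right b2, le_max_of_le_right b3,
          le_max_of_le_right b4⟩)
      (fun x => by rw [hv, zero_add]) (fun x => by rw [hu, zero_add])
      (r - t₀) ⟨sub_nonneg.mpr hr.1, le_rfl⟩ x
    simpa only [sub_add_cancel] using key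
  have e1 : ∀ r ∈ Ico 0 T, (fun x => if r ≤ t₀ then v r x else vl (r - t₀) x) = v r ∧
      (fun x => if r ≤ t₀ then u r x else ul (r - t₀) x) = u r := by
    intro r hr
    by_cases hrt : r ≤ t₀
    · simp only [hrt, if_true, and_self]
    · simp only [hrt, if_false]
      push Not at hrt
      exact ⟨funext fun x => (hagree r ⟨hrt.le, hr.2⟩ x).1,
        funext fun x => (hagree r ⟨hrt.le, hr.2⟩ x).2⟩
  refine ⟨t₀ + τ, by linarith, fun r x => if r ≤ t₀ then v r x else vl (r - t₀) x,
    fun r x => if r ≤ t₀ then u r x else ul (r - t₀) x, ?_, fun x => ?_, fun x => ?_, ?_⟩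
  · refine Solves.of_locally fun t ht => ?_
    by_cases htT : t < T
    · refine ⟨Ico 0 T, ⟨ht.1, htT⟩, ?_, v, u, h.solves, e1⟩
      filter_upwards [self_mem_nhdsWithin, mem_nhdsWithin_of_mem_nhds (Iio_mem_nhds htT)] with r h1 h2
      exact ⟨h1.1, h2⟩
    · have htt : t₀ < t := ht₀.2.trans_le (not_lt.mp htT)
      refine ⟨Ioo t₀ (t₀ + τ), ⟨htt, ht.2⟩, mem_nhdsWithin_of_mem_nhds (Ioo_mem_nhds htt ht.2), _, _,
        hs.translate (-t₀) (J := Ioo t₀ (t₀ + τ)) fun r hr => ⟨by linarith [hr.1], by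
          linarith [hr.2]⟩, fun r hr => ?_⟩
      simp only [not_le.mpr hr.1, if_false, sub_eq_add_neg, and_self]
  · simp only [ht₀0.le, if_true, h.initial_v]
  · simp only [ht₀0.le, if_true, h.initial_u]
  · intro T' hT'
    obtain ⟨B', hB'⟩ := h.bounded t₀ ht₀T
    refine ⟨max B B', fun t ht x => ?_⟩
    by_cases htt : t ≤ t₀
    · simp only [htt, if_true]
      obtain ⟨b1, b2, b3, b4⟩ := hB' t ⟨ht.1, htt⟩ x
      exact ⟨le_max_of_le_right b1, le_max_of_le_right b2, le_max_of_le_right b3,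
        le_max_of_le_right b4⟩
    · simp only [htt, if_false]
      push Not at htt
      obtain ⟨b1, b2, b3, b4⟩ := hB (t - t₀) ⟨by linarith, by linarith [ht.2, hT'.2]⟩ x
      exact ⟨le_max_of_le_left b1, le_max_of_le_left b2, le_max_of_le_left b3,
        le_max_of_le_left b4⟩

/-- Solutions on the members of an exhausting family of intervals glue to a solution. -/
lemma BoundedData.exists_glue (hd : BoundedData κ γ γt ε δ R V M v₀ u₀)
    (hp : Parameters κ γ γt ε) (hI : IsInitialInterval I) (h0 : (0 : ℝ) ∈ I)
    (hc : ∀ t ∈ I, ∃ T > t, ∃ v u, BoundedSolution κ γ γt ε v₀ u₀ (Ico 0 T) v u) :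
    ∃ v u, BoundedSolution κ γ γt ε v₀ u₀ I v u := by
  choose! T hT vv uu hs using hc
  have key : ∀ t ∈ I, ∀ r ∈ Ico 0 (T t), r ∈ I → vv r r = vv t r ∧ uu r r = uu t r := by
    intro t ht r hr hrI
    have h1 := (hs r hrI).mono (Ico_subset_Ico_right (min_le_right (T t) (T r)))
    have h2 := (hs t ht).mono (Ico_subset_Ico_right (min_le_left (T t) (T r)))
    have h3 := h2.agreeOn hd hp (isInitialInterval_Ico _) h1 r ⟨hr.1, lt_min hr.2 (hT r hrI)⟩
    exact ⟨funext fun x => (h3 x).1, funext fun x => (h3 x).2⟩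
  -- The value at time t comes from the solution selected for t; by uniqueness it agrees near t with
  -- any one of the selected solutions.
  refine ⟨fun t => vv t t, fun t => uu t t, ?_, (hs 0 h0).initial_v, (hs 0 h0).initial_u, ?_⟩
  · refine Solves.of_locally fun t ht => ⟨Ico 0 (T t) ∩ I, ⟨⟨hI.nonneg t ht, hT t ht⟩, ht⟩, ?_,
      vv t, uu t, (hs t ht).solves.mono inter_subset_left, fun r hr => key t ht r hr.1 hr.2⟩
    filter_upwards [self_mem_nhdsWithin, mem_nhdsWithin_of_mem_nhds (Iio_mem_nhds (hT t ht))]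
      with r h1 h2
    exact ⟨⟨hI.nonneg r h1, h2⟩, h1⟩
  · intro T' hT'
    obtain ⟨B, hB⟩ := (hs T' hT').bounded T' ⟨hI.nonneg _ hT', hT T' hT'⟩
    refine ⟨B, fun t ht x => ?_⟩
    obtain ⟨e1, e2⟩ := key T' hT' t ⟨ht.1, ht.2.trans_lt (hT T' hT')⟩ (hI.Icc_subset T' hT' ht)
    rw [e1, e2]
    exact hB t ht x

/-- There is a global solution or a maximal solution with finite life-span. -/
theorem BoundedData.exists_maximal (hd : BoundedData κ γ γt ε δ R V M v₀ u₀)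
    (hp : Parameters κ γ γt ε) :
    (∃ v u, BoundedSolution κ γ γt ε v₀ u₀ (Ici 0) v u) ∨
    ∃ Tm > 0, ∃ v u, BoundedSolution κ γ γt ε v₀ u₀ (Ico 0 Tm) v u ∧
      ∀ T v' u', BoundedSolution κ γ γt ε v₀ u₀ (Ico 0 T) v' u' → T ≤ Tm := by
  let E : Set ℝ := {T | ∃ v u, BoundedSolution κ γ γt ε v₀ u₀ (Ico 0 T) v u}
  obtain ⟨T₁, hT₁, hE₁⟩ := hd.exists_boundedSolution hp
  have hT₁E : T₁ ∈ E := hE₁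
  by_cases hE : BddAbove E
  · right
    have hpos : 0 < sSup E := hT₁.trans_le (le_csSup hE hT₁E)
    -- Gluing yields a solution on the half-open interval up to the supremum, so the supremum is
    -- attained.
    obtain ⟨v, u, h⟩ := hd.exists_glue hp (isInitialInterval_Ico (sSup E)) ⟨le_rfl, hpos⟩
      fun t ht => by
        obtain ⟨T, hT, htT⟩ := exists_lt_of_lt_csSup ⟨T₁, hT₁E⟩ ht.2
        exact ⟨T, htT, hT⟩
    exact ⟨sSup E, hpos, v, u, h, fun T v' u' h' => le_csSup hE ⟨v', u', h'⟩⟩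
  · left
    refine hd.exists_glue hp isInitialInterval_Ici self_mem_Ici fun t _ => ?_
    obtain ⟨T, hT, htT⟩ := not_bddAbove_iff.mp hE t
    exact ⟨T, htT, hT⟩

end

/-! ### Riccati equations, growth of v and breakdown -/

section

variable {κ γ γt ε : ℝ}

lemma sub_le_sub_of_deriv_le {T : ℝ} {f g f' g' : ℝ → ℝ}
    (hf : ∀ t ∈ Icc 0 T, HasDerivWithinAt f (f' t) (Icc 0 T) t)
    (hg : ∀ t ∈ Icc 0 T, HasDerivWithinAt g (g' t) (Icc 0 T) t)
    (h : ∀ t ∈ Icc 0 T, f' t ≤ g' t) {t : ℝ} (ht : t ∈ Icc 0 T) : f t - f 0 ≤ g t - g 0 := by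
  have hd : ∀ t ∈ Icc 0 T, HasDerivWithinAt (fun t => f t - g t) (f' t - g' t) (Icc 0 T) t :=
    fun t ht => (hf t ht).sub (hg t ht)
  have := antitoneOn_of_hasDerivWithinAt_nonpos (f := fun t => f t - g t)
    (f' := fun t => f' t - g' t) (convex_Icc 0 T)
    (fun t ht => (hd t ht).continuousWithinAt)
    (fun t ht => (hd t (interior_subset ht)).mono interior_subset)
    (fun t ht => by linarith [h t (interior_subset ht)]) ⟨le_rfl, ht.1.trans ht.2⟩ ht ht.1
  simp only at this
  linarith

/-- A function with `y' = -a y²`, where `a ≥ 0` is continuous. -/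
structure RiccatiOn (T : ℝ) (a y : ℝ → ℝ) : Prop where
  nonneg : ∀ t ∈ Icc 0 T, 0 ≤ a t
  continuousOn : ContinuousOn a (Icc 0 T)
  deriv : ∀ t ∈ Icc 0 T, HasDerivWithinAt y (-a t * y t ^ 2) (Icc 0 T) t

namespace RiccatiOn

variable {T : ℝ} {a y : ℝ → ℝ} (h : RiccatiOn T a y)
include h

lemma le_initial {t : ℝ} (ht : t ∈ Icc 0 T) : y t ≤ y 0 := by
  have := sub_le_sub_of_deriv_le h.deriv (g := fun _ => (0 : ℝ)) (g' := fun _ => 0)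
    (fun t _ => hasDerivWithinAt_const t _ _)
    (fun t ht => by nlinarith [h.nonneg t ht, sq_nonneg (y t)]) ht
  linarith

/-- Read as a linear equation y' = (-a y) y with continuous coefficient -a y, the Riccati equation
preserves the sign of y. -/
lemma exists_pos_mul {t : ℝ} (ht : t ∈ Icc 0 T) : ∃ r > 0, y t = r * y 0 :=
  exists_exp_of_linear (m := fun t => -a t * y t)
    (h.continuousOn.neg.mul fun t ht => (h.deriv t ht).continuousWithinAt)
    (fun t ht => (h.deriv t ht).congr_deriv (by ring)) ht

lemma neg {t : ℝ} (ht : t ∈ Icc 0 T) (h0 : y 0 < 0) : y t < 0 := by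
  obtain ⟨r, hr, e⟩ := h.exists_pos_mul ht
  rw [e]
  exact mul_neg_of_pos_of_neg hr h0

lemma nonneg_of_nonneg {t : ℝ} (ht : t ∈ Icc 0 T) (h0 : 0 ≤ y 0) : 0 ≤ y t := by
  obtain ⟨r, hr, e⟩ := h.exists_pos_mul ht
  rw [e]
  exact mul_nonneg hr.le h0

/-- The reciprocal linearises the equation to (1/y)' = a. A negative y blows up when 1/y reaches 0,
so bounds on the integral of a translate into bounds on the life-span. -/
lemma hasDerivWithinAt_inv (h0 : y 0 < 0) {t : ℝ} (ht : t ∈ Icc 0 T) :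
    HasDerivWithinAt (fun t => (y t)⁻¹) (a t) (Icc 0 T) t := by
  have hn := (h.neg ht h0).ne
  refine ((h.deriv t ht).inv hn).congr_deriv ?_
  field_simp

/-- Blow-up in finite time of negative solutions. -/
lemma sub_le_of_le {b b' : ℝ → ℝ}
    (hb : ∀ t ∈ Icc 0 T, HasDerivWithinAt b (b' t) (Icc 0 T) t)
    (hab : ∀ t ∈ Icc 0 T, b' t ≤ a t) (h0 : y 0 < 0) {t : ℝ} (ht : t ∈ Icc 0 T) :
    b t - b 0 ≤ -(y 0)⁻¹ := by
  have h1 := sub_le_sub_of_deriv_le hb (fun t ht => h.hasDerivWithinAt_inv h0 ht) hab ht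
  have h2 := inv_lt_zero.mpr (h.neg ht h0)
  linarith

/-- Negative solutions exist for some time. -/
lemma ge_of_le {A N : ℝ} (ha : ∀ t ∈ Icc 0 T, a t ≤ A) (hA : 0 ≤ A) (hN : 0 < N) (h0 : -N ≤ y 0)
    {t : ℝ} (ht : t ∈ Icc 0 T) (hNt : N * A * T < 1) : -(N / (1 - N * A * T)) ≤ y t := by
  have hpos : 0 < 1 - N * A * T := by linarith
  rcases le_or_gt 0 (y 0) with h1 | h1
  · exact (neg_nonpos.mpr (by positivity)).trans (h.nonneg_of_nonneg ht h1)
  -- -1/y starts at 1/N or more and decreases at rate at most A, so it remains at least 1/N - A T >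
  -- 0.
  have h2 := sub_le_sub_of_deriv_le (fun t ht => h.hasDerivWithinAt_inv h1 ht)
    (g := fun t => A * t) (g' := fun _ => A)
    (fun t _ => by simpa using ((hasDerivAt_id t).const_mul A).hasDerivWithinAt) ha ht
  have h3 := h.neg ht h1
  have h4 : N⁻¹ ≤ -(y 0)⁻¹ := by
    rw [← inv_neg]
    exact inv_anti₀ (by linarith) (by linarith)
  have h5 : A * t ≤ A * T := mul_le_mul_of_nonneg_left ht.2 hA
  have h6 : N⁻¹ - A * T ≤ (-y t)⁻¹ := by
    rw [inv_neg]
    simp only [mul_zero, sub_zero] at h2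
    linarith
  have h7 : N⁻¹ - A * T = (N / (1 - N * A * T))⁻¹ := by field_simp
  rw [h7] at h6
  have h8 := (inv_le_inv₀ (by positivity) (by linarith)).mp h6
  linarith

end RiccatiOn

/-- The weighted gradients of the initial datum. -/
noncomputable def initialGrad (κ γ γt ε s : ℝ) (v₀ u₀ : ℝ → ℝ) (x : ℝ) : ℝ :=
  weightedGrad κ γ γt ε s (fun _ => v₀) (fun _ => u₀) (0, x)

variable {v₀ u₀ : ℝ → ℝ} {I : Set ℝ} {v u : ℝ → ℝ → ℝ} {δ R V M : ℝ}

lemma Parameters.continuousOn_riccatiCoeff (hp : Parameters κ γ γt ε) :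
    ContinuousOn (riccatiCoeff κ γ γt ε) (Ioi 1) := by
  refine hp.continuousOn_speedDeriv.neg.div
    ((continuousOn_const.mul hp.continuousOn_soundSpeed).mul hp.continuousOn_soundSpeed.sqrt)
    fun v hv => ?_
  have h1 := hp.soundSpeed_pos hv
  have h2 := Real.sqrt_pos.mpr h1
  positivity

lemma weightedGrad_add (v u : ℝ → ℝ → ℝ) (q : ℝ × ℝ) :
    weightedGrad κ γ γt ε 1 v u q + weightedGrad κ γ γt ε (-1) v u q =
      2 * √(soundSpeed κ γ γt ε (v q.1 q.2)) * deriv (u q.1) q.2 := by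
  simp only [weightedGrad, riemannGrad]; ring

lemma weightedGrad_sub (v u : ℝ → ℝ → ℝ) (q : ℝ × ℝ) :
    weightedGrad κ γ γt ε (-1) v u q - weightedGrad κ γ γt ε 1 v u q =
      2 * √(soundSpeed κ γ γt ε (v q.1 q.2)) * soundSpeed κ γ γt ε (v q.1 q.2) *
        deriv (v q.1) q.2 := by
  simp only [weightedGrad, riemannGrad]; ring

namespace BoundedSolution

variable (h : BoundedSolution κ γ γt ε v₀ u₀ I v u) (hd : BoundedData κ γ γt ε δ R V M v₀ u₀)
  (hp : Parameters κ γ γt ε) (hI : IsInitialInterval I)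
include h hd hp hI

lemma exists_riccatiOn {s : ℝ} (hs : s * s = 1) {T t₀ : ℝ} (hT : T ∈ I) (ht₀ : t₀ ∈ Icc 0 T)
    (x₀ : ℝ) : ∃ X : ℝ → ℝ, X t₀ = x₀ ∧
      RiccatiOn T (fun t => riccatiCoeff κ γ γt ε (v t (X t)))
        (fun t => weightedGrad κ γ γt ε s v u (t, X t)) ∧
      weightedGrad κ γ γt ε s v u (0, X 0) = initialGrad κ γ γt ε s v₀ u₀ (X 0) := by
  obtain ⟨B, hB⟩ := h.bounded T hT
  have hsub := hI.Icc_subset T hT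
  have hS := h.solves.mono hsub
  obtain ⟨X, hX0, hX, -, hr⟩ := hS.exists_characteristic hp hd.δ_pos
    (fun r hr x => h.low hd hp hI (hsub hr) x)
    (fun t ht x => (hB t ht x).2.2.1) (fun t ht x => (hB t ht x).2.2.2) hs ht₀ x₀
  refine ⟨X, hX0, ⟨fun t ht => (hp.riccatiCoeff_pos (hS.one_lt t ht _)).le, ?_, hr⟩, ?_⟩
  · exact (hS.continuousOn_comp_v hp.continuousOn_riccatiCoeff).comp
      (f := fun t => (t, X t)) (continuousOn_id.prodMk fun t ht => (hX t ht).continuousWithinAt)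
      fun t ht => ⟨ht, mem_univ _⟩
  · simp only [initialGrad, weightedGrad, riemannGrad, funext h.initial_v, funext h.initial_u]

lemma weightedGrad_le {s : ℝ} (hs : s * s = 1) {Y : ℝ}
    (hY : ∀ x, initialGrad κ γ γt ε s v₀ u₀ x ≤ Y) {t : ℝ} (ht : t ∈ I) (x : ℝ) :
    weightedGrad κ γ γt ε s v u (t, x) ≤ Y := by
  have htt : t ∈ Icc 0 t := ⟨hI.nonneg t ht, le_rfl⟩
  obtain ⟨X, hX, hr, h0⟩ := h.exists_riccatiOn hd hp hI hs ht htt x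
  have := hr.le_initial htt
  rw [hX, h0] at this
  exact this.trans (hY _)

lemma weightedGrad_nonneg {s : ℝ} (hs : s * s = 1)
    (hY : ∀ x, 0 ≤ initialGrad κ γ γt ε s v₀ u₀ x) {t : ℝ} (ht : t ∈ I) (x : ℝ) :
    0 ≤ weightedGrad κ γ γt ε s v u (t, x) := by
  have htt : t ∈ Icc 0 t := ⟨hI.nonneg t ht, le_rfl⟩
  obtain ⟨X, hX, hr, h0⟩ := h.exists_riccatiOn hd hp hI hs ht htt x
  have := hr.nonneg_of_nonneg htt (by rw [h0]; exact hY _)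
  rwa [hX] at this

lemma weightedGrad_ge {s : ℝ} (hs : s * s = 1) {N A T : ℝ} (hN : 0 < N) (hA : 0 ≤ A)
    (hY : ∀ x, -N ≤ initialGrad κ γ γt ε s v₀ u₀ x)
    (ha : ∀ t ∈ I, ∀ x, riccatiCoeff κ γ γt ε (v t x) ≤ A) (hIT : ∀ t ∈ I, t ≤ T)
    (hT : N * A * T < 1) {t : ℝ} (ht : t ∈ I) (x : ℝ) :
    -(N / (1 - N * A * T)) ≤ weightedGrad κ γ γt ε s v u (t, x) := by
  have htt : t ∈ Icc 0 t := ⟨hI.nonneg t ht, le_rfl⟩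
  obtain ⟨X, hX, hr, h0⟩ := h.exists_riccatiOn hd hp hI hs ht htt x
  have hNt : N * A * t ≤ N * A * T := mul_le_mul_of_nonneg_left (hIT t ht) (by positivity)
  have := hr.ge_of_le (fun r hr => ha r (hI.Icc_subset t ht hr) _) hA hN (by rw [h0]; exact hY _)
    htt (hNt.trans_lt hT)
  rw [hX] at this
  refine le_trans (neg_le_neg ?_) this
  exact div_le_div_of_nonneg_left hN.le (by linarith) (by linarith)

omit h hd hp hI in
lemma deriv_u_le {D : ℝ} (h1 : ∀ t ∈ I, ∀ x, weightedGrad κ γ γt ε 1 v u (t, x) +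
      weightedGrad κ γ γt ε (-1) v u (t, x) ≤ 2 * D) {t : ℝ} (ht : t ∈ I) (x : ℝ) :
    √(soundSpeed κ γ γt ε (v t x)) * deriv (u t) x ≤ D := by
  have := h1 t ht x
  rw [weightedGrad_add] at this
  simp only at this
  linarith

omit hd hp in
lemma hasDerivWithinAt_v {T : ℝ} (hT : T ∈ I) (x : ℝ) {φ φ' : ℝ → ℝ}
    (hφ : ∀ y, 1 < y → HasDerivAt φ (φ' y) y) {t : ℝ} (ht : t ∈ Icc 0 T) :
    HasDerivWithinAt (fun t => φ (v t x)) (φ' (v t x) * deriv (u t) x) (Icc 0 T) t := by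
  have hsub := hI.Icc_subset T hT
  have := hasDerivWithinAt_along (X := fun _ => x) hsub (h.solves.fderiv_comp_v hφ (hsub ht) x)
    (hasDerivWithinAt_const t (Icc 0 T) x)
  simpa using this

/-- Growth of the specific volume. -/
lemma rpow_v_le {D : ℝ} (hD : 0 ≤ D)
    (h1 : ∀ t ∈ I, ∀ x, weightedGrad κ γ γt ε 1 v u (t, x) +
      weightedGrad κ γ γt ε (-1) v u (t, x) ≤ 2 * D) {t : ℝ} (ht : t ∈ I) (x : ℝ) :
    v t x ^ ((3 - γt) / 4) ≤ V ^ ((3 - γt) / 4) +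
      (3 - γt) / 4 * (D / √√(κ * γt)) * t := by
  have hκ := hp.κ_pos; have hγt := hp.γt_pos; have hγt3 := hp.γt_lt
  -- The regular part of the pressure gives √c ≥ (κ γt)^(1/4) v^(μ - 1), so √c ∂ₜv ≤ D bounds the
  -- derivative of v^μ. Positivity of μ is the condition γt < 3.
  set μ := (3 - γt) / 4 with hμ
  have hμ0 : 0 < μ := by rw [hμ]; linarith
  have hk : 0 < √√(κ * γt) := Real.sqrt_pos.mpr (Real.sqrt_pos.mpr (by positivity))
  have htt : t ∈ Icc 0 t := ⟨hI.nonneg t ht, le_rfl⟩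
  have hsub := hI.Icc_subset t ht
  have := sub_le_sub_of_deriv_le (fun r hr => h.hasDerivWithinAt_v hI ht x
      (φ := fun y => y ^ μ) (φ' := fun y => μ * y ^ (μ - 1))
      (fun y hy => Real.hasDerivAt_rpow_const (Or.inl (by linarith))) hr)
    (g := fun r => μ * (D / √√(κ * γt)) * r) (g' := fun _ => μ * (D / √√(κ * γt)))
    (fun r _ => by simpa using ((hasDerivAt_id r).const_mul _).hasDerivWithinAt)
    (fun r hr => ?_) htt
  · simp only [mul_zero, sub_zero, h.initial_v] at this
    have h3 : v₀ x ^ μ ≤ V ^ μ :=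
      Real.rpow_le_rpow (by linarith [hd.one_lt x]) (hd.v_le x) hμ0.le
    linarith
  · have hv1 := h.solves.one_lt r (hsub hr) x
    have hv0 : 0 < v r x := by linarith
    have h2 := deriv_u_le h1 (hsub hr) x
    have h3 := hp.soundSpeed_ge_regular hv1
    have h4 : √√(κ * γt) * v r x ^ (μ - 1) ≤ √(soundSpeed κ γ γt ε (v r x)) := by
      have := Real.sqrt_le_sqrt h3
      rw [Parameters.sqrt_mul_rpow (Real.sqrt_nonneg _) hv0] at this
      refine le_trans (le_of_eq ?_) this
      congr 2
      rw [hμ]; ring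
    have h5 : 0 < v r x ^ (μ - 1) := Real.rpow_pos_of_pos hv0 _
    have h6 : v r x ^ (μ - 1) * deriv (u r) x ≤ D / √√(κ * γt) := by
      rw [le_div_iff₀ hk]
      rcases le_or_gt (deriv (u r) x) 0 with h7 | h7
      · exact (mul_nonpos_of_nonpos_of_nonneg
          (mul_nonpos_of_nonneg_of_nonpos h5.le h7) hk.le).trans hD
      · calc _ = (√√(κ * γt) * v r x ^ (μ - 1)) * deriv (u r) x := by ring
          _ ≤ √(soundSpeed κ γ γt ε (v r x)) * deriv (u r) x := by gcongr
          _ ≤ D := h2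
    calc _ = μ * (v r x ^ (μ - 1) * deriv (u r) x) := by ring
      _ ≤ _ := mul_le_mul_of_nonneg_left h6 hμ0.le

/-- If the sum of the gradients is bounded above, a compressive datum does not have a global
solution. -/
theorem false_of_global {D : ℝ} (hD : 0 < D) (hg : I = Ici 0)
    (h1 : ∀ t ∈ I, ∀ x, weightedGrad κ γ γt ε 1 v u (t, x) +
      weightedGrad κ γ γt ε (-1) v u (t, x) ≤ 2 * D)
    {s : ℝ} (hs : s * s = 1) {x₀ : ℝ} (hx₀ : initialGrad κ γ γt ε s v₀ u₀ x₀ < 0) : False := by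
  set c := soundSpeed κ γ γt ε with hc
  have hδ1 : (1 : ℝ) < 1 + δ := by linarith [hd.δ_pos]
  have hcont : ContinuousOn (fun y => √(c y)) (Ioi 1) := hp.continuousOn_soundSpeed.sqrt
  -- The primitive of √c satisfies ∂ₜ F(v) = √c ∂ₓu ≤ D, so F(v) grows at most linearly in time.
  let F : ℝ → ℝ := fun y => ∫ z in (1 + δ)..y, √(c z)
  have hF : ∀ y, 1 < y → HasDerivAt F (√(c y)) y := by
    intro y hy
    refine intervalIntegral.integral_hasDerivAt_right ?_
      (hcont.stronglyMeasurableAtFilter isOpen_Ioi y hy)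
      (hcont.continuousAt (Ioi_mem_nhds hy))
    exact (hcont.mono fun z hz => lt_of_lt_of_le (lt_min hδ1 hy) hz.1).intervalIntegrable
  have hFmono : MonotoneOn F (Ioi 1) := by
    refine monotoneOn_of_hasDerivWithinAt_nonneg (convex_Ioi 1)
      (fun y hy => (hF y hy).continuousAt.continuousWithinAt)
      (f' := fun y => √(c y)) (fun y hy => ?_) (fun y _ => Real.sqrt_nonneg _)
    rw [interior_Ioi] at hy
    exact (hF y hy).hasDerivWithinAt
  -- The derivative is -y c' / (2√c) ≥ 0 because c decreases. Hence y √c ≤ F(y) + const, so that v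
  -- √c also grows at most linearly.
  have hFc : MonotoneOn (fun y => F y - y * √(c y)) (Ioi 1) := by
    have hder : ∀ y, 1 < y → HasDerivAt (fun y => F y - y * √(c y))
        (√(c y) - (1 * √(c y) + y * (speedDeriv κ γ γt ε y / (2 * √(c y))))) y := fun y hy =>
      (hF y hy).sub ((hasDerivAt_id y).mul ((hp.hasDerivAt_soundSpeed hy).sqrt
        (hp.soundSpeed_pos hy).ne'))
    refine monotoneOn_of_hasDerivWithinAt_nonneg (convex_Ioi 1)
      (fun y hy => (hder y hy).continuousAt.continuousWithinAt)
      (fun y hy => (hder y (by simpa using hy)).hasDerivWithinAt) (fun y hy => ?_)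
    rw [interior_Ioi] at hy
    have h2 := hp.speedDeriv_neg hy
    have h3 := Real.sqrt_pos.mpr (hp.soundSpeed_pos hy)
    have h4 : y * (speedDeriv κ γ γt ε y / (2 * √(c y))) ≤ 0 :=
      mul_nonpos_of_nonneg_of_nonpos (by linarith [mem_Ioi.mp hy])
        (div_nonpos_of_nonpos_of_nonneg h2.le (by positivity))
    linarith
  set c₀ := F V + (1 + δ) * √(c (1 + δ)) with hc₀
  have hV : 1 + δ ≤ V := (hd.low hp 0).trans (hd.v_le 0)
  have hFV : 0 ≤ F V := by
    have := hFmono hδ1 (hδ1.trans_le hV) hV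
    simpa [F] using this
  have hc₀0 : 0 < c₀ := by
    have := Real.sqrt_pos.mpr (hp.soundSpeed_pos hδ1)
    positivity
  -- The coefficient is p'' / (4 c² √c), and p'' ≥ 2 c² / v makes it at least 1 / (2 v √c).
  have hcoef : ∀ t ∈ I, ∀ x, 1 / (2 * (c₀ + D * t)) ≤ riccatiCoeff κ γ γt ε (v t x) := by
    intro t ht x
    have htt : t ∈ Icc 0 t := ⟨hI.nonneg t ht, le_rfl⟩
    have hsub := hI.Icc_subset t ht
    have hv1 := h.solves.one_lt t ht x
    have h2 := sub_le_sub_of_deriv_le (fun r hr => h.hasDerivWithinAt_v hI ht x hF hr)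
      (g := fun r => D * r) (g' := fun _ => D)
      (fun r _ => by simpa using ((hasDerivAt_id r).const_mul D).hasDerivWithinAt)
      (fun r hr => deriv_u_le h1 (hsub hr) x) htt
    simp only [mul_zero, sub_zero, h.initial_v] at h2
    have h3 := hFmono (hd.one_lt x) (hδ1.trans_le hV) (hd.v_le x)
    have h4 := hFc hδ1 hv1 (h.low hd hp hI ht x)
    have h4' : -((1 + δ) * √(c (1 + δ))) ≤ F (v t x) - v t x * √(c (v t x)) := by
      simpa [F] using h4
    have h5 : v t x * √(c (v t x)) ≤ c₀ + D * t := by rw [hc₀]; linarith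
    have hcp := hp.soundSpeed_pos hv1
    have hr := Real.sqrt_pos.mpr hcp
    have h6 := hp.le_pressureDeriv₂ hv1
    rw [← hp.soundSpeed_mul_self hv1] at h6
    have hv0 : 0 < v t x := by linarith
    calc 1 / (2 * (c₀ + D * t)) ≤ 1 / (2 * (v t x * √(c (v t x)))) := by gcongr
      _ = (2 / v t x * (c (v t x) * c (v t x))) / (2 * c (v t x)) /
          (2 * c (v t x) * √(c (v t x))) := by
            rw [← hc] at hcp
            field_simp
      _ ≤ pressureDeriv₂ κ γ γt ε (v t x) / (2 * c (v t x)) /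
          (2 * c (v t x) * √(c (v t x))) := by
            rw [← hc] at hcp
            gcongr
      _ = riccatiCoeff κ γ γt ε (v t x) := by
            rw [riccatiCoeff, speedDeriv, neg_div, neg_div, neg_div, neg_neg]
  have hbound : ∀ T, 0 ≤ T → Real.log (c₀ + D * T) / (2 * D) - Real.log c₀ / (2 * D) ≤
      -(initialGrad κ γ γt ε s v₀ u₀ x₀)⁻¹ := by
    intro T hT
    have hTI : T ∈ I := hg ▸ hT
    obtain ⟨X, hX, hr, h0⟩ := h.exists_riccatiOn hd hp hI hs hTI ⟨le_rfl, hT⟩ x₀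
    rw [hX] at h0
    have := hr.sub_le_of_le (b := fun t => Real.log (c₀ + D * t) / (2 * D))
      (b' := fun t => 1 / (2 * (c₀ + D * t))) (fun t ht => ?_)
      (fun t ht => hcoef t (hI.Icc_subset T hTI ht) _) (by rw [hX, h0]; exact hx₀) ⟨hT, le_rfl⟩
    · simp only [mul_zero, add_zero] at this
      rwa [hX, h0] at this
    · have hpos : 0 < c₀ + D * t := by have := ht.1; positivity
      refine HasDerivAt.hasDerivWithinAt ?_
      have := ((((hasDerivAt_id t).const_mul D).const_add c₀).log hpos.ne').div_const (2 * D)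
      refine this.congr_deriv ?_
      simp only [id]
      field_simp
  set E := Real.log c₀ / (2 * D) - (initialGrad κ γ γt ε s v₀ u₀ x₀)⁻¹ with hE
  have hle : ∀ T, 0 ≤ T → c₀ + D * T ≤ Real.exp (2 * D * E) := by
    intro T hT
    have h2 := hbound T hT
    have h3 : Real.log (c₀ + D * T) / (2 * D) ≤ E := by rw [hE]; linarith
    rw [div_le_iff₀ (by positivity)] at h3
    exact (Real.log_le_iff_le_exp (by positivity)).mp (by linarith)
  -- The logarithmic growth of the integrated lower bound contradicts its uniform bound; this T
  -- already makes D T equal to the exponential, and c₀ > 0 exceeds it.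
  have h4 := hle (Real.exp (2 * D * E) / D) (by positivity)
  rw [mul_div_cancel₀ _ hD.ne'] at h4
  linarith

end BoundedSolution

end

/-! ### Estimates uniform in ε -/

section

variable {κ γ γt ε : ℝ} {v₀ u₀ : ℝ → ℝ} {I : Set ℝ} {v u : ℝ → ℝ → ℝ} {δ R V M : ℝ}

/-- Lower bound of the distance of the specific volume to its singular value. -/
lemma exists_le_sub_one (hκ : 0 < κ) (hγ : 1 < γ) (hγt : γt ∈ Ioo (1 : ℝ) 3) (hR : 0 < R) :
    ∃ A > 0, ∀ ε, 0 < ε → ∀ y, 1 < y → theta κ γ γt ε y ≤ R → A * ε ^ (1 / (γ - 1)) ≤ y - 1 := by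
  have hγ1 : 0 < γ - 1 := by linarith
  have hγ0 : 0 < γ := by linarith
  set p := (γ - 1) / 2 with hp
  have hp0 : 0 < p := by positivity
  -- Obtained by solving √(ε γ) (y - 1)^(-p) / p ≤ R, the singular part of the bound on θ, for y -
  -- 1.
  refine ⟨(√γ / (R * p)) ^ (1 / p), by positivity, fun ε hε y hy hθ => ?_⟩
  have hP : Parameters κ γ γt ε := ⟨hκ, hγ, hγt.1, hγt.2, hε⟩
  have hm : 0 < y - 1 := by linarith
  have h1 := (hP.le_theta hy).trans hθ
  rw [← hp, show 2 / (γ - 1) = 1 / p by rw [hp]; field_simp, Real.rpow_neg hm.le] at h1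
  have hmp : 0 < (y - 1) ^ p := by positivity
  have h2 : √(ε * γ) / (R * p) ≤ (y - 1) ^ p := by
    rw [div_le_iff₀ (by positivity)]
    calc √(ε * γ) = (√(ε * γ) * (1 / p) * ((y - 1) ^ p)⁻¹) * (p * (y - 1) ^ p) := by field_simp
      _ ≤ R * (p * (y - 1) ^ p) := by gcongr
      _ = _ := by ring
  have h3 := Real.rpow_le_rpow (by positivity) h2 (by positivity : 0 ≤ 1 / p)
  rw [← Real.rpow_mul hm.le, mul_one_div_cancel hp0.ne', Real.rpow_one] at h3
  refine le_trans (le_of_eq ?_) h3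
  rw [Real.sqrt_mul hε.le, mul_div_assoc, Real.mul_rpow (by positivity) (by positivity), mul_comm,
    Real.sqrt_eq_rpow ε, ← Real.rpow_mul hε.le]
  congr 2
  rw [hp]; field_simp

/-- The sound speed grows at most like `ε ^ (-1 / (γ - 1))`. -/
lemma exists_sqrt_soundSpeed_le (hκ : 0 < κ) (hγ : 1 < γ) (hγt : γt ∈ Ioo (1 : ℝ) 3)
    (hR : 0 < R) :
    ∃ C > 0, ∀ ε, 0 < ε → ε ≤ 1 → ∀ y, 1 < y → theta κ γ γt ε y ≤ R →
      √(soundSpeed κ γ γt ε y) ≤ C * ε ^ (-(1 / (2 * (γ - 1)))) := by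
  obtain ⟨A, hA, H⟩ := exists_le_sub_one hκ hγ hγt hR
  have hγ1 : 0 < γ - 1 := by linarith
  have hγt0 : 0 < γt := by linarith [hγt.1]
  refine ⟨√(R * ((γ - 1) / 2) / A + √(κ * γt)), by positivity, fun ε hε hε1 y hy hθ => ?_⟩
  have hP : Parameters κ γ γt ε := ⟨hκ, hγ, hγt.1, hγt.2, hε⟩
  have hm : 0 < y - 1 := by linarith
  have h1 := (hP.le_theta hy).trans hθ
  have h2 := H ε hε y hy hθ
  have hεp : 0 < ε ^ (1 / (γ - 1)) := by positivity
  -- The singular part of c is (γ - 1) / 2 times the singular lower bound of θ, divided by y - 1;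
  -- the former is at most R, and y - 1 is at least A ε^(1/(γ - 1)).
  have h3 : √(ε * γ) * (y - 1) ^ (-((γ + 1) / 2)) ≤
      R * ((γ - 1) / 2) / A * ε ^ (-(1 / (γ - 1))) := by
    have e : (y - 1) ^ (-((γ + 1) / 2)) = (y - 1) ^ (-((γ - 1) / 2)) / (y - 1) := by
      rw [← Real.rpow_sub_one hm.ne']; ring_nf
    rw [e, Real.rpow_neg hε.le]
    calc _ = (√(ε * γ) * (2 / (γ - 1)) * (y - 1) ^ (-((γ - 1) / 2))) * ((γ - 1) / 2) / (y - 1) := by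
          field_simp
      _ ≤ R * ((γ - 1) / 2) / (A * ε ^ (1 / (γ - 1))) := by gcongr
      _ = _ := by field_simp
  have h4 : √(κ * γt) * y ^ (-((γt + 1) / 2)) ≤ √(κ * γt) * ε ^ (-(1 / (γ - 1))) := by
    gcongr
    exact (Real.rpow_le_one_of_one_le_of_nonpos hy.le (by linarith)).trans
      (Real.one_le_rpow_of_pos_of_le_one_of_nonpos hε hε1
        (neg_nonpos.mpr (by positivity)))
  have h5 := hP.soundSpeed_le hy
  calc _ ≤ √((R * ((γ - 1) / 2) / A + √(κ * γt)) * ε ^ (-(1 / (γ - 1)))) := by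
        apply Real.sqrt_le_sqrt; linarith
    _ = _ := by
        rw [Parameters.sqrt_mul_rpow (by positivity) hε]
        congr 2
        field_simp

/-- This is where β arises. The singular part of c gives (y - 1) √c ≥ γ^(1/4) ε^(1/4) (y - 1)^((3 -
γ)/4). For γ ≤ 3 the last power is nondecreasing, and y - 1 ≥ A ε^(1/(γ - 1)) leads to 1/4 + (3 -
γ)/(4(γ - 1)) = 1/(2(γ - 1)). For γ > 3 it decreases, and the regular part of c takes over for
larger y. -/
lemma exists_le_sub_one_mul_sqrt_soundSpeed (hκ : 0 < κ) (hγ : 1 < γ)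
    (hγt : γt ∈ Ioo (1 : ℝ) 3) (hR : 0 < R) :
    ∃ K > 0, ∀ ε, 0 < ε → ε ≤ 1 → ∀ y, 1 < y → theta κ γ γt ε y ≤ R →
      K * ε ^ lifespanExponent γ ≤ (y - 1) * √(soundSpeed κ γ γt ε y) := by
  have hγ1 : 0 < γ - 1 := by linarith
  have hγ0 : 0 < γ := by linarith
  have hγt0 : 0 < γt := by linarith [hγt.1]
  have sing : ∀ ε, 0 < ε → ∀ y, 1 < y →
      √√γ * (ε ^ (1 / 4 : ℝ) * (y - 1) ^ ((3 - γ) / 4)) ≤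
        (y - 1) * √(soundSpeed κ γ γt ε y) := by
    intro ε hε y hy
    have hP : Parameters κ γ γt ε := ⟨hκ, hγ, hγt.1, hγt.2, hε⟩
    have hm : 0 < y - 1 := by linarith
    have h1 := Real.sqrt_le_sqrt (hP.soundSpeed_ge_singular hy)
    rw [Parameters.sqrt_mul_rpow (Real.sqrt_nonneg _) hm, Real.sqrt_mul hε.le,
      Real.sqrt_mul (Real.sqrt_nonneg _)] at h1
    have e1 : √√ε = ε ^ (1 / 4 : ℝ) := by
      rw [Real.sqrt_eq_rpow, Real.sqrt_eq_rpow, ← Real.rpow_mul hε.le]; norm_num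
    have e2 : (y - 1) ^ ((3 - γ) / 4) = (y - 1) * (y - 1) ^ (-((γ + 1) / 2 / 2)) := by
      rw [mul_comm, ← Real.rpow_add_one hm.ne']; ring_nf
    rw [e1] at h1
    rw [e2]
    calc _ = (y - 1) * (ε ^ (1 / 4 : ℝ) * √√γ * (y - 1) ^ (-((γ + 1) / 2 / 2))) := by ring
      _ ≤ _ := by gcongr
  rcases le_or_gt γ 3 with h3 | h3
  · obtain ⟨A, hA, H⟩ := exists_le_sub_one hκ hγ hγt hR
    refine ⟨√√γ * A ^ ((3 - γ) / 4), by positivity, fun ε hε hε1 y hy hθ => ?_⟩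
    refine le_trans ?_ (sing ε hε y hy)
    have h1 := Real.rpow_le_rpow (by positivity) (H ε hε y hy hθ)
      (by linarith : 0 ≤ (3 - γ) / 4)
    rw [Real.mul_rpow hA.le (by positivity), ← Real.rpow_mul hε.le] at h1
    have e : ε ^ lifespanExponent γ = ε ^ (1 / 4 : ℝ) * ε ^ (1 / (γ - 1) * ((3 - γ) / 4)) := by
      rw [← Real.rpow_add hε]
      congr 1
      unfold lifespanExponent
      rcases h3.lt_or_eq with h | h
      · rw [if_pos h]; field_simp; ring
      · rw [h]; norm_num
    rw [e]
    calc _ = √√γ * (ε ^ (1 / 4 : ℝ) *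
          (A ^ ((3 - γ) / 4) * ε ^ (1 / (γ - 1) * ((3 - γ) / 4)))) := by ring
      _ ≤ _ := by gcongr
  · have hβ : lifespanExponent γ = 1 / (γ + 1) := by
      unfold lifespanExponent
      rw [if_neg (by linarith), if_neg (by linarith)]
    have hγp : 0 < γ + 1 := by linarith
    set k := √√(κ * γt) with hk
    have hk0 : 0 < k := by rw [hk]; positivity
    refine ⟨min √√γ (k / 2), by positivity, fun ε hε hε1 y hy hθ => ?_⟩
    have hm : 0 < y - 1 := by linarith
    have hy0 : 0 < y := by linarith
    rw [hβ]
    -- The threshold is where ε (y - 1)^(-(γ + 1)) = 1. Below it the singular bound has exponent 1/4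
    -- + (3 - γ)/(4(γ + 1)) = 1/(γ + 1). Above it √c ≥ k / y, since γt < 3, and (y - 1) / y is at
    -- least half the threshold.
    rcases le_or_gt (y - 1) (ε ^ (1 / (γ + 1))) with h1 | h1
    · refine le_trans ?_ (sing ε hε y hy)
      have h2 := Real.rpow_le_rpow_of_nonpos hm h1 (by linarith : (3 - γ) / 4 ≤ 0)
      rw [← Real.rpow_mul hε.le] at h2
      have e : ε ^ (1 / (γ + 1)) = ε ^ (1 / 4 : ℝ) * ε ^ (1 / (γ + 1) * ((3 - γ) / 4)) := by
        rw [← Real.rpow_add hε]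
        congr 1
        field_simp; ring
      rw [e]
      gcongr
      exact min_le_left _ _
    · have hP : Parameters κ γ γt ε := ⟨hκ, hγ, hγt.1, hγt.2, hε⟩
      have h2 := Real.sqrt_le_sqrt (hP.soundSpeed_ge_regular hy)
      rw [Parameters.sqrt_mul_rpow (Real.sqrt_nonneg _) hy0, ← hk] at h2
      have h3 : y⁻¹ ≤ y ^ (-((γt + 1) / 2 / 2)) := by
        rw [← Real.rpow_neg_one]
        exact Real.rpow_le_rpow_of_exponent_le hy.le (by linarith [hγt.2])
      have h4 : k * y⁻¹ ≤ √(soundSpeed κ γ γt ε y) := le_trans (by gcongr) h2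
      have hε2 : ε ^ (1 / (γ + 1)) ≤ 1 := Real.rpow_le_one hε.le hε1 (by positivity)
      have h5 : ε ^ (1 / (γ + 1)) * y ≤ 2 * (y - 1) := by
        have hεp : 0 < ε ^ (1 / (γ + 1)) := by positivity
        nlinarith
      calc _ ≤ k / 2 * ε ^ (1 / (γ + 1)) := by
            gcongr
            exact min_le_right _ _
        _ = k * (ε ^ (1 / (γ + 1)) * y) / 2 * y⁻¹ := by field_simp
        _ ≤ k * (2 * (y - 1)) / 2 * y⁻¹ := by gcongr
        _ = (y - 1) * (k * y⁻¹) := by ring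
        _ ≤ _ := by gcongr

/-- Upper bound of the coefficient of the Riccati equations. -/
lemma exists_riccatiCoeff_le (hκ : 0 < κ) (hγ : 1 < γ) (hγt : γt ∈ Ioo (1 : ℝ) 3)
    (hR : 0 < R) :
    ∃ C > 0, ∀ ε, 0 < ε → ε ≤ 1 → ∀ y, 1 < y → theta κ γ γt ε y ≤ R →
      riccatiCoeff κ γ γt ε y ≤ C / ε ^ lifespanExponent γ := by
  obtain ⟨K, hK, H⟩ := exists_le_sub_one_mul_sqrt_soundSpeed hκ hγ hγt hR
  have hs : 0 < γ + γt + 2 := by linarith [hγt.1]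
  -- The coefficient equals p'' / (4 c² √c), and the bound on p'' turns it into (γ + γt + 2) / (4 (y
  -- - 1) √c).
  refine ⟨(γ + γt + 2) / (4 * K), by positivity, fun ε hε hε1 y hy hθ => ?_⟩
  have hP : Parameters κ γ γt ε := ⟨hκ, hγ, hγt.1, hγt.2, hε⟩
  have h1 := H ε hε hε1 y hy hθ
  have h2 := hP.pressureDeriv₂_le hy
  rw [← hP.soundSpeed_mul_self hy] at h2
  have hc := hP.soundSpeed_pos hy
  have hr := Real.sqrt_pos.mpr hc
  have hm : 0 < y - 1 := by linarith
  rw [riccatiCoeff, speedDeriv, neg_div, neg_div, neg_div, neg_neg]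
  calc _ ≤ (γ + γt + 2) / (y - 1) * (soundSpeed κ γ γt ε y * soundSpeed κ γ γt ε y) /
        (2 * soundSpeed κ γ γt ε y) / (2 * soundSpeed κ γ γt ε y * √(soundSpeed κ γ γt ε y)) := by
        gcongr
    _ = (γ + γt + 2) / (4 * ((y - 1) * √(soundSpeed κ γ γt ε y))) := by field_simp; norm_num
    _ ≤ (γ + γt + 2) / (4 * (K * ε ^ lifespanExponent γ)) := by gcongr
    _ = _ := by field_simp

/-- Bound of the Riemann invariants of admissible data. -/
noncomputable def invariantBound (κ γ γt M₁ M₂ : ℝ) : ℝ :=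
  M₂ + √γ * (2 / (γ - 1)) * √M₁ + √(κ * γt) * (2 / (γt - 1))

lemma invariantBound_pos (hγ : 1 < γ) (hγt : 1 < γt) {M₁ M₂ : ℝ} (hM₂ : 0 < M₂) :
    0 < invariantBound κ γ γt M₁ M₂ := by
  have h1 : 0 < γ - 1 := by linarith
  have h2 : 0 < γt - 1 := by linarith
  unfold invariantBound
  positivity

namespace AdmissibleData

variable {M₁ M₂ Y₀ Q₀ : ℝ} (h : AdmissibleData κ γ γt M₁ M₂ Y₀ Q₀ ε v₀ u₀)
  (hp : Parameters κ γ γt ε)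
include h hp

/-- The hypothesis on (v₀ - 1)^(γ - 1) says √ε (v₀ - 1)^(-(γ - 1)/2) ≤ √M₁, which bounds the
singular part of θ(v₀) independently of ε. The distance δ does depend on ε; the uniform estimates
use only the bound on the invariants. -/
lemma exists_boundedData (hM₁ : 0 < M₁) (hM₂ : 0 < M₂) :
    ∃ δ, BoundedData κ γ γt ε δ (invariantBound κ γ γt M₁ M₂) M₂ M₂ v₀ u₀ := by
  have hγ := hp.one_lt_γ
  have hγ1 : 0 < γ - 1 := by linarith
  have hγt := hp.one_lt_γt
  have hγt1 : 0 < γt - 1 := by linarith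
  have hε := hp.ε_pos
  obtain ⟨y, hy, e⟩ := hp.exists_theta_eq (invariantBound_pos (κ := κ) (M₁ := M₁) hγ hγt hM₂)
  have hb : ∀ x y, |v₀ x| ≤ M₂ ∧ |u₀ x| ≤ M₂ ∧ |deriv v₀ y| ≤ M₂ ∧ |deriv u₀ y| ≤ M₂ := by
    intro x y
    have h1 := h.c1_bound x y
    have h2 := le_max_left |v₀ x| |u₀ x|
    have h3 := le_max_right |v₀ x| |u₀ x|
    have h4 := le_max_left |deriv v₀ y| |deriv u₀ y|
    have h5 := le_max_right |deriv v₀ y| |deriv u₀ y|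
    have h6 := abs_nonneg (v₀ x)
    have h7 := abs_nonneg (deriv v₀ y)
    exact ⟨by linarith, by linarith, by linarith, by linarith⟩
  refine ⟨y - 1, h.contDiff_v, h.contDiff_u, by linarith, by rw [add_sub_cancel, e], h.one_lt,
    fun x => ?_, fun x => (le_abs_self _).trans (hb x x).1, fun x => (hb x x).2.2.1,
    fun x => (hb x x).2.2.2⟩
  have hv1 := h.one_lt x
  have hm : 0 < v₀ x - 1 := by linarith
  have h1 := hp.theta_le hv1
  have h2 : √ε * (v₀ x - 1) ^ (-((γ - 1) / 2)) ≤ √M₁ := by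
    have h3 : ε ≤ M₁ * (v₀ x - 1) ^ (γ - 1) := by
      have := h.away_from_one x
      rwa [inv_mul_le_iff₀ hM₁] at this
    have h4 := Real.sqrt_le_sqrt h3
    rw [Real.sqrt_mul hM₁.le, Real.sqrt_eq_rpow ((v₀ x - 1) ^ (γ - 1)), ← Real.rpow_mul hm.le,
      show (γ - 1) * (1 / 2) = (γ - 1) / 2 by ring] at h4
    rw [Real.rpow_neg hm.le, ← div_eq_mul_inv, div_le_iff₀ (by positivity)]
    exact h4
  have h3 : v₀ x ^ (-((γt - 1) / 2)) ≤ 1 :=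
    Real.rpow_le_one_of_one_le_of_nonpos hv1.le (by linarith)
  have h4 : √(ε * γ) * (2 / (γ - 1)) * (v₀ x - 1) ^ (-((γ - 1) / 2)) ≤
      √γ * (2 / (γ - 1)) * √M₁ := by
    rw [Real.sqrt_mul hε.le]
    calc _ = √γ * (2 / (γ - 1)) * (√ε * (v₀ x - 1) ^ (-((γ - 1) / 2))) := by ring
      _ ≤ _ := by gcongr
  have h5 : √(κ * γt) * (2 / (γt - 1)) * v₀ x ^ (-((γt - 1) / 2)) ≤
      √(κ * γt) * (2 / (γt - 1)) * 1 := by gcongr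
  have h6 := (hb x x).2.1
  unfold invariantBound
  linarith

lemma initialGrad_eq (x : ℝ) :
    initialGrad κ γ γt ε 1 v₀ u₀ x =
      √(soundSpeed κ γ γt ε (v₀ x)) * deriv (riemannW κ γ γt ε v₀ u₀) x ∧
    initialGrad κ γ γt ε (-1) v₀ u₀ x =
      √(soundSpeed κ γ γt ε (v₀ x)) * deriv (riemannZ κ γ γt ε v₀ u₀) x := by
  have hu : HasDerivAt u₀ (deriv u₀ x) x :=
    (h.contDiff_u.differentiable (by norm_num) x).hasDerivAt
  have hv : HasDerivAt v₀ (deriv v₀ x) x :=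
    (h.contDiff_v.differentiable (by norm_num) x).hasDerivAt
  have hθ : HasDerivAt (fun x => theta κ γ γt ε (v₀ x))
      (-soundSpeed κ γ γt ε (v₀ x) * deriv v₀ x) x := (hp.hasDerivAt_theta (h.one_lt x)).comp x hv
  have hw : deriv (riemannW κ γ γt ε v₀ u₀) x =
      deriv u₀ x + -soundSpeed κ γ γt ε (v₀ x) * deriv v₀ x := (hu.add hθ).deriv
  have hz : deriv (riemannZ κ γ γt ε v₀ u₀) x =
      deriv u₀ x - -soundSpeed κ γ γt ε (v₀ x) * deriv v₀ x := (hu.sub hθ).deriv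
  rw [hw, hz]
  simp only [initialGrad, weightedGrad, riemannGrad]
  constructor <;> ring

end AdmissibleData

/-- Bounds of the derivatives in terms of the weighted gradients. -/
lemma Parameters.abs_deriv_le (hp : Parameters κ γ γt ε) {q : ℝ × ℝ} {N W : ℝ}
    (hv : 1 < v q.1 q.2) (hW : v q.1 q.2 ≤ W) (h1 : |weightedGrad κ γ γt ε 1 v u q| ≤ N)
    (h2 : |weightedGrad κ γ γt ε (-1) v u q| ≤ N) :
    |deriv (u q.1) q.2| ≤ N / √(√(κ * γt) * W ^ (-((γt + 1) / 2))) ∧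
    |deriv (v q.1) q.2| ≤ N / (√(√(κ * γt) * W ^ (-((γt + 1) / 2))) *
      (√(κ * γt) * W ^ (-((γt + 1) / 2)))) ∧
    |speedSq κ γ γt ε (v q.1 q.2) * deriv (v q.1) q.2| ≤
      N * √(soundSpeed κ γ γt ε (v q.1 q.2)) := by
  have hκ := hp.κ_pos; have hγt := hp.γt_pos
  have hN : 0 ≤ N := (abs_nonneg _).trans h1
  have hc := hp.soundSpeed_pos hv
  have hr := Real.sqrt_pos.mpr hc
  have hrr := Real.mul_self_sqrt hc.le
  have e1 := weightedGrad_add (κ := κ) (γ := γ) (γt := γt) (ε := ε) v u q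
  have e2 := weightedGrad_sub (κ := κ) (γ := γ) (γt := γt) (ε := ε) v u q
  have hsq := hp.soundSpeed_mul_self hv
  have hge := hp.soundSpeed_ge_regular hv
  have hv0 : 0 < v q.1 q.2 := by linarith
  have hW0 : 0 < W := hv0.trans_le hW
  have hcm : √(κ * γt) * W ^ (-((γt + 1) / 2)) ≤ soundSpeed κ γ γt ε (v q.1 q.2) := by
    refine le_trans ?_ hge
    gcongr √(κ * γt) * ?_
    exact Real.rpow_le_rpow_of_nonpos hv0 hW (by linarith)
  have hcm0 : 0 < √(κ * γt) * W ^ (-((γt + 1) / 2)) := by positivity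
  have hsm := Real.sqrt_le_sqrt hcm
  have hsm0 := Real.sqrt_pos.mpr hcm0
  have f1 : √(soundSpeed κ γ γt ε (v q.1 q.2)) * |deriv (u q.1) q.2| ≤ N := by
    rw [← abs_of_pos hr, ← abs_mul]
    rw [abs_le] at h1 h2 ⊢
    constructor <;> linarith [h1.1, h1.2, h2.1, h2.2]
  have f2 : √(soundSpeed κ γ γt ε (v q.1 q.2)) * soundSpeed κ γ γt ε (v q.1 q.2) *
      |deriv (v q.1) q.2| ≤ N := by
    rw [← abs_of_pos (mul_pos hr hc), ← abs_mul]
    rw [abs_le] at h1 h2 ⊢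
    constructor <;> linarith [h1.1, h1.2, h2.1, h2.2]
  refine ⟨?_, ?_, ?_⟩
  · rw [le_div_iff₀ hsm0, mul_comm]
    exact le_trans (by gcongr) f1
  · rw [le_div_iff₀ (by positivity), mul_comm]
    exact le_trans (by gcongr) f2
  · rw [abs_mul, abs_of_pos (hp.speedSq_pos hv), ← hsq]
    calc _ = √(soundSpeed κ γ γt ε (v q.1 q.2)) * √(soundSpeed κ γ γt ε (v q.1 q.2)) *
          soundSpeed κ γ γt ε (v q.1 q.2) * |deriv (v q.1) q.2| := by rw [hrr]
      _ = (√(soundSpeed κ γ γt ε (v q.1 q.2)) * soundSpeed κ γ γt ε (v q.1 q.2) *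
          |deriv (v q.1) q.2|) * √(soundSpeed κ γ γt ε (v q.1 q.2)) := by ring
      _ ≤ _ := by gcongr

/-- Bound at time `t` of the specific volume, when `∂ₓu ≤ D / √c`. -/
noncomputable def volumeBound (κ γt V D t : ℝ) : ℝ :=
  (V ^ ((3 - γt) / 4) + (3 - γt) / 4 * (D / √√(κ * γt)) * t) ^ (4 / (3 - γt))

namespace BoundedSolution

variable (h : BoundedSolution κ γ γt ε v₀ u₀ I v u) (hd : BoundedData κ γ γt ε δ R V M v₀ u₀)
  (hp : Parameters κ γ γt ε)
include h hd hp

lemma v_le (hI : IsInitialInterval I) {D : ℝ} (hD : 0 ≤ D)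
    (h1 : ∀ t ∈ I, ∀ x, weightedGrad κ γ γt ε 1 v u (t, x) +
      weightedGrad κ γ γt ε (-1) v u (t, x) ≤ 2 * D) {t T : ℝ} (ht : t ∈ I) (htT : t ≤ T) (x : ℝ) :
    v t x ≤ volumeBound κ γt V D T := by
  have hγt3 : 0 < 3 - γt := by linarith [hp.γt_lt]
  have hv0 : 0 < v t x := by linarith [h.solves.one_lt t ht x]
  have h2 := h.rpow_v_le hd hp hI hD h1 ht x
  have h3 : (3 - γt) / 4 * (D / √√(κ * γt)) * t ≤ (3 - γt) / 4 * (D / √√(κ * γt)) * T := by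
    gcongr
  have h4 := Real.rpow_le_rpow (by positivity) (h2.trans (add_le_add_right h3 _))
    (by positivity : 0 ≤ 4 / (3 - γt))
  rwa [← Real.rpow_mul hv0.le, show (3 - γt) / 4 * (4 / (3 - γt)) = 1 by field_simp,
    Real.rpow_one] at h4

/-- The gradient of a maximal solution blows up. -/
lemma eventually_gradient_gt {T : ℝ} (hT : 0 < T) (hIT : I = Ico 0 T)
    (hmax : ∀ T' v' u', BoundedSolution κ γ γt ε v₀ u₀ (Ico 0 T') v' u' → T' ≤ T) {D : ℝ}
    (hD : 0 ≤ D) (h1 : ∀ t ∈ I, ∀ x, weightedGrad κ γ γt ε 1 v u (t, x) +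
      weightedGrad κ γ γt ε (-1) v u (t, x) ≤ 2 * D) (M' : ℝ) :
    ∀ᶠ t in 𝓝[<] T, ∃ x, M' < max |deriv (v t) x| |deriv (u t) x| := by
  subst hIT
  by_contra hcon
  rw [not_eventually] at hcon
  -- The negation bounds the gradient only at times accumulating at T. That suffices for an
  -- extension, which is why the gradient tends to infinity rather than being merely unbounded.
  have hf := hcon.and_eventually (Ioo_mem_nhdsLT hT)
  obtain ⟨T', hT', v', u', h'⟩ := h.exists_extension hT hd hp
    (V' := volumeBound κ γt V D T) (M' := M') (hf.mono fun t ht x => by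
      have h2 := ht.1
      push Not at h2
      have h3 := h2 x
      exact ⟨h.v_le hd hp (isInitialInterval_Ico T) hD h1 ⟨ht.2.1.le, ht.2.2⟩ ht.2.2.le x,
        (le_max_left _ _).trans h3, (le_max_right _ _).trans h3⟩)
  exact absurd (hmax T' v' u' h') (not_le.mpr hT')

/-- The weighted gradients of a maximal solution are unbounded. -/
lemma false_of_abs_weightedGrad_le {T : ℝ} (hT : 0 < T) (hIT : I = Ico 0 T)
    (hmax : ∀ T' v' u', BoundedSolution κ γ γt ε v₀ u₀ (Ico 0 T') v' u' → T' ≤ T) {N : ℝ}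
    (h1 : ∀ t ∈ I, ∀ x, |weightedGrad κ γ γt ε 1 v u (t, x)| ≤ N)
    (h2 : ∀ t ∈ I, ∀ x, |weightedGrad κ γ γt ε (-1) v u (t, x)| ≤ N) : False := by
  have h0 : (0 : ℝ) ∈ I := hIT ▸ ⟨le_rfl, hT⟩
  have hN : 0 ≤ N := (abs_nonneg _).trans (h1 0 h0 0)
  have h3 : ∀ t ∈ I, ∀ x, weightedGrad κ γ γt ε 1 v u (t, x) +
      weightedGrad κ γ γt ε (-1) v u (t, x) ≤ 2 * N := fun t ht x => by
    linarith [(abs_le.mp (h1 t ht x)).2, (abs_le.mp (h2 t ht x)).2]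
  -- A lower bound for the sound speed up to time T, from the bound on v; it converts bounded
  -- weighted gradients into bounded gradients.
  set c := √(κ * γt) * volumeBound κ γt V N T ^ (-((γt + 1) / 2)) with hc
  have ev := h.eventually_gradient_gt hd hp hT hIT hmax hN h3 (max (N / √c) (N / (√c * c)))
  obtain ⟨t, ⟨x, hx⟩, ht⟩ := (ev.and (Ioo_mem_nhdsLT hT)).exists
  have htI : t ∈ I := hIT ▸ ⟨ht.1.le, ht.2⟩
  have hb := hp.abs_deriv_le (q := (t, x)) (h.solves.one_lt t htI x)
    (h.v_le hd hp (hIT ▸ isInitialInterval_Ico T) hN h3 htI ht.2.le x) (h1 t htI x) (h2 t htI x)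
  rw [← hc] at hb
  exact absurd hx (not_lt.mpr (max_le (le_max_of_le_right hb.2.1) (le_max_of_le_left hb.1)))

end BoundedSolution

end

/-! ### The rarefactive and the compressive case -/

section

variable {κ γ γt ε M₁ M₂ Y₀ Q₀ : ℝ} {v₀ u₀ : ℝ → ℝ} {I : Set ℝ} {v u : ℝ → ℝ → ℝ} {δ R V M : ℝ}

namespace AdmissibleData

variable (h : AdmissibleData κ γ γt M₁ M₂ Y₀ Q₀ ε v₀ u₀) (hp : Parameters κ γ γt ε)
include h hp

lemma initialGrad_one_le (x : ℝ) : initialGrad κ γ γt ε 1 v₀ u₀ x ≤ Y₀ := by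
  rw [(h.initialGrad_eq hp x).1]; exact h.w_bound x

lemma initialGrad_neg_one_le (x : ℝ) : initialGrad κ γ γt ε (-1) v₀ u₀ x ≤ Q₀ := by
  rw [(h.initialGrad_eq hp x).2]; exact h.z_bound x

lemma sqrt_soundSpeed_pos (x : ℝ) : 0 < √(soundSpeed κ γ γt ε (v₀ x)) :=
  Real.sqrt_pos.mpr (hp.soundSpeed_pos (h.one_lt x))

/-- The weighted gradients are bounded above by their initial bounds. -/
lemma weightedGrad_add_le (hs : BoundedSolution κ γ γt ε v₀ u₀ I v u)
    (hd : BoundedData κ γ γt ε δ R V M v₀ u₀) (hI : IsInitialInterval I) {t : ℝ} (ht : t ∈ I)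
    (x : ℝ) : weightedGrad κ γ γt ε 1 v u (t, x) + weightedGrad κ γ γt ε (-1) v u (t, x) ≤
      2 * ((Y₀ + Q₀) / 2) := by
  have h1 := hs.weightedGrad_le hd hp hI (s := 1) (by norm_num) (h.initialGrad_one_le hp) ht x
  have h2 := hs.weightedGrad_le hd hp hI (s := -1) (by norm_num) (h.initialGrad_neg_one_le hp) ht x
  linarith

lemma abs_weightedGrad_le_of_rarefactive (hr : ∀ x, RarefactiveAt κ γ γt ε v₀ u₀ x)
    (hs : BoundedSolution κ γ γt ε v₀ u₀ I v u)
    (hd : BoundedData κ γ γt ε δ R V M v₀ u₀) (hI : IsInitialInterval I) {t : ℝ} (ht : t ∈ I)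
    (x : ℝ) : |weightedGrad κ γ γt ε 1 v u (t, x)| ≤ max Y₀ Q₀ ∧
      |weightedGrad κ γ γt ε (-1) v u (t, x)| ≤ max Y₀ Q₀ := by
  have n1 := hs.weightedGrad_nonneg hd hp hI (s := 1) (by norm_num) (fun x => by
    rw [(h.initialGrad_eq hp x).1]
    exact mul_nonneg (h.sqrt_soundSpeed_pos hp x).le (hr x).1) ht x
  have n2 := hs.weightedGrad_nonneg hd hp hI (s := -1) (by norm_num) (fun x => by
    rw [(h.initialGrad_eq hp x).2]
    exact mul_nonneg (h.sqrt_soundSpeed_pos hp x).le (hr x).2) ht x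
  rw [abs_of_nonneg n1, abs_of_nonneg n2]
  exact ⟨le_max_of_le_left (hs.weightedGrad_le hd hp hI (by norm_num) (h.initialGrad_one_le hp) ht x),
    le_max_of_le_right
      (hs.weightedGrad_le hd hp hI (by norm_num) (h.initialGrad_neg_one_le hp) ht x)⟩

end AdmissibleData

/-- Everywhere rarefactive data have a global solution, with bounds uniform in `ε`. -/
theorem exists_global_bound (hκ : 0 < κ) (hγ : 1 < γ) (hγt : γt ∈ Ioo (1 : ℝ) 3) (hM₁ : 0 < M₁)
    (hM₂ : 0 < M₂) (hY₀ : 0 < Y₀) (hQ₀ : 0 < Q₀) :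
    ∃ K : ℝ → ℝ, ∀ ε, 0 < ε → ε ≤ 1 → ∀ v₀ u₀ : ℝ → ℝ,
      AdmissibleData κ γ γt M₁ M₂ Y₀ Q₀ ε v₀ u₀ → (∀ x, RarefactiveAt κ γ γt ε v₀ u₀ x) →
      ∃ v u : ℝ → ℝ → ℝ, IsC1Solution κ γ γt ε v₀ u₀ (Ici 0) v u ∧
        (∀ v' u' : ℝ → ℝ → ℝ, IsC1Solution κ γ γt ε v₀ u₀ (Ici 0) v' u' →
          AgreeOn (Ici 0) v u v' u') ∧
        (∀ T : ℝ, 0 < T → ∀ v' u' : ℝ → ℝ → ℝ, IsC1Solution κ γ γt ε v₀ u₀ (Ico 0 T) v' u' →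
          AgreeOn (Ico 0 T) v u v' u') ∧
        (∀ T : ℝ, 0 < T → ∀ t ∈ Icc 0 T, ∀ x,
          |v t x| ≤ K T ∧ |u t x| ≤ K T ∧ |deriv (v t) x| ≤ K T ∧ |deriv (u t) x| ≤ K T ∧
          |derivWithin (fun s => v s x) (Ici 0) t| ≤ K T ∧
          |derivWithin (fun s => u s x) (Ici 0) t| ≤ K T * ε ^ (-(1 / (2 * (γ - 1))))) := by
  have hR : 0 < invariantBound κ γ γt M₁ M₂ := invariantBound_pos hγ hγt.1 hM₂
  obtain ⟨C, hC, HC⟩ := exists_sqrt_soundSpeed_le hκ hγ hγt hR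
  let N := max Y₀ Q₀
  let W : ℝ → ℝ := volumeBound κ γt M₂ ((Y₀ + Q₀) / 2)
  let c : ℝ → ℝ := fun T => √(κ * γt) * W T ^ (-((γt + 1) / 2))
  have hN : 0 < N := lt_max_of_lt_left hY₀
  -- The entries bound, in turn, v, u, ∂ₓu (which is ∂ₜv), ∂ₓv, and the factor of the power of ε in
  -- ∂ₜu = c² ∂ₓv.
  refine ⟨fun T => max (max (W T) (invariantBound κ γ γt M₁ M₂))
    (max (max (N / √(c T)) (N / (√(c T) * c T))) (N * C)), fun ε hε hε1 v₀ u₀ h hr => ?_⟩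
  have hp : Parameters κ γ γt ε := ⟨hκ, hγ, hγt.1, hγt.2, hε⟩
  obtain ⟨δ, hd⟩ := h.exists_boundedData hp hM₁ hM₂
  obtain ⟨v, u, hs⟩ : ∃ v u, BoundedSolution κ γ γt ε v₀ u₀ (Ici 0) v u := by
    rcases hd.exists_maximal hp with hs | ⟨T, hT, v, u, hs, hmax⟩
    · exact hs
    · exact (hs.false_of_abs_weightedGrad_le hd hp hT rfl hmax
        (fun t ht x => (h.abs_weightedGrad_le_of_rarefactive hp hr hs hd
          (isInitialInterval_Ico T) ht x).1)
        (fun t ht x => (h.abs_weightedGrad_le_of_rarefactive hp hr hs hd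
          (isInitialInterval_Ico T) ht x).2)).elim
  have hI := isInitialInterval_Ici
  have hU := uniqueDiffOn_Ici (0 : ℝ)
  refine ⟨v, u, hs.isC1Solution hd hp hI hU,
    fun v' u' h' => hs.agreeOn hd hp hI (h'.boundedSolution hU),
    fun T _ v' u' h' => (hs.mono Ico_subset_Ici_self).agreeOn hd hp (isInitialInterval_Ico T)
      (h'.boundedSolution (uniqueDiffOn_Ico 0 T)), fun T _ t ht x => ?_⟩
  have ht0 : t ∈ Ici (0 : ℝ) := ht.1
  have hv1 := hs.solves.one_lt t ht0 x
  have hW := hs.v_le hd hp hI (by positivity)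
    (fun t ht x => h.weightedGrad_add_le hp hs hd hI ht x) ht0 ht.2 x
  have hθ := hs.riemann_le hd hp hI ht0 x
  have hθ0 := hp.theta_pos hv1
  obtain ⟨g1, g2⟩ := h.abs_weightedGrad_le_of_rarefactive hp hr hs hd hI ht0 x
  obtain ⟨b1, b2, b3⟩ := hp.abs_deriv_le (q := (t, x)) hv1 hW g1 g2
  obtain ⟨e1, e2⟩ := hs.solves.derivWithin_eq hU ht0 x
  have hc := HC ε hε hε1 (v t x) hv1 (by linarith [abs_nonneg (u t x)])
  have hux := le_max_of_le_right (b := max (W T) (invariantBound κ γ γt M₁ M₂))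
    (le_max_of_le_left (c := N * C) (le_max_of_le_left (c := N / (√(c T) * c T)) b1))
  rw [e1, e2]
  refine ⟨?_, ?_, ?_, hux, hux, ?_⟩
  · rw [abs_of_pos (by linarith)]
    exact le_max_of_le_left (le_max_of_le_left hW)
  · exact le_max_of_le_left (le_max_of_le_right (by linarith))
  · exact le_max_of_le_right (le_max_of_le_left (le_max_of_le_right b2))
  · calc _ ≤ N * √(soundSpeed κ γ γt ε (v t x)) := b3
      _ ≤ N * (C * ε ^ (-(1 / (2 * (γ - 1))))) := by gcongr
      _ = N * C * ε ^ (-(1 / (2 * (γ - 1)))) := by ring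
      _ ≤ _ := by
        gcongr
        exact le_max_of_le_right (le_max_right _ _)

/-- Data which are compressive somewhere have a maximal solution with finite life-span, bounded
below in terms of the compression. -/
theorem exists_lifespan_bound (hκ : 0 < κ) (hγ : 1 < γ) (hγt : γt ∈ Ioo (1 : ℝ) 3) (hM₁ : 0 < M₁)
    (hM₂ : 0 < M₂) (hY₀ : 0 < Y₀) (hQ₀ : 0 < Q₀) :
    ∃ C > 0, ∀ ε, 0 < ε → ε ≤ 1 → ∀ v₀ u₀ : ℝ → ℝ,
      AdmissibleData κ γ γt M₁ M₂ Y₀ Q₀ ε v₀ u₀ → (∃ x, ¬ RarefactiveAt κ γ γt ε v₀ u₀ x) →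
      ∃ (Tm : ℝ) (v u : ℝ → ℝ → ℝ), 0 < Tm ∧ IsC1Solution κ γ γt ε v₀ u₀ (Ico 0 Tm) v u ∧
        (∀ T : ℝ, 0 < T → ∀ v' u' : ℝ → ℝ → ℝ, IsC1Solution κ γ γt ε v₀ u₀ (Ico 0 T) v' u' →
          T ≤ Tm ∧ AgreeOn (Ico 0 T) v u v' u') ∧
        (∀ M : ℝ, ∀ᶠ t in 𝓝[<] Tm, ∃ x, M < max |deriv (v t) x| |deriv (u t) x|) ∧
        (⨅ x : {x : ℝ // 0 < compression κ γ γt ε v₀ u₀ x},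
          ε ^ lifespanExponent γ / (C * √(soundSpeed κ γ γt ε (v₀ x)) *
            compression κ γ γt ε v₀ u₀ x)) ≤ Tm := by
  have hR : 0 < invariantBound κ γ γt M₁ M₂ := invariantBound_pos hγ hγt.1 hM₂
  obtain ⟨C, hC, HC⟩ := exists_riccatiCoeff_le hκ hγ hγt hR
  refine ⟨C, hC, fun ε hε hε1 v₀ u₀ h ⟨x₀, hx₀⟩ => ?_⟩
  have hp : Parameters κ γ γt ε := ⟨hκ, hγ, hγt.1, hγt.2, hε⟩
  obtain ⟨δ, hd⟩ := h.exists_boundedData hp hM₁ hM₂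
  have hneg : ∃ s : ℝ, s * s = 1 ∧ initialGrad κ γ γt ε s v₀ u₀ x₀ < 0 := by
    have hc := h.sqrt_soundSpeed_pos hp x₀
    rw [RarefactiveAt, not_and_or, not_le, not_le] at hx₀
    rcases hx₀ with h1 | h1
    · refine ⟨1, by norm_num, ?_⟩
      rw [(h.initialGrad_eq hp x₀).1]
      exact mul_neg_of_pos_of_neg hc h1
    · refine ⟨-1, by norm_num, ?_⟩
      rw [(h.initialGrad_eq hp x₀).2]
      exact mul_neg_of_pos_of_neg hc h1
  obtain ⟨s, hs1, hs2⟩ := hneg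
  rcases hd.exists_maximal hp with ⟨v, u, hs⟩ | ⟨Tm, hTm, v, u, hs, hmax⟩
  · exact (hs.false_of_global hd hp isInitialInterval_Ici (D := (Y₀ + Q₀) / 2) (by positivity) rfl
      (fun t ht x => h.weightedGrad_add_le hp hs hd isInitialInterval_Ici ht x) hs1 hs2).elim
  have hI := isInitialInterval_Ico Tm
  refine ⟨Tm, v, u, hTm, hs.isC1Solution hd hp hI (uniqueDiffOn_Ico 0 Tm), fun T _ v' u' h' => ?_,
    hs.eventually_gradient_gt hd hp hTm rfl hmax (D := (Y₀ + Q₀) / 2) (by positivity)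
      fun t ht x => h.weightedGrad_add_le hp hs hd hI ht x, ?_⟩
  · have hb := h'.boundedSolution (uniqueDiffOn_Ico 0 T)
    have hT := hmax T v' u' hb
    exact ⟨hT, (hs.mono (Ico_subset_Ico_right hT)).agreeOn hd hp (isInitialInterval_Ico T) hb⟩
  by_contra hcon
  push Not at hcon
  set m := ⨅ x : {x : ℝ // 0 < compression κ γ γt ε v₀ u₀ x},
    ε ^ lifespanExponent γ / (C * √(soundSpeed κ γ γt ε (v₀ x)) *
      compression κ γ γt ε v₀ u₀ x) with hm
  have hm0 : 0 < m := hTm.trans hcon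
  have hεp : 0 < ε ^ lifespanExponent γ := by positivity
  -- If the solution stopped before the infimum m, then m > 0, and N bounds √c⁰ times the
  -- compression at every point, compressive or not.
  set N := ε ^ lifespanExponent γ / (C * m) with hN
  have hN0 : 0 < N := by positivity
  have hcomp : ∀ x, √(soundSpeed κ γ γt ε (v₀ x)) * compression κ γ γt ε v₀ u₀ x ≤ N := by
    intro x
    have hc := h.sqrt_soundSpeed_pos hp x
    rcases le_or_gt (compression κ γ γt ε v₀ u₀ x) 0 with h1 | h1
    · exact (mul_nonpos_of_nonneg_of_nonpos hc.le h1).trans hN0.le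
    · have hbdd : BddBelow (range fun x : {x : ℝ // 0 < compression κ γ γt ε v₀ u₀ x} =>
          ε ^ lifespanExponent γ / (C * √(soundSpeed κ γ γt ε (v₀ x)) *
            compression κ γ γt ε v₀ u₀ x)) := by
        refine ⟨0, ?_⟩
        rintro _ ⟨y, rfl⟩
        have := y.2
        positivity
      have h2 : m ≤ ε ^ lifespanExponent γ / (C * √(soundSpeed κ γ γt ε (v₀ x)) *
          compression κ γ γt ε v₀ u₀ x) := ciInf_le hbdd ⟨x, h1⟩
      rw [le_div_iff₀ (by positivity)] at h2
      rw [hN, le_div_iff₀ (by positivity)]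
      linarith
  have hcoef : ∀ t ∈ Ico 0 Tm, ∀ x,
      riccatiCoeff κ γ γt ε (v t x) ≤ C / ε ^ lifespanExponent γ := fun t ht x =>
    HC ε hε hε1 _ (hs.solves.one_lt t ht x)
      (by linarith [hs.riemann_le hd hp hI ht x, abs_nonneg (u t x)])
  -- The product is Tm / m < 1, so the weighted gradients stay bounded below up to Tm. They are also
  -- bounded above, which contradicts maximality.
  have hNT : N * (C / ε ^ lifespanExponent γ) * Tm < 1 := by
    rw [hN, show ε ^ lifespanExponent γ / (C * m) * (C / ε ^ lifespanExponent γ) * Tm = Tm / m by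
      field_simp, div_lt_one hm0]
    exact hcon
  have low : ∀ s : ℝ, s * s = 1 → (∀ x, -N ≤ initialGrad κ γ γt ε s v₀ u₀ x) → ∀ t ∈ Ico 0 Tm,
      ∀ x, -(N / (1 - N * (C / ε ^ lifespanExponent γ) * Tm)) ≤
        weightedGrad κ γ γt ε s v u (t, x) := fun s hs1 hs2 t ht x =>
    hs.weightedGrad_ge hd hp hI hs1 hN0 (by positivity) hs2 hcoef (fun t ht => ht.2.le) hNT ht x
  have low₁ := low 1 (by norm_num) fun x => by
    rw [(h.initialGrad_eq hp x).1]
    have h1 := mul_le_mul_of_nonneg_left (le_max_left (-(deriv (riemannW κ γ γt ε v₀ u₀) x))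
      (-(deriv (riemannZ κ γ γt ε v₀ u₀) x))) (h.sqrt_soundSpeed_pos hp x).le
    have h2 := hcomp x
    rw [compression] at h2
    linarith
  have low₂ := low (-1) (by norm_num) fun x => by
    rw [(h.initialGrad_eq hp x).2]
    have h1 := mul_le_mul_of_nonneg_left (le_max_right (-(deriv (riemannW κ γ γt ε v₀ u₀) x))
      (-(deriv (riemannZ κ γ γt ε v₀ u₀) x))) (h.sqrt_soundSpeed_pos hp x).le
    have h2 := hcomp x
    rw [compression] at h2
    linarith
  set L := N / (1 - N * (C / ε ^ lifespanExponent γ) * Tm) with hL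
  refine hs.false_of_abs_weightedGrad_le hd hp hTm rfl hmax (N := max L (max Y₀ Q₀))
    (fun t ht x => abs_le.mpr ⟨?_, ?_⟩) (fun t ht x => abs_le.mpr ⟨?_, ?_⟩)
  · exact (neg_le_neg (le_max_left _ _)).trans (low₁ t ht x)
  · exact (hs.weightedGrad_le hd hp hI (by norm_num) (h.initialGrad_one_le hp) ht x).trans
      (le_max_of_le_right (le_max_left _ _))
  · exact (neg_le_neg (le_max_left _ _)).trans (low₂ t ht x)
  · exact (hs.weightedGrad_le hd hp hI (by norm_num) (h.initialGrad_neg_one_le hp) ht x).trans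
      (le_max_of_le_right (le_max_right _ _))

end

end PSystem

theorem theorem1p5 (κ γ γt : ℝ) (hκ : 0 < κ) (hγ : 1 < γ) (hγt : γt ∈ Set.Ioo (1 : ℝ) 3) :
    ∃ ε₀ : ℝ, 0 < ε₀ ∧
    ∀ M₁ M₂ Y₀ Q₀ : ℝ, 0 < M₁ → 0 < M₂ → 0 < Y₀ → 0 < Q₀ →
    ∃ (K : ℝ → ℝ) (C : ℝ), 0 < C ∧
    ∀ ε : ℝ, 0 < ε → ε ≤ ε₀ →
    ∀ v₀ u₀ : ℝ → ℝ, PSystem.AdmissibleData κ γ γt M₁ M₂ Y₀ Q₀ ε v₀ u₀ →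
      -- everywhere rarefactive data: a unique global solution, bounded uniformly in `ε`
      ((∀ x, PSystem.RarefactiveAt κ γ γt ε v₀ u₀ x) →
        ∃ v u : ℝ → ℝ → ℝ,
          PSystem.IsC1Solution κ γ γt ε v₀ u₀ (Set.Ici 0) v u ∧
          (∀ v' u' : ℝ → ℝ → ℝ, PSystem.IsC1Solution κ γ γt ε v₀ u₀ (Set.Ici 0) v' u' →
            PSystem.AgreeOn (Set.Ici 0) v u v' u') ∧
          (∀ T : ℝ, 0 < T → ∀ v' u' : ℝ → ℝ → ℝ,
            PSystem.IsC1Solution κ γ γt ε v₀ u₀ (Set.Ico 0 T) v' u' →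
            PSystem.AgreeOn (Set.Ico 0 T) v u v' u') ∧
          (∀ T : ℝ, 0 < T → ∀ t ∈ Set.Icc 0 T, ∀ x,
            |v t x| ≤ K T ∧ |u t x| ≤ K T ∧
            |deriv (fun y => v t y) x| ≤ K T ∧ |deriv (fun y => u t y) x| ≤ K T ∧
            |derivWithin (fun s => v s x) (Set.Ici 0) t| ≤ K T ∧
            |derivWithin (fun s => u s x) (Set.Ici 0) t| ≤
              K T * ε ^ (-(1 / (2 * (γ - 1)))))) ∧
      -- otherwise: a unique maximal solution, whose gradient blows up at a finite time
      ((∃ x, ¬ PSystem.RarefactiveAt κ γ γt ε v₀ u₀ x) →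
        ∃ (Tstar : ℝ) (v u : ℝ → ℝ → ℝ), 0 < Tstar ∧
          PSystem.IsC1Solution κ γ γt ε v₀ u₀ (Set.Ico 0 Tstar) v u ∧
          (∀ T : ℝ, 0 < T → ∀ v' u' : ℝ → ℝ → ℝ,
            PSystem.IsC1Solution κ γ γt ε v₀ u₀ (Set.Ico 0 T) v' u' →
            T ≤ Tstar ∧ PSystem.AgreeOn (Set.Ico 0 T) v u v' u') ∧
          (∀ M : ℝ, ∀ᶠ t in nhdsWithin Tstar (Set.Iio Tstar), ∃ x,
            M < max |deriv (fun y => v t y) x| |deriv (fun y => u t y) x|) ∧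
          (⨅ x : {x : ℝ // 0 < PSystem.compression κ γ γt ε v₀ u₀ x},
            ε ^ PSystem.lifespanExponent γ /
              (C * Real.sqrt (PSystem.soundSpeed κ γ γt ε (v₀ x)) *
                PSystem.compression κ γ γt ε v₀ u₀ x)) ≤ Tstar) := by
  -- ε ≤ 1 is needed only to compare powers: 1 ≤ ε^(-1/(γ - 1)) in the bound on c, and ε^(1/(γ + 1))
  -- ≤ 1 when γ > 3.
  refine ⟨1, one_pos, fun M₁ M₂ Y₀ Q₀ hM₁ hM₂ hY₀ hQ₀ => ?_⟩
  obtain ⟨K, hK⟩ := PSystem.exists_global_bound hκ hγ hγt hM₁ hM₂ hY₀ hQ₀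
  obtain ⟨C, hC, hC'⟩ := PSystem.exists_lifespan_bound hκ hγ hγt hM₁ hM₂ hY₀ hQ₀
  exact ⟨K, C, hC, fun ε hε hε1 v₀ u₀ h => ⟨hK ε hε hε1 v₀ u₀ h, hC' ε hε hε1 v₀ u₀ h⟩⟩
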